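/- **Setting.** Let $\mathcal H$ be the set of hyperplanes $H(\alpha,u)=\{x\in\mathbb R^\ell:\langle x,u\rangle=\alpha\}$, $\alpha\in\mathbb R$, $u\in\mathbb S^{\ell-1}_+$ (unit vectors with nonnegative last coordinate), with the topology and $\sigma$-algebra induced from the parameters $(\alpha,u)$. Put $H^-=\{x:\langle x,u\rangle\le\alpha\}$ and $H^+=\{x:\langle x,u\rangle\ge\alpha\}$; where a hyperplane has two parameters (last coordinate of $u$ equal to $0$), one of them is chosen, by an arbitrary but fixed rule that is measurable in $H$. For $B\subseteq\mathbb R^\ell$ let $[B]=\{H\in\mathcal H:H\cap B\ne\emptyset\}$. Let $\Lambda\neq0$ be a translation invariant measure on $\mathcal H$ with $\Lambda([B])<\infty$ for all bounded Borel sets $B$, and such that no line is parallel to all hyperplanes in the support of $\Lambda$. Put $\widehat\Lambda_{[C]}=\Lambda([C])^{-1}\Lambda|_{[C]}$. A window or cell is a polytope with nonempty interior. Let $W$ be a window. A tessellation $T$ of $W$ is a finite set of cells with pairwise disjoint interiors and union $W$; $\partial T=\bigcup_{C\in T}\partial C$, $\#T$ is the number of cells, and $\zeta(T)=\sum_{C\in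 T}\Lambda([C])$. The set $\mathbb T\wedge W$ of tessellations of $W$ carries the $\sigma$-algebra generated by the sets $\{T:\partial T\cap K=\emptyset\}$, $K\subseteq W$ compact. **Binary tree.** Let $\mathcal E^*$ be the set of finite words over $\{-,+\}$, $o$ the empty word, ordered by length and then lexicographically with $-<+$; $\mathrm{Succ}(e)=\{e-,e+\}$. For $k\ge0$ let $\Theta_k$ be the set of $R=(r_0,\dots,r_{2k})\in(\mathcal E^*)^{2k+1}$ with pairwise different entries, $r_0=o$, and such that for each $l\in\{1,\dots,k\}$ there is $j\in\{0,\dots,2l-2\}$ with $\{r_{2l-1},r_{2l}\}=\mathrm{Succ}(r_j)$ and $r_{2l-1}<r_{2l}$. Then $R^{(s)}=(r_0,\dots,r_{2s})$ for $0\le s\le k$, $r^*_s$ for $0\le s<k$ is the word with $\mathrm{Succ}(r^*_s)=\{r_{2s+1},r_{2s+2}\}$, and the leaves $\mathcal L(R^{(s)})$ are the entries of $R^{(s)}$ none of whose successors is an entry of $R^{(s)}$. **STIT process.** On a probability space let $(Z(e))_{e\in\mathcal E^*}$ and $(G_n)_{n\ge1}$ be two independent families of independent random variables, $Z(e)\sim\mathrm{Exponential}(1)$,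 $G_n\sim\widehat\Lambda_{[W]}$. Put $C(o)=W$, $\kappa(o)=1$; for $e\ne o$, $\kappa(e)=\inf\{n: G_n\in[C(e)],\ n>\kappa(e')\text{ for all }e'<e\}$; $H(e)=G_{\kappa(e)}$ and $C(e\pm)=C(e)\cap H(e)^\pm$. The cell $C(e)$ has lifetime $t_l(e)=\Lambda([C(e)])^{-1}Z(e)$ and birth time $t_b(e)$, where $t_b(o)=0$ and $t_b(e\pm)=t_b(e)+t_l(e)$. Finally $(Y\wedge W)_t=\{C(e): t_b(e)\le t<t_b(e)+t_l(e)\}$. **Claim.** Let $t\ge0$, let $k\ge1$ be an integer and let $A\subseteq\mathbb T\wedge W$ be measurable. Then $$ \begin{aligned} \mathbb P\big(\#(Y\wedge W)_t=k+1,\ (Y\wedge W)_t\in A\big) =\sum_{R\in\Theta_k}&\int\! d\widehat\Lambda_{[C(r^*_0)]}(H_1)\int\! d\widehat\Lambda_{[C(r^*_1)]}(H_2)\cdots\int\! d\widehat\Lambda_{[C(r^*_{k-1})]}(H_k)\\ &\int_0^t\! dw_1\int_0^{t-w_1}\! dw_2\cdots\int_0^{t-\sum_{j=1}^{k-1}w_j}\!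 dw_k\ \prod_{s=0}^{k-1}\Lambda([C(r^*_s)])\\ &\times\exp\Big[-\sum_{s=0}^{k-1}\zeta(T^{(s)}(R))\,w_{s+1}\Big]\exp\Big[-\zeta(T^{(k)}(R))\Big(t-\sum_{j=1}^k w_j\Big)\Big]\mathbf 1_A(T^{(k)}(R)). \end{aligned} $$ On the right-hand side the cells are functions of $R$ and $H_1,\dots,H_k$: $C(o)=W$ and $C(r^*_s\,\pm)=C(r^*_s)\cap H_{s+1}^\pm$ for $0\le s<k$; and $T^{(s)}(R)=\{C(r):r\in\mathcal L(R^{(s)})\}$ for $0\le s\le k$. -/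

import Mathlib

open MeasureTheory ProbabilityTheory Set
open scoped ENNReal

noncomputable section

namespace STIT

/-! ### Hyperplanes -/

/-- Euclidean space `ℝ^ℓ`. -/
abbrev Space (ℓ : ℕ) : Type := EuclideanSpace ℝ (Fin ℓ)

/-- The upper half unit sphere: unit vectors whose last coordinate is nonnegative. -/
def upperSphere (ℓ : ℕ) : Set (Space ℓ) :=
  {u | ‖u‖ = 1 ∧ ∀ i : Fin ℓ, (i : ℕ) + 1 = ℓ → 0 ≤ u i}

/-- Parameters `(α, u)` of hyperplanes. -/
abbrev Param (ℓ : ℕ) : Type := ℝ × upperSphere ℓ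

/-- `H(α, u) = {x | ⟨x, u⟩ = α}`. -/
def plane {ℓ : ℕ} (q : Param ℓ) : Set (Space ℓ) :=
  {x | inner ℝ x (q.2 : Space ℓ) = q.1}

/-- The closed half-spaces of `(α, u)`: `false` stands for `-`, `true` for `+`. -/
def half {ℓ : ℕ} (q : Param ℓ) : Bool → Set (Space ℓ)
  | false => {x | inner ℝ x (q.2 : Space ℓ) ≤ q.1}
  | true => {x | q.1 ≤ inner ℝ x (q.2 : Space ℓ)}

/-- The set of all hyperplanes of `ℝ^ℓ`. -/
def Hyperplane (ℓ : ℕ) : Type :=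
  {h : Set (Space ℓ) // ∃ q : Param ℓ, h = plane q}

/-- The parameterization `(α, u) ↦ H(α, u)`. -/
def ofParam {ℓ : ℕ} (q : Param ℓ) : Hyperplane ℓ := ⟨plane q, q, rfl⟩

/-- The topology induced from the parameter space. -/
instance (ℓ : ℕ) : TopologicalSpace (Hyperplane ℓ) :=
  TopologicalSpace.coinduced ofParam inferInstance

/-- The `σ`-algebra induced from the Borel `σ`-algebra of the parameter space. -/
instance (ℓ : ℕ) : MeasurableSpace (Hyperplane ℓ) :=
  MeasurableSpace.map ofParam inferInstance

/-- `[B]`, the set of hyperplanes that meet `B`. -/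
def hit {ℓ : ℕ} (B : Set (Space ℓ)) : Set (Hyperplane ℓ) :=
  {h | (h.1 ∩ B).Nonempty}

theorem image_add_plane {ℓ : ℕ} (v : Space ℓ) (q : Param ℓ) :
    (fun x => v + x) '' plane q = plane (q.1 + inner ℝ v (q.2 : Space ℓ), q.2) := by
  ext y
  simp only [plane, mem_image, mem_ofPred_eq]
  constructor
  · rintro ⟨x, hx, rfl⟩
    rw [inner_add_left, hx, add_comm]
  · intro hy
    refine ⟨y - v, ?_, by simp⟩
    rw [inner_sub_left, hy]
    ring

/-- The translate `v + h` of a hyperplane. -/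
def translate {ℓ : ℕ} (v : Space ℓ) (h : Hyperplane ℓ) : Hyperplane ℓ :=
  ⟨(fun x => v + x) '' h.1, by
    obtain ⟨_, q, rfl⟩ := h
    exact ⟨_, image_add_plane v q⟩⟩

/-- The standing assumptions on the hyperplane measure. -/
structure IsHyperplaneMeasure {ℓ : ℕ} (Λ : Measure (Hyperplane ℓ)) : Prop where
  ne_zero : Λ ≠ 0
  translation_invariant : ∀ v : Space ℓ, MeasurePreserving (translate v) Λ Λ
  locally_finite : ∀ B : Set (Space ℓ), MeasurableSet B → Bornology.IsBounded B → Λ (hit B) < ∞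
  /-- No line (with direction `v`) is parallel to all hyperplanes of the support. -/
  not_parallel : ¬ ∃ v : Space ℓ, v ≠ 0 ∧ ∀ h ∈ Λ.support, ∀ x ∈ h.1, x + v ∈ h.1

/-- The normalized restriction of `Λ` to `[C]`. -/
def normalized {ℓ : ℕ} (Λ : Measure (Hyperplane ℓ)) (C : Set (Space ℓ)) :
    Measure (Hyperplane ℓ) :=
  (Λ (hit C))⁻¹ • Λ.restrict (hit C)

/-! ### Tessellations of a window -/

/-- Cells and windows: polytopes with nonempty interior. -/
def IsCell {ℓ : ℕ} (C : Set (Space ℓ)) : Prop :=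
  (∃ S : Finset (Space ℓ), C = convexHull ℝ (S : Set (Space ℓ))) ∧ (interior C).Nonempty

/-- `T` is a tessellation of `W`. For a bounded `W`, local finiteness is finiteness. -/
structure IsTessellation {ℓ : ℕ} (W : Set (Space ℓ)) (T : Set (Set (Space ℓ))) : Prop where
  finite : T.Finite
  isCell : ∀ C ∈ T, IsCell C
  disjoint : T.PairwiseDisjoint interior
  cover : ⋃₀ T = W

/-- The set of tessellations of `W`. -/
def Tessellation {ℓ : ℕ} (W : Set (Space ℓ)) : Type :=
  {T : Set (Set (Space ℓ)) // IsTessellation W T}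

/-- `∂T`, the union of the cell boundaries. -/
def boundary {ℓ : ℕ} (T : Set (Set (Space ℓ))) : Set (Space ℓ) := ⋃ C ∈ T, frontier C

/-- The `σ`-algebra generated by the sets `{T | ∂T ∩ K = ∅}`, `K ⊆ W` compact. -/
instance {ℓ : ℕ} (W : Set (Space ℓ)) : MeasurableSpace (Tessellation W) :=
  MeasurableSpace.generateFrom
    {B | ∃ K : Set (Space ℓ), K ⊆ W ∧ IsCompact K ∧ B = {T | boundary T.1 ∩ K = ∅}}

/-- `ζ(T) = ∑_{C ∈ T} Λ([C])`. -/
def zeta {ℓ : ℕ} (Λ : Measure (Hyperplane ℓ)) (T : Set (Set (Space ℓ))) : ℝ≥0∞ :=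
  ∑' C : T, Λ (hit (C : Set (Space ℓ)))

/-! ### The binary tree -/

/-- Words over `{-, +}` (`false` for `-`, `true` for `+`), last letter first: `e₁ e₂ … eₖ` is
stored as `[eₖ, …, e₂, e₁]`, so that `b :: e` is `e` followed by the letter `b`, and the
predecessor of a nonempty word is its tail. -/
abbrev Word : Type := List Bool

namespace Word

/-- The order on words: first by length, then lexicographic with `- < +`. -/
def lt (e e' : Word) : Prop := List.Shortlex (· < ·) e.reverse e'.reverse

theorem lt_wf : WellFounded lt :=
  InvImage.wf List.reverse (List.Shortlex.wf wellFounded_lt)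

theorem lt_cons (b : Bool) (e : Word) : lt e (b :: e) :=
  List.Shortlex.of_length_lt (by simp)

/-- The two successors of a word. -/
def succ (e : Word) : Set Word := {false :: e, true :: e}

/-- The predecessor of a nonempty word. -/
def pred (e : Word) : Word := e.tail

end Word

/-! ### Construction of the STIT process

Everything in this section is for one realization: `g n` is the hyperplane `G_{n+1}` (the
sequence is numbered from `0`), `z e` is the standard exponential variable of the word `e`,
and `p` chooses parameters `(α, u)` of each hyperplane, which fixes its sides `-` and `+`. -/

/-- The cells, when the cell of the word `e` is divided by the hyperplane `h e`. -/
def cell {ℓ : ℕ} (p : Hyperplane ℓ → Param ℓ) (W : Set (Space ℓ)) (h : Word → Hyperplane ℓ) :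
    Word → Set (Space ℓ)
  | [] => W
  | b :: e => cell p W h e ∩ half (p (h e)) b

theorem cell_congr {ℓ : ℕ} (p : Hyperplane ℓ → Param ℓ) (W : Set (Space ℓ))
    {h h' : Word → Hyperplane ℓ} (e : Word) (hh : ∀ f, Word.lt f e → h f = h' f) :
    cell p W h e = cell p W h' e := by
  induction e with
  | nil => rfl
  | cons b e ih =>
    have hlt : ∀ f, Word.lt f e → Word.lt f (b :: e) := fun f hf => by
      refine List.Shortlex.of_length_lt ?_
      rcases List.shortlex_def.1 hf with h1 | ⟨h1, _⟩ <;> simp at h1 ⊢ <;> omega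
    simp only [cell]
    rw [ih fun f hf => hh f (hlt f hf), hh e (Word.lt_cons b e)]

open Classical in
/-- The index `κ(e)` of the hyperplane that divides the cell of `e`, by recursion along the order
of words; `kappa_nil` and `kappa_eq` below are the defining equations. -/
def kappa {ℓ : ℕ} (p : Hyperplane ℓ → Param ℓ) (W : Set (Space ℓ)) (g : ℕ → Hyperplane ℓ) :
    Word → ℕ :=
  Word.lt_wf.fix fun e ih =>
    if e = [] then 0
    else sInf {n | g n ∈ hit (cell p W (fun f => g (if hf : Word.lt f e then ih f hf else 0)) e) ∧
      ∀ f, ∀ hf : Word.lt f e, ih f hf < n}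

/-- The hyperplane `H(e) = G_{κ(e)}`. -/
def divider {ℓ : ℕ} (p : Hyperplane ℓ → Param ℓ) (W : Set (Space ℓ)) (g : ℕ → Hyperplane ℓ)
    (e : Word) : Hyperplane ℓ :=
  g (kappa p W g e)

/-- The cell `C(e)`: `C(o) = W`, `C(e ±) = C(e) ∩ H^±(e)`. -/
def stitCell {ℓ : ℕ} (p : Hyperplane ℓ → Param ℓ) (W : Set (Space ℓ)) (g : ℕ → Hyperplane ℓ) :
    Word → Set (Space ℓ) :=
  cell p W (divider p W g)

theorem kappa_nil {ℓ : ℕ} (p : Hyperplane ℓ → Param ℓ) (W : Set (Space ℓ))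
    (g : ℕ → Hyperplane ℓ) : kappa p W g [] = 0 := by
  rw [kappa, WellFounded.fix_eq]
  simp

open Classical in
theorem kappa_eq {ℓ : ℕ} (p : Hyperplane ℓ → Param ℓ) (W : Set (Space ℓ))
    (g : ℕ → Hyperplane ℓ) (e : Word) (he : e ≠ []) :
    kappa p W g e = sInf {n | g n ∈ hit (stitCell p W g e) ∧
      ∀ f, Word.lt f e → kappa p W g f < n} := by
  have hc : cell p W
      (fun f => g (if Word.lt f e then kappa p W g f else 0)) e = stitCell p W g e :=
    cell_congr p W e fun f hf => by simp [divider, hf]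
  rw [← hc]
  conv_lhs => rw [kappa, WellFounded.fix_eq, if_neg he]
  simp only [dite_eq_ite]
  rfl

/-- The lifetime `Λ([C(e)])⁻¹ Z(e)` of the cell `C(e)`. -/
def lifetime {ℓ : ℕ} (Λ : Measure (Hyperplane ℓ)) (p : Hyperplane ℓ → Param ℓ)
    (W : Set (Space ℓ)) (z : Word → ℝ) (g : ℕ → Hyperplane ℓ) (e : Word) : ℝ :=
  (Λ (hit (stitCell p W g e))).toReal⁻¹ * z e

/-- The time at which the cell `C(e)` is born. -/
def birth {ℓ : ℕ} (Λ : Measure (Hyperplane ℓ)) (p : Hyperplane ℓ → Param ℓ)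
    (W : Set (Space ℓ)) (z : Word → ℝ) (g : ℕ → Hyperplane ℓ) : Word → ℝ
  | [] => 0
  | _ :: e => birth Λ p W z g e + lifetime Λ p W z g e

/-- `E_t`, the set of words whose cell is alive at time `t`. -/
def alive {ℓ : ℕ} (Λ : Measure (Hyperplane ℓ)) (p : Hyperplane ℓ → Param ℓ)
    (W : Set (Space ℓ)) (z : Word → ℝ) (g : ℕ → Hyperplane ℓ) (t : ℝ) : Set Word :=
  {e | birth Λ p W z g e ≤ t ∧ t < birth Λ p W z g e + lifetime Λ p W z g e}

/-- The STIT process `(Y ∧ W)_t = {C(e) | e ∈ E_t}`. -/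
def stit {ℓ : ℕ} (Λ : Measure (Hyperplane ℓ)) (p : Hyperplane ℓ → Param ℓ)
    (W : Set (Space ℓ)) (z : Word → ℝ) (g : ℕ → Hyperplane ℓ) (t : ℝ) : Set (Set (Space ℓ)) :=
  stitCell p W g '' alive Λ p W z g t

/-- The random input of the construction: two independent families of independent random
variables, `Z(e)` standard exponential and `G_n` with the normalized restriction of `Λ` to `[W]`
as law. -/
structure IsStitInput {ℓ : ℕ} {Ω : Type*} [MeasurableSpace Ω] (P : Measure Ω)
    (Λ : Measure (Hyperplane ℓ)) (W : Set (Space ℓ)) (Z : Word → Ω → ℝ)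
    (G : ℕ → Ω → Hyperplane ℓ) : Prop where
  measurable_Z : ∀ e, Measurable (Z e)
  measurable_G : ∀ n, Measurable (G n)
  law_Z : ∀ e, P.map (Z e) = expMeasure 1
  law_G : ∀ n, P.map (G n) = normalized Λ W
  indep_Z : iIndepFun Z P
  indep_G : iIndepFun G P
  indep : IndepFun (fun ω e => Z e ω) (fun ω n => G n ω) P

/-! ### Growth sequences -/

/-- `R = (r₀, …, r_{2k})` belongs to `Θ_k`. -/
structure IsGrowth {k : ℕ} (R : Fin (2 * k + 1) → Word) : Prop where
  root : R 0 = []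
  injective : Function.Injective R
  grow : ∀ l : Fin k, ∃ j : Fin (2 * k + 1), (j : ℕ) ≤ 2 * l ∧
    ({R ⟨2 * l + 1, by omega⟩, R ⟨2 * l + 2, by omega⟩} : Set Word) = Word.succ (R j) ∧
    Word.lt (R ⟨2 * l + 1, by omega⟩) (R ⟨2 * l + 2, by omega⟩)

/-- The initial segment `R^{(s)} = (r₀, …, r_{2s})`. -/
def initial {k : ℕ} (R : Fin (2 * k + 1) → Word) (s : ℕ) (hs : s ≤ k) :
    Fin (2 * s + 1) → Word :=
  fun i => R ⟨i, by omega⟩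

/-- The set of leaves of a tuple of words. -/
def leaves {n : ℕ} (R : Fin n → Word) : Set Word :=
  {r ∈ range R | Word.succ r ∩ range R = ∅}

/-- `r*_s`, the common predecessor of `r_{2s+1}` and `r_{2s+2}` (used for `s < k` only). -/
def splitWord {k : ℕ} (R : Fin (2 * k + 1) → Word) (s : ℕ) : Word :=
  if h : 2 * s + 1 < 2 * k + 1 then Word.pred (R ⟨2 * s + 1, h⟩) else []

/-- The cell `C(r)` when `C(r*_0), …, C(r*_{n-1})` are divided by the hyperplanes
`H 0, …, H (n-1)` (numbered from `1` in the usual notation). -/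
def growthCell {ℓ k : ℕ} (p : Hyperplane ℓ → Param ℓ) (W : Set (Space ℓ))
    (R : Fin (2 * k + 1) → Word) {n : ℕ} (H : Fin n → Hyperplane ℓ) : Word → Set (Space ℓ)
  | [] => W
  | b :: e => growthCell p W R H e ∩ {x | ∀ i : Fin n, splitWord R i = e → x ∈ half (p (H i)) b}

/-- `T^{(s)}(R) = {C(r) | r a leaf of R^{(s)}}`. -/
def growthTess {ℓ k : ℕ} (p : Hyperplane ℓ → Param ℓ) (W : Set (Space ℓ))
    (R : Fin (2 * k + 1) → Word) {n : ℕ} (H : Fin n → Hyperplane ℓ) (s : ℕ) (hs : s ≤ k) :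
    Set (Set (Space ℓ)) :=
  growthCell p W R H '' leaves (initial R s hs)

/-- The iterated integral `∫ μ₀(dx₁) ∫ μ₁(x₁; dx₂) … ∫ μ_{k-1}(x₁, …, x_{k-1}; dx_k) F(x₁, …, x_k)`,
with the integral over `x_k` innermost. -/
def iterLintegral {X : Type*} [MeasurableSpace X] (μ : ∀ s : ℕ, (Fin s → X) → Measure X) :
    ∀ k : ℕ, ((Fin k → X) → ℝ≥0∞) → ℝ≥0∞
  | 0, F => F Fin.elim0
  | k + 1, F => iterLintegral μ k fun x => ∫⁻ y, F (Fin.snoc (α := fun _ => X) x y) ∂(μ k x)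

/-- `∫ dΛ̂_{[C(r*_0)]}(H₁) … ∫ dΛ̂_{[C(r*_{k-1})]}(H_k) F(H₁, …, H_k)`. -/
def planeIntegral {ℓ k : ℕ} (Λ : Measure (Hyperplane ℓ)) (p : Hyperplane ℓ → Param ℓ)
    (W : Set (Space ℓ)) (R : Fin (2 * k + 1) → Word)
    (F : (Fin k → Hyperplane ℓ) → ℝ≥0∞) : ℝ≥0∞ :=
  iterLintegral (fun s H => normalized Λ (growthCell p W R H (splitWord R s))) k F

/-- `∫₀ᵗ dw₁ ∫₀^{t-w₁} dw₂ … ∫₀^{t-(w₁+…+w_{k-1})} dw_k F(w₁, …, w_k)`. -/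
def timeIntegral (t : ℝ) (k : ℕ) (F : (Fin k → ℝ) → ℝ≥0∞) : ℝ≥0∞ :=
  iterLintegral (fun _ w => volume.restrict (Icc 0 (t - ∑ i, w i))) k F

end STIT

end

/-!
The process at time `t` has `k + 1` cells exactly when `k` cells have been divided before, and the
words of these cells, listed in the order of their times of division, determine a unique growth
sequence `R`. The event on the left-hand side therefore splits, up to a null set, into the disjoint
events that the divisions up to time `t` are those of `R`, in this order (`IsHistory`), and that the
resulting cells form a tessellation in `A` (`stit_mem_iff_exists_growth`). It remains to compute the
probability of one such event. Since the exponential variables are independent of the hyperplanes,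
this is done in two stages.

*The hyperplanes.* The index `κ(e)` depends on all words before `e`, so that the dividing
hyperplanes of the words of `R` are not found in the sequence `G` in the order of their divisions.
Their joint law, however, does not depend on any order: for a finite set `D` of words that is closed
under predecessors, the hyperplanes `H(e)`, `e ∈ D`, have the density `∏ 1{H(e) ∈ [C(e)]} / ν[C(e)]`
with respect to independent hyperplanes with the law `ν` of the `G n` (`dividerDensity`,
`hasDividerLaw`). This is proved along the order on words: `H(e)` is the first term of an i.i.d.
sequence, after the indices of the preceding words, that hits `C(e)`, and summation over the number
of terms that miss `C(e)` gives a geometric series (`lintegral_iid_first_hit`,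
`lintegral_divider_step`). The same product density arises from the iterated integral over the
hyperplanes in the order of division (`iterLintegral_normalized_eq`), which yields the outer
integrals of the formula.

*The times.* Given the hyperplanes, the cell of `e` has a lifetime with rate `Λ([C(e)])`. Integrating
out the lifetimes of the leaves, and then those of the divided words from the last division to the
first, with lack of memory at each step, gives the integral over the waiting times between
successive divisions (`measure_inOrder_and_leaves`). The exponents combine because the total
lifetime of all cells, weighted by their rates, is the integral of the total rate of the current
leaves (`sum_lifetimes_eq`).

Three null sets have to be excluded. Hyperplanes that touch a cell without dividing it properly
pass through one of its vertices, and translation invariance implies that almost no hyperplane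
passes through a given point (`IsCell.ae_cuts`); hence all `C(e)` are polytopes with interior points.
Infinitely many births up to time `t` are excluded by the finiteness of the expected discounted
number of births (`ae_finite_startTime_le`; all rates are at most `Λ([W])`), and simultaneous
divisions by the absence of atoms of the exponential law (`ae_injective_deathTime`).

All uses of Fubini's theorem on the infinite products are instances of `lintegral_resample`: one
coordinate may be replaced by an independent copy.
-/

namespace STIT

/-! ### Resampling coordinates of an infinite product -/

section Resample

variable {ι : Type*} [DecidableEq ι] {X : ι → Type*} [∀ i, MeasurableSpace (X i)]
  (μ : ∀ i, Measure (X i)) [∀ i, IsProbabilityMeasure (μ i)]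

theorem measurable_update_prod (i : ι) :
    Measurable fun q : (∀ j, X j) × X i => Function.update q.1 i q.2 := by
  refine measurable_pi_iff.2 fun j => ?_
  by_cases h : j = i
  · subst h; simpa using measurable_snd
  · simp only [Function.update_of_ne h]
    exact (measurable_pi_apply j).comp measurable_fst

theorem map_update_infinitePi (i : ι) :
    ((Measure.infinitePi μ).prod (μ i)).map (fun q => Function.update q.1 i q.2) =
      Measure.infinitePi μ := by
  have hm := measurable_update_prod (X := X) i
  refine Measure.eq_infinitePi _ fun s t ht => ?_
  rw [Measure.map_apply hm (MeasurableSet.pi s.countable_toSet fun j _ => ht j)]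
  have hpre : (fun q : (∀ j, X j) × X i => Function.update q.1 i q.2) ⁻¹' (Set.pi s t) =
      (Set.pi (s.erase i) t) ×ˢ (if i ∈ s then t i else univ) := by
    ext q
    simp only [mem_preimage, Set.mem_pi, Finset.mem_coe, mem_prod, Finset.mem_erase]
    constructor
    · intro h
      refine ⟨fun j hj => by simpa [Function.update_of_ne hj.1] using h j hj.2, ?_⟩
      split_ifs with hi
      · simpa using h i hi
      · trivial
    · rintro ⟨h1, h2⟩ j hj
      by_cases hji : j = i
      · subst hji; simpa [hj] using h2
      · simpa [Function.update_of_ne hji] using h1 j ⟨hji, hj⟩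
  rw [hpre, Measure.prod_prod, Measure.infinitePi_pi _ fun j _ => ht j]
  split_ifs with hi
  · rw [mul_comm]
    exact Finset.mul_prod_erase s (fun j => μ j (t j)) hi
  · simp [Finset.erase_eq_of_notMem hi]

/-- A coordinate of an infinite product may be replaced by an independent copy. This is the only
form of Fubini's theorem on infinite products that is used. -/
theorem lintegral_resample (i : ι) {f : (∀ j, X j) → ℝ≥0∞} (hf : Measurable f) :
    ∫⁻ g, f g ∂(Measure.infinitePi μ) =
      ∫⁻ g, ∫⁻ y, f (Function.update g i y) ∂(μ i) ∂(Measure.infinitePi μ) := by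
  conv_lhs => rw [← map_update_infinitePi μ i]
  rw [lintegral_map hf (measurable_update_prod i),
    lintegral_prod (fun q : (∀ j, X j) × X i => f (Function.update q.1 i q.2))
      (hf.comp (measurable_update_prod i)).aemeasurable]

/-- If for every value of the other coordinates a measurable property holds for almost every value
of coordinate `i`, it holds almost surely. -/
theorem ae_resample (i : ι) {s : Set (∀ j, X j)} (hs : MeasurableSet s)
    (h : ∀ g, ∀ᵐ y ∂(μ i), Function.update g i y ∈ s) :
    ∀ᵐ g ∂(Measure.infinitePi μ), g ∈ s := by
  rw [ae_iff]
  change Measure.infinitePi μ sᶜ = 0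
  rw [← lintegral_indicator_one hs.compl, lintegral_resample μ i (measurable_one.indicator hs.compl)]
  refine (lintegral_congr fun g => ?_).trans lintegral_zero
  refine (lintegral_congr_ae ?_).trans lintegral_zero
  filter_upwards [h g] with y hy
  simp [hy]

end Resample

section Tail

variable {X : Type*} [MeasurableSpace X] (ν : Measure X) [IsProbabilityMeasure ν]

/-- In an i.i.d. sequence, the probability that `j` consecutive terms miss a set determined by the
terms before them. -/
theorem lintegral_iid_miss (n j : ℕ) {Ψ : (ℕ → X) → ℝ≥0∞} (hΨ : Measurable Ψ)
    (hΨd : DependsOn Ψ (Iic n)) {S : (ℕ → X) → Set X}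
    (hS : MeasurableSet {q : (ℕ → X) × X | q.2 ∈ S q.1}) (hSd : DependsOn S (Iic n)) :
    ∫⁻ g, Ψ g * ∏ i ∈ Finset.range j, (S g)ᶜ.indicator 1 (g (n + 1 + i))
        ∂(Measure.infinitePi fun _ : ℕ => ν) =
      ∫⁻ g, Ψ g * (ν (S g)ᶜ) ^ j ∂(Measure.infinitePi fun _ : ℕ => ν) := by
  classical
  have hind : Measurable fun q : (ℕ → X) × X => (S q.1)ᶜ.indicator (1 : X → ℝ≥0∞) q.2 := by
    have : (fun q : (ℕ → X) × X => (S q.1)ᶜ.indicator (1 : X → ℝ≥0∞) q.2) =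
        {q : (ℕ → X) × X | q.2 ∈ S q.1}ᶜ.indicator 1 := by
      ext q; by_cases h : q.2 ∈ S q.1 <;> simp [h]
    rw [this]
    exact measurable_one.indicator hS.compl
  have hc : Measurable fun g => ν (S g)ᶜ := by
    have := measurable_measure_prodMk_left (ν := ν) hS.compl
    exact this
  have hupd : ∀ (i : ℕ) (g : ℕ → X) (y : X), ∀ m ∈ Iic n, Function.update g (n + 1 + i) y m = g m :=
    fun i g y m hm => Function.update_of_ne (by simp at hm; omega) _ _
  induction j generalizing Ψ with
  | zero => simp
  | succ j ih =>
    have hmeas : Measurable fun g : ℕ → X => Ψ g *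
        ∏ i ∈ Finset.range (j + 1), (S g)ᶜ.indicator (1 : X → ℝ≥0∞) (g (n + 1 + i)) := by
      refine hΨ.mul (Finset.measurable_prod _ fun i _ => ?_)
      exact hind.comp (measurable_id.prodMk (measurable_pi_apply (n + 1 + i)))
    rw [lintegral_resample _ (n + 1 + j) hmeas]
    have : ∀ g : ℕ → X, ∫⁻ y, Ψ (Function.update g (n + 1 + j) y) *
        ∏ i ∈ Finset.range (j + 1), (S (Function.update g (n + 1 + j) y))ᶜ.indicator
          (1 : X → ℝ≥0∞) (Function.update g (n + 1 + j) y (n + 1 + i)) ∂ν =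
        (Ψ g * ν (S g)ᶜ) *
          ∏ i ∈ Finset.range j, (S g)ᶜ.indicator 1 (g (n + 1 + i)) := by
      intro g
      have h1 : ∀ y, Ψ (Function.update g (n + 1 + j) y) *
        ∏ i ∈ Finset.range (j + 1), (S (Function.update g (n + 1 + j) y))ᶜ.indicator
          (1 : X → ℝ≥0∞) (Function.update g (n + 1 + j) y (n + 1 + i)) =
          (Ψ g * ∏ i ∈ Finset.range j, (S g)ᶜ.indicator 1 (g (n + 1 + i))) *
            (S g)ᶜ.indicator 1 y := by
        intro y
        rw [hΨd (hupd j g y), hSd (hupd j g y), Finset.prod_range_succ, ← mul_assoc]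
        congr 1
        · congr 1
          refine Finset.prod_congr rfl fun i hi => ?_
          rw [Function.update_of_ne]
          simp at hi; omega
        · simp
      simp_rw [h1]
      have hm : MeasurableSet (S g)ᶜ := by
        have := measurable_prodMk_left (x := g) hS.compl
        exact this
      rw [lintegral_const_mul _ (measurable_one.indicator hm), lintegral_indicator_one hm]
      ring
    simp_rw [this]
    refine (ih (Ψ := fun g => Ψ g * ν (S g)ᶜ) (hΨ.mul hc)
      (fun x y h => by simp only [hΨd h, hSd h])).trans ?_
    refine lintegral_congr fun g => ?_
    ring

theorem measurable_miss_mul {Θ : (ℕ → X) → X → ℝ≥0∞}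
    (hΘ : Measurable (Function.uncurry Θ)) {S : (ℕ → X) → Set X}
    (hS : MeasurableSet {q : (ℕ → X) × X | q.2 ∈ S q.1}) (n j : ℕ) :
    Measurable fun g : ℕ → X =>
      (∏ i ∈ Finset.range j, (S g)ᶜ.indicator (1 : X → ℝ≥0∞) (g (n + 1 + i))) *
        Θ g (g (n + 1 + j)) := by
  have hind : Measurable fun q : (ℕ → X) × X => (S q.1)ᶜ.indicator (1 : X → ℝ≥0∞) q.2 :=
    (measurable_const (a := (1 : ℝ≥0∞))).indicator hS.compl
  refine Measurable.mul (Finset.measurable_prod _ fun i _ => ?_) ?_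
  · exact hind.comp (measurable_id.prodMk (measurable_pi_apply (n + 1 + i)))
  · exact hΘ.comp (measurable_id.prodMk (measurable_pi_apply (n + 1 + j)))

/-- In an i.i.d. sequence, the first term after time `n` that lies in a set `S`, determined by the
terms up to time `n`, has the conditional law `ν(· | S)`: summing over the number `j` of
misses produces the geometric series of `ν Sᶜ`. -/
theorem lintegral_iid_first_hit (n : ℕ) {Θ : (ℕ → X) → X → ℝ≥0∞}
    (hΘ : Measurable (Function.uncurry Θ)) (hΘd : DependsOn Θ (Iic n)) {S : (ℕ → X) → Set X}
    (hS : MeasurableSet {q : (ℕ → X) × X | q.2 ∈ S q.1}) (hSd : DependsOn S (Iic n)) :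
    ∫⁻ g, ∑' j, (∏ i ∈ Finset.range j, (S g)ᶜ.indicator 1 (g (n + 1 + i))) *
        Θ g (g (n + 1 + j)) ∂(Measure.infinitePi fun _ : ℕ => ν) =
      ∫⁻ g, (ν (S g))⁻¹ * ∫⁻ y, Θ g y ∂ν ∂(Measure.infinitePi fun _ : ℕ => ν) := by
  classical
  have hmul := measurable_miss_mul hΘ hS n
  have hΨ : Measurable fun g => ∫⁻ y, Θ g y ∂ν := hΘ.lintegral_prod_right'
  have hc : Measurable fun g => ν (S g)ᶜ := measurable_measure_prodMk_left (ν := ν) hS.compl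
  have hterm : ∀ j, ∫⁻ g, (∏ i ∈ Finset.range j, (S g)ᶜ.indicator 1 (g (n + 1 + i))) *
      Θ g (g (n + 1 + j)) ∂(Measure.infinitePi fun _ : ℕ => ν) =
      ∫⁻ g, (∫⁻ y, Θ g y ∂ν) * (ν (S g)ᶜ) ^ j ∂(Measure.infinitePi fun _ : ℕ => ν) := by
    intro j
    rw [lintegral_resample _ (n + 1 + j) (hmul j),
      ← lintegral_iid_miss ν n j hΨ (fun x y h => by simp only [hΘd h]) hS hSd]
    refine lintegral_congr fun g => ?_
    rw [← lintegral_mul_const _ (f := fun y => Θ g y) (hΘ.comp measurable_prodMk_left)]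
    refine lintegral_congr fun y => ?_
    have hupd : ∀ m ∈ Iic n, Function.update g (n + 1 + j) y m = g m :=
      fun m hm => Function.update_of_ne (by simp at hm; omega) _ _
    rw [hΘd hupd, hSd hupd, Function.update_self, mul_comm]
    congr 1
    refine Finset.prod_congr rfl fun i hi => ?_
    rw [Function.update_of_ne]
    simp at hi; omega
  rw [lintegral_tsum fun j => (hmul j).aemeasurable]
  simp_rw [hterm]
  have hpow : ∀ j : ℕ, Measurable fun g => (∫⁻ y, Θ g y ∂ν) * (ν (S g)ᶜ) ^ j := fun j =>
    hΨ.mul (hc.pow_const j)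
  rw [← lintegral_tsum fun j => (hpow j).aemeasurable]
  refine lintegral_congr fun g => ?_
  have hm : MeasurableSet (S g) := measurable_prodMk_left (x := g) hS
  rw [ENNReal.tsum_mul_left, ENNReal.tsum_geometric, prob_compl_eq_one_sub hm,
    ENNReal.sub_sub_cancel ENNReal.one_ne_top prob_le_one, mul_comm]

end Tail

/-! ### Iterated integrals -/

section Iterated

variable {X : Type*} [MeasurableSpace X]

/-- Iterated integrals agree when the integrands agree on a set of configurations that is reached,
one coordinate at a time, almost surely. -/
theorem iterLintegral_congr_of_ae (μ : ∀ s : ℕ, (Fin s → X) → Measure X)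
    (Q : ∀ s : ℕ, (Fin s → X) → Prop) (h0 : ∀ x, Q 0 x) (k : ℕ)
    (hQ : ∀ s < k, ∀ x, Q s x → ∀ᵐ y ∂(μ s x), Q (s + 1) (Fin.snoc (α := fun _ => X) x y))
    {F F' : (Fin k → X) → ℝ≥0∞} (hF : ∀ x, Q k x → F x = F' x) :
    iterLintegral μ k F = iterLintegral μ k F' := by
  induction k with
  | zero => exact hF _ (h0 _)
  | succ k ih =>
    refine ih (fun s hs => hQ s (by omega)) fun x hx => ?_
    refine lintegral_congr_ae ?_
    filter_upwards [hQ k (by omega) x hx] with y hy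
    exact hF _ hy

end Iterated

end STIT

namespace STIT

/-! ### Polytopes and half-spaces -/

variable {ℓ : ℕ}

theorem IsCell.isCompact {C : Set (Space ℓ)} (hC : IsCell C) : IsCompact C := by
  obtain ⟨⟨S, rfl⟩, -⟩ := hC
  exact S.finite_toSet.isCompact_convexHull ℝ

theorem IsCell.convex {C : Set (Space ℓ)} (hC : IsCell C) : Convex ℝ C := by
  obtain ⟨⟨S, rfl⟩, -⟩ := hC
  exact convex_convexHull ℝ _

/-- The intersection of a polytope with a closed half-space is a polytope: it is spanned by the
vertices in the half-space and the points where segments between vertices cross the bounding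
hyperplane. If a point outside this hull were in the intersection, a separating functional `g`
would be dominated, on all vertices, by an affine function of `f` that is too small at the
point. -/
theorem exists_convexHull_inter_le (S : Finset (Space ℓ)) (f : Space ℓ →L[ℝ] ℝ) (α : ℝ) :
    ∃ S' : Finset (Space ℓ), convexHull ℝ (S : Set (Space ℓ)) ∩ {x | f x ≤ α} =
      convexHull ℝ (S' : Set (Space ℓ)) := by
  classical
  -- the point at which the segment between two points crosses the hyperplane `f = α`
  let cr : Space ℓ × Space ℓ → Space ℓ := fun r =>
    ((f r.2 - α) / (f r.2 - f r.1)) • r.1 + ((α - f r.1) / (f r.2 - f r.1)) • r.2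
  let lo := S.filter fun s => f s < α
  let hi := S.filter fun s => α < f s
  let S' := (S.filter fun s => f s ≤ α) ∪ (lo ×ˢ hi).image cr
  have hconv : Convex ℝ (convexHull ℝ (S : Set (Space ℓ)) ∩ {x | f x ≤ α}) :=
    (convex_convexHull ℝ _).inter (convex_halfSpace_le f.toLinearMap.isLinear α)
  have hcr : ∀ r : Space ℓ × Space ℓ, f r.1 < α → α < f r.2 → f (cr r) = α := by
    intro r h1 h2
    have : f r.2 - f r.1 ≠ 0 := by linarith
    simp only [cr, map_add, map_smul, smul_eq_mul]
    field_simp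
    ring
  refine ⟨S', Subset.antisymm ?_ (convexHull_min ?_ hconv)⟩
  · rintro x ⟨hx, hfx⟩
    by_contra hx'
    obtain ⟨g, β, hg, hgx⟩ := geometric_hahn_banach_closed_point (convex_convexHull ℝ _)
      ((S'.finite_toSet.isCompact_convexHull ℝ).isClosed) hx'
    have hgS' : ∀ s ∈ S', g s < β := fun s hs => hg s (subset_convexHull ℝ _ hs)
    -- `c` is the least nonnegative slope for which `β + c * (f s - α)` dominates `g s` on the
    -- vertices beyond the hyperplane; on the other vertices this follows from the crossing points.
    let N : Finset ℝ := insert 0 (hi.image fun s => (g s - β) / (f s - α))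
    have hN : N.Nonempty := ⟨0, by simp [N]⟩
    set c := N.max' hN with hc
    have hc0 : 0 ≤ c := N.le_max' 0 (by simp [N])
    have hcut : ∀ s ∈ S, g s ≤ β + c * (f s - α) := by
      intro s hs
      rcases lt_trichotomy (f s) α with h | h | h
      · have hsS' : s ∈ S' := by
          simp only [S', Finset.mem_union, Finset.mem_filter]
          exact Or.inl ⟨hs, h.le⟩
        have hgs := hgS' s hsS'
        have hcm : c ∈ N := N.max'_mem hN
        simp only [N, Finset.mem_insert, Finset.mem_image] at hcm
        rcases hcm with hcm | ⟨s', hs', hcm⟩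
        · rw [hcm, zero_mul, add_zero]
          exact hgs.le
        · simp only [hi, Finset.mem_filter] at hs'
          have hmem : cr (s, s') ∈ S' := by
            simp only [S', Finset.mem_union]
            refine Or.inr (Finset.mem_image_of_mem _ ?_)
            simp [lo, hi, hs, h, hs']
          have h3 := hgS' _ hmem
          have hd : 0 < f s' - f s := by linarith [hs'.2]
          simp only [cr, map_add, map_smul, smul_eq_mul] at h3
          have h4 : (f s' - α) * g s + (α - f s) * g s' < β * (f s' - f s) := by
            have := mul_lt_mul_of_pos_right h3 hd
            have e : ((f s' - α) / (f s' - f s) * g s + (α - f s) / (f s' - f s) * g s') *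
              (f s' - f s) = (f s' - α) * g s + (α - f s) * g s' := by field_simp
            linarith
          rw [← hcm]
          have hb : 0 < f s' - α := by linarith [hs'.2]
          rw [div_mul_eq_mul_div, ← sub_le_iff_le_add', le_div_iff₀ hb]
          nlinarith
      · have hsS' : s ∈ S' := by
          simp only [S', Finset.mem_union, Finset.mem_filter]
          exact Or.inl ⟨hs, h.le⟩
        rw [h, sub_self, mul_zero, add_zero]
        exact (hgS' s hsS').le
      · have : (g s - β) / (f s - α) ≤ c := by
          refine N.le_max' _ ?_
          simp only [N, Finset.mem_insert, Finset.mem_image]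
          exact Or.inr ⟨s, by simp [hi, hs, h], rfl⟩
        rw [div_le_iff₀ (by linarith)] at this
        linarith
    have hsub : convexHull ℝ (S : Set (Space ℓ)) ⊆ {y | (g - c • f) y ≤ β - c * α} := by
      refine convexHull_min (fun s hs => ?_) (convex_halfSpace_le (g - c • f).toLinearMap.isLinear _)
      have := hcut s hs
      simp only [sub_apply, smul_apply,
        smul_eq_mul, mem_ofPred_eq]
      linarith
    have := hsub hx
    simp only [sub_apply, smul_apply,
      smul_eq_mul, mem_ofPred_eq] at this
    have h2 : c * f x ≤ c * α := mul_le_mul_of_nonneg_left hfx hc0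
    linarith
  · intro s hs
    simp only [S', Finset.coe_union, Finset.coe_filter, Finset.coe_image, mem_union, mem_image,
      mem_ofPred_eq] at hs
    rcases hs with ⟨h1, h2⟩ | ⟨r, hr, rfl⟩
    · exact ⟨subset_convexHull ℝ _ h1, h2⟩
    · simp only [Finset.coe_product, mem_prod, Finset.mem_coe, lo, hi, Finset.mem_filter] at hr
      refine ⟨?_, (hcr r hr.1.2 hr.2.2).le⟩
      have hd : 0 < f r.2 - f r.1 := by linarith [hr.1.2, hr.2.2]
      refine convex_convexHull ℝ _ (subset_convexHull ℝ _ hr.1.1) (subset_convexHull ℝ _ hr.2.1)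
        (div_nonneg (by linarith [hr.2.2]) hd.le) (div_nonneg (by linarith [hr.1.2]) hd.le) ?_
      field_simp
      ring

/-- The hyperplane with parameter `q` properly divides `C`: there are points of `C` strictly on
either side. -/
def Cuts (q : Param ℓ) (C : Set (Space ℓ)) : Prop :=
  (∃ x ∈ C, inner ℝ x (q.2 : Space ℓ) < q.1) ∧ ∃ x ∈ C, q.1 < inner ℝ x (q.2 : Space ℓ)

theorem inner_continuousLinear (u : Space ℓ) :
    ∃ f : Space ℓ →L[ℝ] ℝ, ∀ x, f x = inner ℝ x u :=
  ⟨innerSL ℝ u, fun x => by simp [real_inner_comm]⟩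

/-- The interior of each part is nonempty, since a polytope with nonempty interior is the closure of
its interior. -/
theorem IsCell.inter_half {C : Set (Space ℓ)} (hC : IsCell C) {q : Param ℓ} (hq : Cuts q C)
    (b : Bool) : IsCell (C ∩ half q b) := by
  have hcl : C ⊆ closure (interior C) := by
    rw [hC.convex.closure_interior_eq_closure_of_nonempty_interior hC.2]
    exact subset_closure
  have hint : ∀ U : Set (Space ℓ), IsOpen U → (C ∩ U).Nonempty → ∀ V, U ⊆ V →
      (interior (C ∩ V)).Nonempty := by
    rintro U hU ⟨x, hxC, hxU⟩ V hUV
    obtain ⟨y, hyU, hyC⟩ := mem_closure_iff.1 (hcl hxC) U hU hxU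
    refine ⟨y, ?_⟩
    rw [interior_inter]
    exact ⟨hyC, interior_maximal hUV hU hyU⟩
  obtain ⟨⟨S, rfl⟩, -⟩ := hC
  obtain ⟨f, hf⟩ := inner_continuousLinear (q.2 : Space ℓ)
  obtain ⟨⟨x, hx, hxq⟩, ⟨y, hy, hyq⟩⟩ := hq
  have hcont : Continuous fun x : Space ℓ => inner ℝ x (q.2 : Space ℓ) := by fun_prop
  cases b with
  | false =>
    constructor
    · obtain ⟨S', hS'⟩ := exists_convexHull_inter_le S f q.1
      refine ⟨S', ?_⟩
      rw [← hS']
      simp [half, hf]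
    · exact hint {x | inner ℝ x (q.2 : Space ℓ) < q.1} (isOpen_lt hcont continuous_const)
        ⟨x, hx, hxq⟩ _ fun z hz => by
          simp only [half, mem_ofPred_eq] at hz ⊢
          exact hz.le
  | true =>
    constructor
    · obtain ⟨S', hS'⟩ := exists_convexHull_inter_le S (-f) (-q.1)
      refine ⟨S', ?_⟩
      rw [← hS']
      simp [half, hf]
    · exact hint {x | q.1 < inner ℝ x (q.2 : Space ℓ)} (isOpen_lt continuous_const hcont)
        ⟨y, hy, hyq⟩ _ fun z hz => by
          simp only [half, mem_ofPred_eq] at hz ⊢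
          exact hz.le

/-- A hyperplane that meets a polytope without properly dividing it passes through a vertex. -/
theorem exists_vertex_of_not_cuts {S : Finset (Space ℓ)} {q : Param ℓ}
    (hq : (plane q ∩ convexHull ℝ (S : Set (Space ℓ))).Nonempty)
    (hc : ¬ Cuts q (convexHull ℝ (S : Set (Space ℓ)))) : ∃ s ∈ S, s ∈ plane q := by
  by_contra! hne
  obtain ⟨f, hf⟩ := inner_continuousLinear (q.2 : Space ℓ)
  obtain ⟨x, hxq, hx⟩ := hq
  have hxq' : f x = q.1 := by rw [hf]; exact hxq
  apply hc
  constructor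
  · by_contra! h
    have hlt : ∀ s ∈ (S : Set (Space ℓ)), s ∈ {y | q.1 < f y} := fun s hs => by
      refine lt_of_le_of_ne (a := q.1) (b := f s) ?_ fun h' => hne s hs ?_
      · rw [hf]; exact h s (subset_convexHull ℝ _ hs)
      · change inner ℝ s (q.2 : Space ℓ) = q.1
        rw [← hf, h']
    have := convexHull_min hlt (convex_halfSpace_gt f.toLinearMap.isLinear q.1) hx
    simp only [mem_ofPred_eq] at this
    linarith
  · by_contra! h
    have hlt : ∀ s ∈ (S : Set (Space ℓ)), s ∈ {y | f y < q.1} := fun s hs => by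
      refine lt_of_le_of_ne (b := q.1) (a := f s) ?_ fun h' => hne s hs ?_
      · rw [hf]; exact h s (subset_convexHull ℝ _ hs)
      · change inner ℝ s (q.2 : Space ℓ) = q.1
        rw [← hf, h']
    have := convexHull_min hlt (convex_halfSpace_lt f.toLinearMap.isLinear q.1) hx
    simp only [mem_ofPred_eq] at this
    linarith

/-! ### Hyperplanes that hit a set -/

/-- Projection along a compact set preserves closedness. -/
theorem isClosed_setOf_exists_mem {E : Type*} [TopologicalSpace E] {K : Set (Space ℓ)}
    (hK : IsCompact K) {F : Set (Space ℓ × E)} (hF : IsClosed F) :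
    IsClosed {e | ∃ x ∈ K, (x, e) ∈ F} := by
  have : CompactSpace K := isCompact_iff_compactSpace.1 hK
  have h1 : IsClosed {r : K × E | ((r.1 : Space ℓ), r.2) ∈ F} :=
    hF.preimage (by fun_prop)
  convert isClosedMap_snd_of_compactSpace (X := K) (Y := E) _ h1 using 1
  ext e
  simp

theorem isClosed_inner_eq : IsClosed {r : Space ℓ × Param ℓ | r.1 ∈ plane r.2} := by
  simp only [plane, mem_ofPred_eq]
  exact isClosed_eq (by fun_prop) (by fun_prop)

theorem isClosed_half (b : Bool) : IsClosed {r : Space ℓ × Param ℓ | r.1 ∈ half r.2 b} := by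
  cases b <;> simp only [half, mem_ofPred_eq]
  · exact isClosed_le (by fun_prop) (by fun_prop)
  · exact isClosed_le (by fun_prop) (by fun_prop)

theorem measurableSet_hit {B : Set (Space ℓ)} (hB : IsCompact B) : MeasurableSet (hit B) := by
  change MeasurableSet (ofParam ⁻¹' hit B)
  refine IsClosed.measurableSet ?_
  convert isClosed_setOf_exists_mem hB (isClosed_inner_eq (ℓ := ℓ)) using 1
  ext q
  simp only [hit, ofParam, mem_preimage, mem_ofPred_eq]
  exact ⟨fun ⟨x, h1, h2⟩ => ⟨x, h2, h1⟩, fun ⟨x, h1, h2⟩ => ⟨x, h2, h1⟩⟩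

theorem hit_mono {B B' : Set (Space ℓ)} (h : B ⊆ B') : hit B ⊆ hit B' :=
  fun _ hh => hh.mono (inter_subset_inter_right _ h)

theorem exists_ofParam (h : Hyperplane ℓ) : ∃ q : Param ℓ, ofParam q = h := by
  obtain ⟨_, q, rfl⟩ := h
  exact ⟨q, rfl⟩

theorem ofParam_mem_hit_singleton {v : Space ℓ} {q : Param ℓ} :
    ofParam q ∈ hit {v} ↔ inner ℝ v (q.2 : Space ℓ) = q.1 := by
  change (plane q ∩ {v}).Nonempty ↔ _
  simp [plane]

theorem mem_hit_singleton {v : Space ℓ} {h : Hyperplane ℓ} : h ∈ hit {v} ↔ v ∈ h.1 := by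
  change (h.1 ∩ {v}).Nonempty ↔ _
  simp

theorem preimage_translate_hit (v : Space ℓ) (B : Set (Space ℓ)) :
    translate v ⁻¹' hit ((fun x => v + x) '' B) = hit B := by
  ext h
  change (((fun x => v + x) '' h.1) ∩ ((fun x => v + x) '' B)).Nonempty ↔ (h.1 ∩ B).Nonempty
  rw [← image_inter (add_right_injective v), image_nonempty]

theorem Hyperplane.nonempty (h : Hyperplane ℓ) : h.1.Nonempty := by
  obtain ⟨_, q, rfl⟩ := h
  refine ⟨q.1 • (q.2 : Space ℓ), ?_⟩
  simp [plane, inner_smul_left, q.2.2.1]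

section Measure

variable {Λ : Measure (Hyperplane ℓ)}

theorem measure_hit_translate (hΛ : IsHyperplaneMeasure Λ) (v : Space ℓ) {B : Set (Space ℓ)}
    (hB : IsCompact B) :
    Λ (hit ((fun x => v + x) '' B)) = Λ (hit B) := by
  rw [← preimage_translate_hit v B]
  exact ((hΛ.translation_invariant v).measure_preimage
    (measurableSet_hit (hB.image (by fun_prop))).nullMeasurableSet).symm

theorem measure_hit_lt_top (hΛ : IsHyperplaneMeasure Λ) {B : Set (Space ℓ)} (hB : IsCompact B) :
    Λ (hit B) < ∞ :=
  hΛ.locally_finite B hB.measurableSet hB.isBounded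

/-- No point is hit with positive measure. The hyperplanes through `v` that are not parallel to a
given basis vector have infinitely many disjoint translates of equal measure, all of which hit one
bounded set. -/
theorem measure_hit_singleton (hΛ : IsHyperplaneMeasure Λ) (v : Space ℓ) : Λ (hit {v}) = 0 := by
  let E : Fin ℓ → Space ℓ := fun i => EuclideanSpace.single i 1
  let A : Fin ℓ → Space ℓ → Set (Hyperplane ℓ) := fun i x => hit {x} \ hit {x + E i}
  have hAm : ∀ i x, MeasurableSet (A i x) := fun i x =>
    (measurableSet_hit isCompact_singleton).diff (measurableSet_hit isCompact_singleton)
  have hcover : hit {v} ⊆ ⋃ i, A i v := by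
    intro h hh
    obtain ⟨q, rfl⟩ := exists_ofParam h
    rw [ofParam_mem_hit_singleton] at hh
    by_contra hne
    simp only [mem_iUnion, not_exists, A, mem_sdiff, not_and, not_not,
      ofParam_mem_hit_singleton] at hne
    have h0 : (q.2 : Space ℓ) = 0 := by
      ext i
      have h1 := hne i hh
      rw [inner_add_left, hh] at h1
      simpa [E, EuclideanSpace.inner_single_left] using h1
    have := q.2.2.1
    rw [h0] at this
    simp at this
  have hzero : ∀ i, Λ (A i v) = 0 := by
    intro i
    have hshift : ∀ s : ℝ, Λ (A i (v + s • E i)) = Λ (A i v) := by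
      intro s
      have : translate (s • E i) ⁻¹' A i (v + s • E i) = A i v := by
        have e1 : ({v + s • E i} : Set (Space ℓ)) = (fun x => s • E i + x) '' {v} := by
          simp [add_comm]
        have e2 : ({v + s • E i + E i} : Set (Space ℓ)) =
            (fun x => s • E i + x) '' {v + E i} := by
          simp only [image_singleton]
          congr 1
          abel
        simp only [A]
        rw [preimage_sdiff, e1, e2, preimage_translate_hit, preimage_translate_hit]
      rw [← this]
      exact ((hΛ.translation_invariant _).measure_preimage (hAm _ _).nullMeasurableSet).symm
    -- Any sequence of distinct shifts in a bounded set would do.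
    let a : ℕ → ℝ := fun n => 1 / ((n : ℝ) + 1)
    have ha : Function.Injective a := by
      intro m n h
      simp only [a] at h
      have h1 : (m : ℝ) + 1 = n + 1 := by
        have := congrArg (fun x : ℝ => 1 / x) h
        simpa using this
      exact_mod_cast add_right_cancel h1
    have hdisj : Pairwise (Function.onFun Disjoint fun n => A i (v + a n • E i)) := by
      intro m n hmn
      rw [Function.onFun, Set.disjoint_left]
      rintro h ⟨e1, h1'⟩ ⟨e2, -⟩
      obtain ⟨q, rfl⟩ := exists_ofParam h
      rw [ofParam_mem_hit_singleton] at e1 h1' e2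
      apply h1'
      rw [inner_add_left, inner_smul_left] at e1 e2
      simp only [conj_trivial] at e1 e2
      have h3 : (a m - a n) * inner ℝ (E i) (q.2 : Space ℓ) = 0 := by linarith
      rcases mul_eq_zero.1 h3 with h | h
      · exact absurd (ha (sub_eq_zero.1 h)) hmn
      · rw [inner_add_left, inner_add_left, inner_smul_left, h]
        rw [h] at e1
        simpa using e1
    have hsub : (⋃ n, A i (v + a n • E i)) ⊆ hit (Metric.closedBall v 1) := by
      refine iUnion_subset fun n h hh => ?_
      refine hit_mono ?_ hh.1
      simp only [singleton_subset_iff, Metric.mem_closedBall, dist_self_add_left, norm_smul, E,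
        PiLp.norm_single, a]
      simp only [norm_one, mul_one, Real.norm_eq_abs]
      rw [abs_of_nonneg (by positivity)]
      rw [div_le_one (by positivity)]
      linarith [n.cast_nonneg (α := ℝ)]
    by_contra hpos
    have h1 : Λ (⋃ n, A i (v + a n • E i)) = ∞ := by
      rw [measure_iUnion hdisj fun n => hAm _ _]
      simp_rw [hshift]
      exact ENNReal.tsum_const_eq_top_of_ne_zero hpos
    have h2 := (measure_mono hsub).trans_lt (measure_hit_lt_top hΛ (isCompact_closedBall v 1))
    rw [h1] at h2
    exact lt_irrefl _ h2
  exact measure_mono_null hcover (measure_iUnion_null hzero)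

/-- A cell contains a ball, and countably many translates of the ball are hit by all hyperplanes. -/
theorem IsCell.measure_hit_pos (hΛ : IsHyperplaneMeasure Λ) {C : Set (Space ℓ)} (hC : IsCell C) :
    0 < Λ (hit C) := by
  obtain ⟨x, hx⟩ := hC.2
  obtain ⟨r, hr, hball⟩ := Metric.nhds_basis_closedBall.mem_iff.1 (mem_interior_iff_mem_nhds.1 hx)
  refine lt_of_lt_of_le ?_ (measure_mono (hit_mono hball))
  rw [pos_iff_ne_zero]
  intro h0
  apply hΛ.ne_zero
  rw [← Measure.measure_univ_eq_zero]
  refine measure_mono_null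
    (t := ⋃ n : ℕ, hit (Metric.closedBall (TopologicalSpace.denseSeq (Space ℓ) n) r)) ?_
    (measure_iUnion_null fun n => ?_)
  · rintro h -
    obtain ⟨y, hy⟩ := h.nonempty
    obtain ⟨n, hz⟩ := (TopologicalSpace.denseRange_denseSeq (Space ℓ)).exists_dist_lt y hr
    exact mem_iUnion.2 ⟨n, y, hy, Metric.mem_closedBall.2 hz.le⟩
  · set d := TopologicalSpace.denseSeq (Space ℓ) n
    have := measure_hit_translate hΛ (d - x) (isCompact_closedBall x r)
    rw [h0] at this
    rw [← this]
    congr 2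
    ext y
    simp only [Metric.mem_closedBall, mem_image, dist_eq_norm]
    constructor
    · intro hy
      exact ⟨y - (d - x), by rwa [show y - (d - x) - x = y - d by abel], by abel⟩
    · rintro ⟨z, hz, rfl⟩
      rwa [show d - x + z - d = z - x by abel]

/-- Almost every hyperplane that hits a cell divides it into two cells. -/
theorem IsCell.ae_cuts (hΛ : IsHyperplaneMeasure Λ) {C : Set (Space ℓ)} (hC : IsCell C)
    (p : Hyperplane ℓ → Param ℓ) (hp : ∀ h, ofParam (p h) = h) :
    ∀ᵐ h ∂Λ, h ∈ hit C → Cuts (p h) C := by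
  obtain ⟨⟨S, rfl⟩, -⟩ := hC
  rw [ae_iff]
  refine measure_mono_null (t := ⋃ s ∈ S, hit {s}) ?_
    ((measure_biUnion_null_iff S.countable_toSet).2 fun s _ => measure_hit_singleton hΛ s)
  intro h hh
  simp only [Classical.not_imp, mem_ofPred_eq] at hh
  have hplane : plane (p h) = h.1 := congrArg Subtype.val (hp h)
  obtain ⟨s, hs, hsq⟩ := exists_vertex_of_not_cuts (q := p h) (by rw [hplane]; exact hh.1) hh.2
  simp only [mem_iUnion]
  exact ⟨s, hs, mem_hit_singleton.2 (by rwa [← hplane])⟩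

end Measure

end STIT

namespace STIT

variable {ℓ : ℕ}

/-! ### Cells as functions of the dividing hyperplanes -/

/-- The cells, as functions of the parameters of the dividing hyperplanes. -/
def paramCell (W : Set (Space ℓ)) (Q : Word → Param ℓ) : Word → Set (Space ℓ)
  | [] => W
  | b :: e => paramCell W Q e ∩ half (Q e) b

theorem cell_eq_paramCell (p : Hyperplane ℓ → Param ℓ) (W : Set (Space ℓ))
    (h : Word → Hyperplane ℓ) (e : Word) : cell p W h e = paramCell W (fun f => p (h f)) e := by
  induction e with
  | nil => rfl
  | cons b e ih => simp only [cell, paramCell, ih]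

theorem cell_subset (p : Hyperplane ℓ → Param ℓ) (W : Set (Space ℓ))
    (h : Word → Hyperplane ℓ) (e : Word) : cell p W h e ⊆ W := by
  induction e with
  | nil => exact Subset.rfl
  | cons b e ih => exact inter_subset_left.trans ih

/-- The cell of a word is determined by the dividers of its proper predecessors. -/
theorem cell_congr_suffix (p : Hyperplane ℓ → Param ℓ) (W : Set (Space ℓ))
    {h h' : Word → Hyperplane ℓ} (e : Word) (hh : ∀ f, f <:+ e → f ≠ e → h f = h' f) :
    cell p W h e = cell p W h' e := by
  induction e with
  | nil => rfl
  | cons b e ih =>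
    have hne : ∀ f : Word, f <:+ e → f ≠ b :: e := by
      rintro f hf rfl
      have := hf.length_le
      simp at this
    simp only [cell]
    rw [ih fun f hf _ => hh f (hf.trans (List.suffix_cons b e)) (hne f hf),
      hh e (List.suffix_cons b e) (hne e List.suffix_rfl)]

theorem isClosed_paramCell {W : Set (Space ℓ)} (hW : IsClosed W) (e : Word) :
    IsClosed {r : Space ℓ × (Word → Param ℓ) | r.1 ∈ paramCell W r.2 e} := by
  induction e with
  | nil => exact hW.preimage continuous_fst
  | cons b e ih =>
    refine ih.inter ?_
    exact (isClosed_half b).preimage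
      (f := fun r : Space ℓ × (Word → Param ℓ) => (r.1, r.2 e)) (by fun_prop)

theorem isClosed_half_fixed (q : Param ℓ) (b : Bool) : IsClosed (half q b) :=
  (isClosed_half b).preimage (f := fun x : Space ℓ => (x, q)) (by fun_prop)

theorem isClosed_cell (p : Hyperplane ℓ → Param ℓ) {W : Set (Space ℓ)} (hW : IsClosed W)
    (h : Word → Hyperplane ℓ) (e : Word) : IsClosed (cell p W h e) := by
  induction e with
  | nil => exact hW
  | cons b e ih => exact ih.inter (isClosed_half_fixed _ b)

theorem isCompact_cell (p : Hyperplane ℓ → Param ℓ) {W : Set (Space ℓ)} (hW : IsCompact W)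
    (h : Word → Hyperplane ℓ) (e : Word) : IsCompact (cell p W h e) :=
  hW.of_isClosed_subset (isClosed_cell p hW.isClosed h e) (cell_subset p W h e)

section Measurability

variable {Y : Type*} [MeasurableSpace Y] {p : Hyperplane ℓ → Param ℓ}
  {W : Set (Space ℓ)} {h : Y → Word → Hyperplane ℓ} {q : Y → Param ℓ}

/-- Incidence conditions between a compact set and closed functions of the parameters are
measurable: projections along compact sets preserve closedness. -/
theorem measurableSet_exists_mem_cell (hp : Measurable p) (hW : IsCompact W) (hh : Measurable h)
    (hq : Measurable q) (e : Word) {F : Set (Space ℓ × Param ℓ)} (hF : IsClosed F) :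
    MeasurableSet {y | ∃ x ∈ cell p W (h y) e, (x, q y) ∈ F} := by
  have hc : IsClosed {r : (Word → Param ℓ) × Param ℓ |
      ∃ x ∈ W, x ∈ paramCell W r.1 e ∧ (x, r.2) ∈ F} := by
    refine isClosed_setOf_exists_mem hW (F := {s : Space ℓ × ((Word → Param ℓ) × Param ℓ) |
      s.1 ∈ paramCell W s.2.1 e ∧ (s.1, s.2.2) ∈ F}) ?_
    refine IsClosed.inter ?_ ?_
    · exact (isClosed_paramCell hW.isClosed e).preimage
        (f := fun s : Space ℓ × ((Word → Param ℓ) × Param ℓ) => (s.1, s.2.1)) (by fun_prop)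
    · exact hF.preimage
        (f := fun s : Space ℓ × ((Word → Param ℓ) × Param ℓ) => (s.1, s.2.2)) (by fun_prop)
  have hmeas : Measurable fun y => ((fun f => p (h y f) : Word → Param ℓ), q y) :=
    (measurable_pi_iff.2 fun f => hp.comp ((measurable_pi_apply f).comp hh)).prodMk hq
  convert hmeas hc.measurableSet using 1
  ext y
  simp only [mem_preimage, mem_ofPred_eq, cell_eq_paramCell]
  refine ⟨fun ⟨x, h1, h2⟩ => ⟨x, ?_, h1, h2⟩, fun ⟨x, _, h1, h2⟩ => ⟨x, h1, h2⟩⟩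
  rw [← cell_eq_paramCell] at h1
  exact cell_subset p W _ e h1

theorem measurableSet_mem_hit_cell (hp : Measurable p) (hp_param : ∀ k, ofParam (p k) = k)
    (hW : IsCompact W) (hh : Measurable h) {k : Y → Hyperplane ℓ} (hk : Measurable k)
    (e : Word) : MeasurableSet {y | k y ∈ hit (cell p W (h y) e)} := by
  convert measurableSet_exists_mem_cell hp hW hh (hp.comp hk) e (isClosed_inner_eq (ℓ := ℓ)) using 1
  ext y
  have hpl : plane (p (k y)) = (k y).1 := congrArg Subtype.val (hp_param (k y))
  simp only [mem_ofPred_eq, Function.comp_apply, hpl]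
  exact ⟨fun ⟨x, h1, h2⟩ => ⟨x, h2, h1⟩, fun ⟨x, h1, h2⟩ => ⟨x, h2, h1⟩⟩

/-- The strict inequalities in `Cuts` are countable unions of closed conditions. -/
theorem measurableSet_cuts_cell (hp : Measurable p) (hW : IsCompact W) (hh : Measurable h)
    (hq : Measurable q) (e : Word) : MeasurableSet {y | Cuts (q y) (cell p W (h y) e)} := by
  have hlt : ∀ a b : ℝ, a < b ↔ ∃ n : ℕ, a + 1 / ((n : ℝ) + 1) ≤ b := fun a b => by
    constructor
    · intro hab
      obtain ⟨n, hn⟩ := exists_nat_one_div_lt (sub_pos.2 hab)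
      exact ⟨n, by linarith⟩
    · rintro ⟨n, hn⟩
      have : (0 : ℝ) < 1 / ((n : ℝ) + 1) := Nat.one_div_pos_of_nat
      linarith
  refine MeasurableSet.inter ?_ ?_
  · have : {y | ∃ x ∈ cell p W (h y) e, inner ℝ x ((q y).2 : Space ℓ) < (q y).1} =
        ⋃ n : ℕ, {y | ∃ x ∈ cell p W (h y) e, (x, q y) ∈ {r : Space ℓ × Param ℓ |
          inner ℝ r.1 (r.2.2 : Space ℓ) + 1 / ((n : ℝ) + 1) ≤ r.2.1}} := by
      ext y
      simp only [mem_ofPred_eq, mem_iUnion, hlt]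
      exact ⟨fun ⟨x, h1, n, h2⟩ => ⟨n, x, h1, h2⟩, fun ⟨n, x, h1, h2⟩ => ⟨x, h1, n, h2⟩⟩
    refine (congrArg MeasurableSet this).mpr (MeasurableSet.iUnion fun n => ?_)
    exact measurableSet_exists_mem_cell hp hW hh hq e (isClosed_le (by fun_prop) (by fun_prop))
  · have : {y | ∃ x ∈ cell p W (h y) e, (q y).1 < inner ℝ x ((q y).2 : Space ℓ)} =
        ⋃ n : ℕ, {y | ∃ x ∈ cell p W (h y) e, (x, q y) ∈ {r : Space ℓ × Param ℓ |
          r.2.1 + 1 / ((n : ℝ) + 1) ≤ inner ℝ r.1 (r.2.2 : Space ℓ)}} := by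
      ext y
      simp only [mem_ofPred_eq, mem_iUnion, hlt]
      exact ⟨fun ⟨x, h1, n, h2⟩ => ⟨n, x, h1, h2⟩, fun ⟨n, x, h1, h2⟩ => ⟨x, h1, n, h2⟩⟩
    refine (congrArg MeasurableSet this).mpr (MeasurableSet.iUnion fun n => ?_)
    exact measurableSet_exists_mem_cell hp hW hh hq e (isClosed_le (by fun_prop) (by fun_prop))

theorem measurable_measure_hit_cell (hp : Measurable p) (hp_param : ∀ k, ofParam (p k) = k)
    (hW : IsCompact W) (hh : Measurable h) (ν : Measure (Hyperplane ℓ)) [SFinite ν] (e : Word) :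
    Measurable fun y => ν (hit (cell p W (h y) e)) :=
  measurable_measure_prodMk_left (ν := ν) (measurableSet_mem_hit_cell hp hp_param hW
    (h := fun r : Y × Hyperplane ℓ => h r.1) (hh.comp measurable_fst) measurable_snd e)

end Measurability

/-! ### Normalized hyperplane measures -/

section Normalized

variable {Λ : Measure (Hyperplane ℓ)}

theorem isProbabilityMeasure_normalized (hΛ : IsHyperplaneMeasure Λ) {C : Set (Space ℓ)}
    (hC : IsCell C) : IsProbabilityMeasure (normalized Λ C) := by
  refine ⟨?_⟩
  simp only [normalized, Measure.smul_apply, Measure.restrict_apply_univ, smul_eq_mul]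
  exact ENNReal.inv_mul_cancel (hC.measure_hit_pos hΛ).ne'
    (measure_hit_lt_top hΛ hC.isCompact).ne

/-- The density of `ν` conditioned on `[C]` with respect to `ν`. -/
noncomputable def hitDensity (ν : Measure (Hyperplane ℓ)) (C : Set (Space ℓ))
    (y : Hyperplane ℓ) : ℝ≥0∞ :=
  (ν (hit C))⁻¹ * (hit C).indicator 1 y

theorem normalized_apply_hit {C W : Set (Space ℓ)} (hCW : C ⊆ W) (hC : IsCompact C) :
    normalized Λ W (hit C) = (Λ (hit W))⁻¹ * Λ (hit C) := by
  simp only [normalized, Measure.smul_apply, smul_eq_mul]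
  rw [Measure.restrict_apply (measurableSet_hit hC), inter_eq_left.2 (hit_mono hCW)]

/-- Conditioning the law of the hyperplanes in the window on hitting a cell. -/
theorem lintegral_normalized (hΛ : IsHyperplaneMeasure Λ) {C W : Set (Space ℓ)} (hW : IsCell W)
    (hCW : C ⊆ W) (hC : IsCompact C) {f : Hyperplane ℓ → ℝ≥0∞} (hf : Measurable f) :
    ∫⁻ y, f y ∂(normalized Λ C) =
      ∫⁻ y, hitDensity (normalized Λ W) C y * f y ∂(normalized Λ W) := by
  have h0 := (hW.measure_hit_pos hΛ).ne'
  have h1 := (measure_hit_lt_top hΛ hW.isCompact).ne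
  have hm := measurableSet_hit hC
  have hind : ∀ y, hitDensity (normalized Λ W) C y * f y =
      ((Λ (hit W))⁻¹ * Λ (hit C))⁻¹ * (hit C).indicator f y := by
    intro y
    rw [hitDensity, normalized_apply_hit hCW hC, mul_assoc]
    by_cases hy : y ∈ hit C <;> simp [hy]
  simp_rw [hind]
  rw [lintegral_const_mul _ (hf.indicator hm)]
  simp only [normalized, lintegral_smul_measure, smul_eq_mul]
  rw [lintegral_indicator hm, Measure.restrict_restrict hm, inter_eq_left.2 (hit_mono hCW),
    ENNReal.mul_inv (Or.inl (ENNReal.inv_ne_zero.2 h1)) (Or.inl (ENNReal.inv_ne_top.2 h0)), inv_inv,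
    mul_comm _ ((Λ (hit W))⁻¹ * _), ← mul_assoc, mul_comm (_ * _) (Λ (hit W)), ← mul_assoc,
    ENNReal.mul_inv_cancel h0 h1, one_mul, mul_comm]

end Normalized

end STIT

namespace STIT

variable {ℓ : ℕ}

/-! ### The order on words -/

namespace Word

theorem lt_of_length_lt {f e : Word} (h : f.length < e.length) : lt f e :=
  List.Shortlex.of_length_lt (by simpa using h)

theorem lt_of_suffix {f e : Word} (h : f <:+ e) (hne : f ≠ e) : lt f e :=
  lt_of_length_lt (lt_of_le_of_ne h.length_le fun hl => hne (h.eq_of_length hl))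

theorem length_le_of_lt {f e : Word} (h : lt f e) : f.length ≤ e.length := by
  rcases List.shortlex_def.1 h with h1 | ⟨h1, _⟩ <;> simp at h1 <;> omega

theorem lt_trans {f e d : Word} (h : lt f e) (h' : lt e d) : lt f d := by
  refine List.shortlex_def.2 ?_
  rcases List.shortlex_def.1 h with h1 | ⟨h1, h2⟩ <;>
    rcases List.shortlex_def.1 h' with h3 | ⟨h3, h4⟩
  · exact Or.inl (h1.trans h3)
  · exact Or.inl (h3 ▸ h1)
  · exact Or.inl (h1 ▸ h3)
  · exact Or.inr ⟨h1.trans h3, _root_.lt_trans (α := List Bool) h2 h4⟩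

theorem lt_irrefl (e : Word) : ¬ lt e e := irrefl (r := List.Shortlex (· < ·)) e.reverse

theorem lt_trichotomous (e f : Word) : lt e f ∨ e = f ∨ lt f e := by
  rcases trichotomous_of (List.Shortlex (· < ·)) e.reverse f.reverse with h | h | h
  · exact Or.inl h
  · exact Or.inr (Or.inl (List.reverse_injective h))
  · exact Or.inr (Or.inr h)

theorem finite_setOf_lt (e : Word) : {f | lt f e}.Finite :=
  (List.finite_length_le Bool e.length).subset fun _ hf => length_le_of_lt hf

theorem lt_nil (f : Word) : ¬ lt f [] := fun h => by
  have := length_le_of_lt h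
  obtain rfl : f = [] := List.length_eq_zero_iff.1 (by simpa using this)
  exact lt_irrefl _ h

theorem nil_lt {e : Word} (he : e ≠ []) : lt [] e :=
  lt_of_length_lt (by simpa using List.length_pos_iff.2 he)

theorem not_suffix_of_lt {f e : Word} (h : lt f e) : ¬ e <:+ f := fun hs => by
  by_cases hfe : e = f
  · exact lt_irrefl _ (hfe ▸ h)
  · exact lt_irrefl _ (lt_trans h (lt_of_suffix hs hfe))

theorem exists_max (D : Finset Word) (hD : D.Nonempty) : ∃ m ∈ D, ∀ f ∈ D, f = m ∨ lt f m := by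
  induction D using Finset.induction_on with
  | empty => exact absurd hD (by simp)
  | insert a D ha ih =>
    rcases D.eq_empty_or_nonempty with rfl | hne
    · exact ⟨a, by simp, by simp⟩
    · obtain ⟨m, hm, hmax⟩ := ih hne
      rcases lt_trichotomous a m with h | h | h
      · refine ⟨m, by simp [hm], fun f hf => ?_⟩
        rcases Finset.mem_insert.1 hf with rfl | hf
        · exact Or.inr h
        · exact hmax f hf
      · exact absurd (h ▸ hm) ha
      · refine ⟨a, by simp, fun f hf => ?_⟩
        rcases Finset.mem_insert.1 hf with rfl | hf
        · exact Or.inl rfl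
        · rcases hmax f hf with rfl | h'
          · exact Or.inr h
          · exact Or.inr (lt_trans h' h)

end Word

/-! ### The indices of the dividing hyperplanes -/

/-- The cell of `e` is eventually divided: the set whose infimum is `κ(e)` is nonempty. -/
def Proceeds (p : Hyperplane ℓ → Param ℓ) (W : Set (Space ℓ)) (g : ℕ → Hyperplane ℓ)
    (e : Word) : Prop :=
  e = [] ∨ ∃ n, g n ∈ hit (stitCell p W g e) ∧ ∀ f, Word.lt f e → kappa p W g f < n

variable {p : Hyperplane ℓ → Param ℓ} {W : Set (Space ℓ)}

theorem Proceeds.kappa_mem {g : ℕ → Hyperplane ℓ} {e : Word} (h : Proceeds p W g e)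
    (he : e ≠ []) : g (kappa p W g e) ∈ hit (stitCell p W g e) ∧
      ∀ f, Word.lt f e → kappa p W g f < kappa p W g e := by
  have := Nat.sInf_mem (s := {n | g n ∈ hit (stitCell p W g e) ∧
    ∀ f, Word.lt f e → kappa p W g f < n}) (h.resolve_left he)
  rw [← kappa_eq p W g e he] at this
  exact this

theorem kappa_le {g : ℕ → Hyperplane ℓ} {e : Word} (he : e ≠ []) {n : ℕ}
    (hn : g n ∈ hit (stitCell p W g e)) (hf : ∀ f, Word.lt f e → kappa p W g f < n) :
    kappa p W g e ≤ n := by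
  rw [kappa_eq p W g e he]
  exact Nat.sInf_le ⟨hn, hf⟩

/-- As long as the indices do not exceed `n`, they are determined by the hyperplanes up to
time `n`. -/
theorem kappa_local {g g' : ℕ → Hyperplane ℓ} {n : ℕ} (hgg : ∀ m ≤ n, g m = g' m) (e : Word)
    (h : ∀ f, f = e ∨ Word.lt f e → Proceeds p W g f ∧ kappa p W g f ≤ n) :
    Proceeds p W g' e ∧ kappa p W g' e = kappa p W g e := by
  induction e using Word.lt_wf.induction with
  | h e ih =>
    by_cases he : e = []
    · subst he
      exact ⟨Or.inl rfl, by rw [kappa_nil, kappa_nil]⟩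
    have ih' : ∀ f, Word.lt f e → Proceeds p W g' f ∧ kappa p W g' f = kappa p W g f := by
      refine fun f hf => ih f hf fun d hd => h d (Or.inr ?_)
      rcases hd with rfl | hd
      · exact hf
      · exact Word.lt_trans hd hf
    have hcell : stitCell p W g' e = stitCell p W g e := by
      refine cell_congr p W e fun f hf => ?_
      rw [divider, divider, (ih' f hf).2, hgg _ (h f (Or.inr hf)).2]
    obtain ⟨hpe, hle⟩ := h e (Or.inl rfl)
    have hk := hpe.kappa_mem he
    have hmem : g' (kappa p W g e) ∈ hit (stitCell p W g' e) ∧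
        ∀ f, Word.lt f e → kappa p W g' f < kappa p W g e := by
      rw [hcell, ← hgg _ hle]
      exact ⟨hk.1, fun f hf => by rw [(ih' f hf).2]; exact hk.2 f hf⟩
    have hp' : Proceeds p W g' e := Or.inr ⟨_, hmem⟩
    refine ⟨hp', le_antisymm (kappa_le he hmem.1 hmem.2) ?_⟩
    have hle' : kappa p W g' e ≤ kappa p W g e := kappa_le he hmem.1 hmem.2
    have hk' := hp'.kappa_mem he
    refine kappa_le he ?_ fun f hf => ?_
    · rw [hgg _ (hle'.trans hle), ← hcell]
      exact hk'.1
    · rw [← (ih' f hf).2]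
      exact hk'.2 f hf

/-- The infimum of the empty set of natural numbers is `0`, hence the extra set for `m = 0`. -/
theorem measurable_sInf_nat {Y : Type*} [MeasurableSpace Y] {A : ℕ → Set Y}
    (hA : ∀ n, MeasurableSet (A n)) : Measurable fun y => sInf {n | y ∈ A n} := by
  refine measurable_to_countable' fun m => ?_
  have : (fun y => sInf {n | y ∈ A n}) ⁻¹' {m} =
      (A m ∩ ⋂ n ∈ {n | n < m}, (A n)ᶜ) ∪ {y | m = 0 ∧ y ∈ ⋂ n, (A n)ᶜ} := by
    ext y
    simp only [mem_preimage, mem_singleton_iff, mem_union, mem_inter_iff, mem_iInter, mem_compl_iff,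
      mem_ofPred_eq]
    constructor
    · rintro rfl
      by_cases hne : {n | y ∈ A n}.Nonempty
      · exact Or.inl ⟨Nat.sInf_mem hne, fun n hn => Nat.notMem_of_lt_sInf hn⟩
      · rw [not_nonempty_iff_eq_empty] at hne
        refine Or.inr ⟨by simp [hne], fun n hn => ?_⟩
        have : n ∈ {n | y ∈ A n} := hn
        simp [hne] at this
    · rintro (⟨h1, h2⟩ | ⟨rfl, h⟩)
      · refine le_antisymm (Nat.sInf_le h1) ?_
        by_contra hlt
        exact h2 _ (not_le.1 hlt) (Nat.sInf_mem (s := {n | y ∈ A n}) ⟨m, h1⟩)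
      · have : {n | y ∈ A n} = ∅ := eq_empty_of_forall_notMem h
        simp [this]
  rw [this]
  refine MeasurableSet.union ((hA m).inter ?_) (MeasurableSet.const _ |>.inter ?_)
  · exact MeasurableSet.biInter (to_countable _) fun n _ => (hA n).compl
  · exact MeasurableSet.iInter fun n => (hA n).compl

section Measurable

theorem measurable_apply_nat {Y : Type*} [MeasurableSpace Y] {k : (ℕ → Y) → ℕ}
    (hk : Measurable k) : Measurable fun g : ℕ → Y => g (k g) := by
  have : Measurable fun r : ℕ × (ℕ → Y) => r.2 r.1 :=
    measurable_from_prod_countable_right fun n => measurable_pi_apply n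
  exact this.comp (hk.prodMk measurable_id)

theorem measurable_kappa (hp : Measurable p) (hp_param : ∀ k, ofParam (p k) = k)
    (hW : IsCompact W) (e : Word) : Measurable fun g => kappa p W g e := by
  classical
  induction e using Word.lt_wf.induction with
  | h e ih =>
    by_cases he : e = []
    · subst he
      simp only [kappa_nil]
      exact measurable_const
    -- The cell of `e` depends on the dividers of the words before `e` only; the value for the other
    -- words is irrelevant and replaced by one that is known to be measurable.
    let h : (ℕ → Hyperplane ℓ) → Word → Hyperplane ℓ := fun g f =>
      if Word.lt f e then divider p W g f else g 0
    have hh : Measurable h := by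
      refine measurable_pi_iff.2 fun f => ?_
      by_cases hf : Word.lt f e
      · simp only [h, hf, if_true, divider]
        exact measurable_apply_nat (ih f hf)
      · simp only [h, hf, if_false]
        exact measurable_pi_apply 0
    have hcell : ∀ g, stitCell p W g e = cell p W (h g) e := fun g =>
      cell_congr p W e fun f hf => by simp [h, hf]
    have heq : (fun g => kappa p W g e) = fun g => sInf {n | g ∈ {g : ℕ → Hyperplane ℓ |
        g n ∈ hit (cell p W (h g) e) ∧ ∀ f, Word.lt f e → kappa p W g f < n}} := by
      ext g
      rw [kappa_eq p W g e he, hcell]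
      rfl
    rw [heq]
    refine measurable_sInf_nat fun n => MeasurableSet.inter ?_ ?_
    · exact measurableSet_mem_hit_cell hp hp_param hW hh (measurable_pi_apply n) e
    · have : {g : ℕ → Hyperplane ℓ | ∀ f, Word.lt f e → kappa p W g f < n} =
          ⋂ f ∈ {f | Word.lt f e}, {g | kappa p W g f < n} := by ext; simp
      change MeasurableSet {g : ℕ → Hyperplane ℓ | ∀ f, Word.lt f e → kappa p W g f < n}
      rw [this]
      exact MeasurableSet.biInter (to_countable _) fun f hf =>
        measurableSet_lt (ih f hf) measurable_const

theorem measurable_divider (hp : Measurable p) (hp_param : ∀ k, ofParam (p k) = k)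
    (hW : IsCompact W) : Measurable fun g => divider p W g :=
  measurable_pi_iff.2 fun e => measurable_apply_nat (measurable_kappa hp hp_param hW e)

theorem measurableSet_proceeds (hp : Measurable p) (hp_param : ∀ k, ofParam (p k) = k)
    (hW : IsCompact W) (e : Word) : MeasurableSet {g | Proceeds p W g e} := by
  have : {g | Proceeds p W g e} = {_g | e = []} ∪
      ⋃ n : ℕ, ({g | g n ∈ hit (cell p W (divider p W g) e)} ∩
      ⋂ f ∈ {f | Word.lt f e}, {g | kappa p W g f < n}) := by
    ext g
    simp [Proceeds, stitCell]
  rw [this]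
  refine (MeasurableSet.const _).union (MeasurableSet.iUnion fun n => MeasurableSet.inter ?_ ?_)
  · exact measurableSet_mem_hit_cell hp hp_param hW (measurable_divider hp hp_param hW)
      (measurable_pi_apply n) e
  · exact MeasurableSet.biInter (to_countable _) fun f hf =>
      measurableSet_lt (measurable_kappa hp hp_param hW f) measurable_const

end Measurable

/-- All words before `e` have been assigned indices, the last of which is `n`. -/
def reachedAt (p : Hyperplane ℓ → Param ℓ) (W : Set (Space ℓ)) (e : Word) (n : ℕ) :
    Set (ℕ → Hyperplane ℓ) :=
  {g | (∀ f, Word.lt f e → Proceeds p W g f ∧ kappa p W g f ≤ n) ∧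
    ∃ f, Word.lt f e ∧ kappa p W g f = n}

theorem measurableSet_reachedAt (hp : Measurable p) (hp_param : ∀ k, ofParam (p k) = k)
    (hW : IsCompact W) (e : Word) (n : ℕ) : MeasurableSet (reachedAt p W e n) := by
  have : reachedAt p W e n = (⋂ f ∈ {f | Word.lt f e}, ({g | Proceeds p W g f} ∩
      {g | kappa p W g f ≤ n})) ∩ ⋃ f ∈ {f | Word.lt f e}, {g | kappa p W g f = n} := by
    ext g
    simp [reachedAt]
  rw [this]
  refine MeasurableSet.inter (MeasurableSet.biInter (to_countable _) fun f _ => ?_)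
    (MeasurableSet.biUnion (to_countable _) fun f _ => ?_)
  · exact (measurableSet_proceeds hp hp_param hW f).inter
      (measurableSet_le (measurable_kappa hp hp_param hW f) measurable_const)
  · exact measurableSet_eq_fun (measurable_kappa hp hp_param hW f) measurable_const

theorem reachedAt_local {g g' : ℕ → Hyperplane ℓ} {n : ℕ} (hgg : ∀ m ≤ n, g m = g' m) {e : Word}
    (hg : g ∈ reachedAt p W e n) : g' ∈ reachedAt p W e n ∧
      ∀ f, Word.lt f e → divider p W g' f = divider p W g f := by
  have h : ∀ f, Word.lt f e → Proceeds p W g' f ∧ kappa p W g' f = kappa p W g f := fun f hf =>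
    kappa_local hgg f fun d hd => hg.1 d (by
      rcases hd with rfl | hd
      · exact hf
      · exact Word.lt_trans hd hf)
  refine ⟨⟨fun f hf => ⟨(h f hf).1, (h f hf).2 ▸ (hg.1 f hf).2⟩, ?_⟩, fun f hf => ?_⟩
  · obtain ⟨f, hf, hfn⟩ := hg.2
    exact ⟨f, hf, (h f hf).2.trans hfn⟩
  · rw [divider, divider, (h f hf).2, hgg _ (hg.1 f hf).2]

theorem exists_reachedAt {g : ℕ → Hyperplane ℓ} {e : Word} (he : e ≠ [])
    (h : ∀ f, Word.lt f e → Proceeds p W g f) : ∃ n, g ∈ reachedAt p W e n := by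
  obtain ⟨m, hm, hmax⟩ := (Word.finite_setOf_lt e).exists_maximalFor (kappa p W g) _
    ⟨[], Word.nil_lt he⟩
  refine ⟨kappa p W g m, fun f hf => ⟨h f hf, ?_⟩, m, hm, rfl⟩
  rcases le_total (kappa p W g f) (kappa p W g m) with h' | h'
  · exact h'
  · exact hmax hf h'

theorem reachedAt_unique {g : ℕ → Hyperplane ℓ} {e : Word} {m n : ℕ}
    (hm : g ∈ reachedAt p W e m) (hn : g ∈ reachedAt p W e n) : m = n := by
  obtain ⟨f, hf, rfl⟩ := hm.2
  obtain ⟨f', hf', rfl⟩ := hn.2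
  exact le_antisymm (hn.1 f hf).2 (hm.1 f' hf').2

end STIT

namespace STIT

variable {ℓ : ℕ}

/-! ### The joint law of the dividing hyperplanes -/

/-- The density of the dividing hyperplanes of the words in `D`, with respect to independent
hyperplanes with law `ν`: each is conditioned on hitting the cell it divides. The density does not
refer to any order of the words. -/
noncomputable def dividerDensity (ν : Measure (Hyperplane ℓ)) (p : Hyperplane ℓ → Param ℓ)
    (W : Set (Space ℓ)) (D : Finset Word) (h : Word → Hyperplane ℓ) : ℝ≥0∞ :=
  ∏ e ∈ D, hitDensity ν (cell p W h e) (h e)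

/-- A set of words that contains the predecessor of each of its nonempty members. -/
def PrefixClosed (D : Finset Word) : Prop := ∀ b e, b :: e ∈ D → e ∈ D

theorem PrefixClosed.mem_of_suffix {D : Finset Word} (hD : PrefixClosed D) {f e : Word}
    (he : e ∈ D) (hf : f <:+ e) : f ∈ D := by
  induction e with
  | nil =>
    rw [List.suffix_nil.1 hf]
    exact he
  | cons b e ih =>
    rcases List.suffix_cons_iff.1 hf with rfl | hf
    · exact he
    · exact ih (hD b e he) hf

theorem PrefixClosed.erase {D : Finset Word} (hD : PrefixClosed D) {e : Word}
    (hmax : ∀ f ∈ D, f = e ∨ Word.lt f e) : PrefixClosed (D.erase e) := by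
  intro b f hf
  rw [Finset.mem_erase] at hf ⊢
  refine ⟨?_, hD b f hf.2⟩
  rintro rfl
  rcases hmax _ hf.2 with h | h
  · exact hf.1 h
  · exact Word.lt_irrefl _ (Word.lt_trans h (Word.lt_cons b f))

/-- The set of the given word and its predecessors. -/
def ancestors (e : Word) : Finset Word := e.tails.toFinset

theorem mem_ancestors {e f : Word} : f ∈ ancestors e ↔ f <:+ e := by simp [ancestors]

theorem prefixClosed_ancestors (e : Word) : PrefixClosed (ancestors e) := by
  intro b f hf
  rw [mem_ancestors] at hf ⊢
  exact (List.suffix_cons b f).trans hf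

variable {p : Hyperplane ℓ → Param ℓ} {W : Set (Space ℓ)} {ν : Measure (Hyperplane ℓ)}

theorem cell_update_of_not_suffix {h : Word → Hyperplane ℓ} {e f : Word} {y : Hyperplane ℓ}
    (hef : e <:+ f → e = f) : cell p W (Function.update h e y) f = cell p W h f :=
  cell_congr_suffix p W f fun d hd hne => Function.update_of_ne (by
    rintro rfl
    exact hne (hef hd)) _ _

section Measurable

variable {Y : Type*} [MeasurableSpace Y] {h : Y → Word → Hyperplane ℓ} {k : Y → Hyperplane ℓ}

theorem measurable_hitDensity_cell (hp : Measurable p) (hp_param : ∀ k, ofParam (p k) = k)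
    (hW : IsCompact W) [SFinite ν] (hh : Measurable h) (hk : Measurable k) (e : Word) :
    Measurable fun y => hitDensity ν (cell p W (h y) e) (k y) := by
  refine (measurable_measure_hit_cell hp hp_param hW hh ν e).inv.mul ?_
  exact (measurable_const (a := (1 : ℝ≥0∞))).indicator
    (measurableSet_mem_hit_cell hp hp_param hW hh hk e)

theorem measurable_dividerDensity (hp : Measurable p) (hp_param : ∀ k, ofParam (p k) = k)
    (hW : IsCompact W) [SFinite ν] (D : Finset Word) : Measurable (dividerDensity ν p W D) :=
  Finset.measurable_prod _ fun e _ => measurable_hitDensity_cell hp hp_param hW measurable_id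
    (measurable_pi_apply e) e

end Measurable

section Law

variable [IsProbabilityMeasure ν]

/-- Integrating out the divider of a word none of whose successors is in play. -/
theorem lintegral_dividerDensity_insert (hp : Measurable p) (hp_param : ∀ k, ofParam (p k) = k)
    (hW : IsCompact W) {D : Finset Word} {e : Word} (he : e ∉ D) (hmax : ∀ f ∈ D, ¬ e <:+ f)
    {F : (Word → Hyperplane ℓ) → ℝ≥0∞} (hF : Measurable F) :
    ∫⁻ h, F h * dividerDensity ν p W (insert e D) h ∂(Measure.infinitePi fun _ : Word => ν) =
      ∫⁻ h, (∫⁻ y, hitDensity ν (cell p W h e) y * F (Function.update h e y) ∂ν) *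
        dividerDensity ν p W D h ∂(Measure.infinitePi fun _ : Word => ν) := by
  have hd : Measurable fun h => F h * dividerDensity ν p W (insert e D) h :=
    hF.mul (measurable_dividerDensity hp hp_param hW _)
  rw [lintegral_resample _ e hd]
  refine lintegral_congr fun h => ?_
  have hm : Measurable fun y => hitDensity ν (cell p W h e) y * F (Function.update h e y) :=
    (measurable_hitDensity_cell hp hp_param hW measurable_const measurable_id e).mul
      (hF.comp (measurable_update h))
  rw [← lintegral_mul_const _ hm]
  refine lintegral_congr fun y => ?_
  rw [dividerDensity, Finset.prod_insert he, cell_update_of_not_suffix fun _ => rfl,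
    Function.update_self]
  have : ∏ f ∈ D, hitDensity ν (cell p W (Function.update h e y) f) (Function.update h e y f) =
      dividerDensity ν p W D h := by
    refine Finset.prod_congr rfl fun f hf => ?_
    rw [cell_update_of_not_suffix fun hs => absurd hs (hmax f hf),
      Function.update_of_ne (by rintro rfl; exact he hf)]
  rw [this]
  ring

/-- If the indices before `e` run up to `n`, the hyperplane of `e` is the first one after time `n`
that hits the cell of `e`. -/
theorem indicator_proceeds_eq_tsum {g : ℕ → Hyperplane ℓ} {e : Word} (he : e ≠ []) {n : ℕ}
    (hn : g ∈ reachedAt p W e n) (F : (Word → Hyperplane ℓ) → ℝ≥0∞) :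
    {g | Proceeds p W g e}.indicator (fun g => F (divider p W g)) g =
      ∑' j, (∏ i ∈ Finset.range j, (hit (stitCell p W g e))ᶜ.indicator 1 (g (n + 1 + i))) *
        (hit (stitCell p W g e)).indicator (fun y => F (Function.update (divider p W g) e y))
          (g (n + 1 + j)) := by
  by_cases hpe : Proceeds p W g e
  · obtain ⟨hk1, hk2⟩ := hpe.kappa_mem he
    have hnk : n < kappa p W g e := by
      obtain ⟨f, hf, rfl⟩ := hn.2
      exact hk2 f hf
    obtain ⟨j, hj⟩ := Nat.exists_eq_add_of_lt hnk
    have hj : kappa p W g e = n + 1 + j := by omega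
    have hbefore : ∀ i < j, g (n + 1 + i) ∉ hit (stitCell p W g e) := by
      intro i hi hmem
      have := kappa_le he hmem fun f hf => lt_of_le_of_lt (hn.1 f hf).2 (by omega)
      omega
    rw [tsum_eq_single j]
    · rw [Finset.prod_eq_one fun i hi => by
        rw [indicator_of_mem (hbefore i (Finset.mem_range.1 hi))]; rfl, one_mul]
      rw [← hj, indicator_of_mem hk1, indicator_of_mem (by exact hpe)]
      congr 1
      ext1 f
      by_cases hfe : f = e
      · subst hfe; simp [divider]
      · rw [Function.update_of_ne hfe]
    · intro i hi
      rcases lt_or_gt_of_ne hi with h | h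
      · rw [indicator_of_notMem (hbefore i h), mul_zero]
      · rw [Finset.prod_eq_zero (Finset.mem_range.2 h), zero_mul]
        rw [← hj]
        simp [hk1]
  · rw [indicator_of_notMem (by exact hpe)]
    symm
    rw [ENNReal.tsum_eq_zero]
    intro j
    have : g (n + 1 + j) ∉ hit (stitCell p W g e) := fun hmem =>
      hpe (Or.inr ⟨_, hmem, fun f hf => lt_of_le_of_lt (hn.1 f hf).2 (by omega)⟩)
    rw [indicator_of_notMem this, mul_zero]

/-- Each word's hyperplane is the first one, among those after the indices of all preceding words,
that hits its cell; hence, given the preceding hyperplanes, its law is `ν` conditioned on hitting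
the cell. -/
theorem lintegral_divider_step (hp : Measurable p) (hp_param : ∀ k, ofParam (p k) = k)
    (hW : IsCompact W) {e : Word} (he : e ≠ [])
    (hI : ∀ᵐ g ∂(Measure.infinitePi fun _ : ℕ => ν), ∀ f, Word.lt f e → Proceeds p W g f)
    {F : (Word → Hyperplane ℓ) → ℝ≥0∞} (hF : Measurable F)
    (hFd : DependsOn F {f | f = e ∨ Word.lt f e}) :
    ∫⁻ g, {g | Proceeds p W g e}.indicator (fun g => F (divider p W g)) g
        ∂(Measure.infinitePi fun _ : ℕ => ν) =
      ∫⁻ g, ∫⁻ y, hitDensity ν (stitCell p W g e) y * F (Function.update (divider p W g) e y) ∂ν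
        ∂(Measure.infinitePi fun _ : ℕ => ν) := by
  classical
  have hdiv := measurable_divider hp hp_param hW (W := W)
  set μ := Measure.infinitePi fun _ : ℕ => ν
  -- On the event that the indices before `e` run up to `n`, which is decided by the terms up to time
  -- `n`, the set of hyperplanes that hit the cell of `e`; empty off this event.
  let S : ℕ → (ℕ → Hyperplane ℓ) → Set (Hyperplane ℓ) := fun n g =>
    {y | g ∈ reachedAt p W e n ∧ y ∈ hit (stitCell p W g e)}
  let Θ : ℕ → (ℕ → Hyperplane ℓ) → Hyperplane ℓ → ℝ≥0∞ := fun n g y =>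
    (S n g).indicator (fun y => F (Function.update (divider p W g) e y)) y
  have hUm := fun n => measurableSet_reachedAt hp hp_param hW e n (W := W)
  have hS : ∀ n, MeasurableSet {q : (ℕ → Hyperplane ℓ) × Hyperplane ℓ | q.2 ∈ S n q.1} := fun n =>
    ((hUm n).preimage measurable_fst).inter (measurableSet_mem_hit_cell hp hp_param hW
      (hdiv.comp measurable_fst) measurable_snd e)
  have hupd : Measurable fun q : (ℕ → Hyperplane ℓ) × Hyperplane ℓ =>
      F (Function.update (divider p W q.1) e q.2) :=
    hF.comp ((measurable_update_prod e).comp ((hdiv.comp measurable_fst).prodMk measurable_snd))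
  have hΘ : ∀ n, Measurable (Function.uncurry (Θ n)) := fun n => hupd.indicator (hS n)
  have hΘS : ∀ n, ∀ g g' : ℕ → Hyperplane ℓ, (∀ m ∈ Iic n, g m = g' m) →
      S n g = S n g' ∧ Θ n g = Θ n g' := by
    intro n g g' hgg
    by_cases hg : g ∈ reachedAt p W e n
    · obtain ⟨hg', hdd⟩ := reachedAt_local (fun m hm => hgg m hm) hg
      have hc : stitCell p W g e = stitCell p W g' e :=
        cell_congr p W e fun f hf => (hdd f hf).symm
      have hSS : S n g = S n g' := by simp only [S, hg, hg', hc]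
      refine ⟨hSS, ?_⟩
      ext y
      simp only [Θ, hSS]
      congr 1
      ext y
      refine hFd fun f hf => ?_
      by_cases hfe : f = e
      · subst hfe; simp
      · rw [Function.update_of_ne hfe, Function.update_of_ne hfe]
        exact (hdd f (hf.resolve_left hfe)).symm
    · have hg' : g' ∉ reachedAt p W e n := fun hg' =>
        hg (reachedAt_local (fun m hm => (hgg m hm).symm) hg').1
      have h1 : S n g = ∅ := by ext y; simp [S, hg]
      have h2 : S n g' = ∅ := by ext y; simp [S, hg']
      refine ⟨by rw [h1, h2], ?_⟩
      ext y
      simp [Θ, h1, h2]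
  have key := fun n => lintegral_iid_first_hit ν n (hΘ n) (fun g g' h => (hΘS n g g' h).2) (hS n)
    (fun g g' h => (hΘS n g g' h).1)
  have hleft : ∀ᵐ g ∂μ, {g | Proceeds p W g e}.indicator (fun g => F (divider p W g)) g =
      ∑' n, ∑' j, (∏ i ∈ Finset.range j, (S n g)ᶜ.indicator 1 (g (n + 1 + i))) *
        Θ n g (g (n + 1 + j)) := by
    filter_upwards [hI] with g hg
    obtain ⟨n, hn⟩ := exists_reachedAt he hg
    rw [tsum_eq_single n]
    swap
    · intro m hm
      have hm' : g ∉ reachedAt p W e m := fun h => hm (reachedAt_unique h hn)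
      have h1 : S m g = ∅ := by ext y; simp [S, hm']
      simp [Θ, h1]
    have hSn : S n g = hit (stitCell p W g e) := by ext y; simp [S, hn]
    simp only [Θ, hSn]
    exact indicator_proceeds_eq_tsum he hn F
  have hright : ∀ᵐ g ∂μ, ∑' n, (ν (S n g))⁻¹ * ∫⁻ y, Θ n g y ∂ν =
      ∫⁻ y, hitDensity ν (stitCell p W g e) y * F (Function.update (divider p W g) e y) ∂ν := by
    filter_upwards [hI] with g hg
    obtain ⟨n, hn⟩ := exists_reachedAt he hg
    rw [tsum_eq_single n]
    swap
    · intro m hm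
      have hm' : g ∉ reachedAt p W e m := fun h => hm (reachedAt_unique h hn)
      have h1 : S m g = ∅ := by ext y; simp [S, hm']
      simp [Θ, h1]
    have hSn : S n g = hit (stitCell p W g e) := by ext y; simp [S, hn]
    have hm : Measurable fun y => Θ n g y := (hΘ n).comp measurable_prodMk_left
    rw [← lintegral_const_mul _ hm]
    refine lintegral_congr fun y => ?_
    simp only [Θ, hSn, hitDensity]
    by_cases hy : y ∈ hit (stitCell p W g e) <;> simp [hy]
  have hsm := fun n j => measurable_miss_mul (hΘ n) (hS n) n j
  have hsm' : ∀ n, Measurable fun g => (ν (S n g))⁻¹ * ∫⁻ y, Θ n g y ∂ν := fun n =>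
    (measurable_measure_prodMk_left (ν := ν) (hS n)).inv.mul (hΘ n).lintegral_prod_right'
  rw [lintegral_congr_ae hleft, ← lintegral_congr_ae hright,
    lintegral_tsum fun n => (Measurable.tsum fun j => hsm n j).aemeasurable,
    lintegral_tsum fun n => (hsm' n).aemeasurable]
  exact tsum_congr key

end Law

end STIT

namespace STIT

variable {ℓ : ℕ}

variable {p : Hyperplane ℓ → Param ℓ} {W : Set (Space ℓ)}

/-- A cell is a polytope with nonempty interior if all divisions that lead to it are proper. -/
theorem isCell_cell (hW : IsCell W) {h : Word → Hyperplane ℓ} {e : Word}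
    (hc : ∀ f, f <:+ e → f ≠ e → Cuts (p (h f)) (cell p W h f)) : IsCell (cell p W h e) := by
  induction e with
  | nil => exact hW
  | cons b e ih =>
    have hne : ∀ f : Word, f <:+ e → f ≠ b :: e := by
      rintro f hf rfl
      have := hf.length_le
      simp at this
    exact (ih fun f hf _ => hc f (hf.trans (List.suffix_cons b e)) (hne f hf)).inter_half
      (hc e (List.suffix_cons b e) (hne e List.suffix_rfl)) b

section Law

variable {Λ : Measure (Hyperplane ℓ)}

/-- Independent hyperplanes with law `ν ≪ Λ` properly divide the cells that they hit. -/
theorem ae_cuts_of_mem_hit (hΛ : IsHyperplaneMeasure Λ) (hp : Measurable p)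
    (hp_param : ∀ k, ofParam (p k) = k) (hW : IsCompact W) {ν : Measure (Hyperplane ℓ)}
    [IsProbabilityMeasure ν] (hν : ν ≪ Λ) :
    ∀ᵐ h ∂(Measure.infinitePi fun _ : Word => ν), ∀ e, IsCell (cell p W h e) →
      h e ∈ hit (cell p W h e) → Cuts (p (h e)) (cell p W h e) := by
  rw [ae_all_iff]
  intro e
  -- the pairs whose second entry meets the cell of `e` without dividing it properly
  let B : Set ((Word → Hyperplane ℓ) × Hyperplane ℓ) :=
    {r | r.2 ∈ hit (cell p W r.1 e)} ∩ {r | Cuts (p r.2) (cell p W r.1 e)}ᶜ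
  have hB : MeasurableSet B :=
    (measurableSet_mem_hit_cell hp hp_param hW measurable_fst measurable_snd e).inter
      (measurableSet_cuts_cell hp hW measurable_fst (hp.comp measurable_snd) e).compl
  have hβ : Measurable fun h => ν (Prod.mk h ⁻¹' B) := measurable_measure_prodMk_left hB
  -- That the cell is a polytope is not known to be a measurable condition; it is replaced by the
  -- condition that the corresponding section of `B` is a null set.
  have hs : MeasurableSet {h : Word → Hyperplane ℓ | ν (Prod.mk h ⁻¹' B) = 0 → (h, h e) ∉ B} := by
    have : {h : Word → Hyperplane ℓ | ν (Prod.mk h ⁻¹' B) = 0 → (h, h e) ∉ B} =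
        {h | ν (Prod.mk h ⁻¹' B) = 0}ᶜ ∪ ((fun h => (h, h e)) ⁻¹' B)ᶜ := by
      ext h
      simp only [mem_ofPred_eq, mem_union, mem_compl_iff, mem_preimage]
      tauto
    rw [this]
    refine (measurableSet_eq_fun hβ measurable_const).compl.union ?_
    exact ((measurable_id.prodMk (measurable_pi_apply e)) hB).compl
  have hae := ae_resample (fun _ : Word => ν) e hs fun g => by
    have hsec : ∀ y, (Prod.mk (Function.update g e y) ⁻¹' B) = Prod.mk g ⁻¹' B := by
      intro y
      ext z
      simp only [B, mem_preimage, mem_inter_iff, mem_ofPred_eq, mem_compl_iff]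
      rw [cell_update_of_not_suffix fun _ => rfl]
    have hmem : ∀ y, (Function.update g e y, y) ∈ B ↔ y ∈ Prod.mk g ⁻¹' B := fun y => by
      rw [← hsec y]; rfl
    by_cases h0 : ν (Prod.mk g ⁻¹' B) = 0
    · filter_upwards [measure_eq_zero_iff_ae_notMem.1 h0] with y hy
      simp only [Function.update_self, hmem]
      exact fun _ => hy
    · refine Filter.Eventually.of_forall fun y => ?_
      simp only [mem_ofPred_eq, hsec]
      exact fun h => absurd h h0
  filter_upwards [hae] with h hh hcell hhit
  by_contra hcut
  refine hh ?_ ⟨hhit, hcut⟩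
  have : ∀ᵐ y ∂ν, y ∈ hit (cell p W h e) → Cuts (p y) (cell p W h e) :=
    hν.ae_le (hcell.ae_cuts hΛ p hp_param)
  rw [ae_iff] at this
  convert this using 2
  ext y
  simp [B]

/-- All divisions of the words in `D` are proper. -/
def ProperOn (p : Hyperplane ℓ → Param ℓ) (W : Set (Space ℓ)) (D : Finset Word)
    (h : Word → Hyperplane ℓ) : Prop := ∀ e ∈ D, Cuts (p (h e)) (cell p W h e)

theorem measurableSet_properOn (hp : Measurable p) (hW : IsCompact W) (D : Finset Word) :
    MeasurableSet {h | ProperOn p W D h} := by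
  have : {h | ProperOn p W D h} = ⋂ e ∈ D, {h | Cuts (p (h e)) (cell p W h e)} := by
    ext h; simp [ProperOn]
  rw [this]
  exact D.measurableSet_biInter fun e _ =>
    measurableSet_cuts_cell hp hW measurable_id (hp.comp (measurable_pi_apply e)) e

theorem dependsOn_properOn {D : Finset Word} (hD : PrefixClosed D) :
    DependsOn (ProperOn p W D) D := by
  intro h h' hh
  have : ∀ e ∈ D, Cuts (p (h e)) (cell p W h e) ↔ Cuts (p (h' e)) (cell p W h' e) := by
    intro e he
    rw [hh e he, cell_congr_suffix p W e fun f hf _ => hh f (hD.mem_of_suffix he hf)]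
  simp only [ProperOn, eq_iff_iff]
  exact forall₂_congr this

/-- Where the density does not vanish, every hyperplane hits the cell that it divides; along the
order on words, all these cells are polytopes with interior points. -/
theorem ae_properOn_of_dividerDensity_ne_zero (hΛ : IsHyperplaneMeasure Λ) (hp : Measurable p)
    (hp_param : ∀ k, ofParam (p k) = k) (hW : IsCell W) {ν : Measure (Hyperplane ℓ)}
    [IsProbabilityMeasure ν] (hν : ν ≪ Λ) {D : Finset Word} (hD : PrefixClosed D) :
    ∀ᵐ h ∂(Measure.infinitePi fun _ : Word => ν),
      dividerDensity ν p W D h ≠ 0 → ProperOn p W D h := by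
  filter_upwards [ae_cuts_of_mem_hit hΛ hp hp_param hW.isCompact hν] with h hh hne e
  induction e using Word.lt_wf.induction with
  | h e ih =>
    intro he
    refine hh e (isCell_cell hW fun f hf hfe =>
      ih f (Word.lt_of_suffix hf hfe) (hD.mem_of_suffix he hf)) ?_
    have := Finset.prod_ne_zero_iff.1 hne e he
    rw [hitDensity] at this
    by_contra hnot
    simp [hnot] at this

theorem normalized_absolutelyContinuous : normalized Λ W ≪ Λ :=
  (Measure.smul_absolutelyContinuous).trans Measure.restrict_le_self.absolutelyContinuous

/-- The joint law of the dividers of the words in `D` has density `dividerDensity`. -/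
def HasDividerLaw (ν : Measure (Hyperplane ℓ)) (p : Hyperplane ℓ → Param ℓ) (W : Set (Space ℓ))
    (D : Finset Word) : Prop :=
  ∀ F : (Word → Hyperplane ℓ) → ℝ≥0∞, Measurable F → DependsOn F D →
    ∫⁻ g, F (divider p W g) ∂(Measure.infinitePi fun _ : ℕ => ν) =
      ∫⁻ h, F h * dividerDensity ν p W D h ∂(Measure.infinitePi fun _ : Word => ν)

theorem HasDividerLaw.ae_properOn (hΛ : IsHyperplaneMeasure Λ) (hp : Measurable p)
    (hp_param : ∀ k, ofParam (p k) = k) (hW : IsCell W) {ν : Measure (Hyperplane ℓ)}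
    [IsProbabilityMeasure ν] (hν : ν ≪ Λ) {D : Finset Word} (hD : PrefixClosed D)
    (hlaw : HasDividerLaw ν p W D) :
    ∀ᵐ g ∂(Measure.infinitePi fun _ : ℕ => ν), ProperOn p W D (divider p W g) := by
  have hm := measurableSet_properOn hp hW.isCompact D
  have h0 := hlaw ({h | ProperOn p W D h}ᶜ.indicator 1) (measurable_one.indicator hm.compl)
    (fun h h' hh => by
      have := dependsOn_properOn hD (p := p) (W := W) hh
      by_cases h1 : ProperOn p W D h
      · have h2 : ProperOn p W D h' := this ▸ h1
        simp [h1, h2]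
      · have h2 : ¬ ProperOn p W D h' := this ▸ h1
        simp [h1, h2])
  have hzero : ∫⁻ h, {h | ProperOn p W D h}ᶜ.indicator (1 : (Word → Hyperplane ℓ) → ℝ≥0∞) h *
      dividerDensity ν p W D h ∂(Measure.infinitePi fun _ : Word => ν) = 0 := by
    refine (lintegral_congr_ae ?_).trans lintegral_zero
    filter_upwards [ae_properOn_of_dividerDensity_ne_zero hΛ hp hp_param hW hν hD] with h hh
    by_cases h1 : dividerDensity ν p W D h = 0
    · simp [h1]
    · simp [hh h1]
  rw [hzero] at h0
  have hmeas : Measurable fun g : ℕ → Hyperplane ℓ =>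
      {h | ProperOn p W D h}ᶜ.indicator (1 : (Word → Hyperplane ℓ) → ℝ≥0∞) (divider p W g) :=
    (measurable_one.indicator hm.compl).comp (measurable_divider hp hp_param hW.isCompact)
  rw [lintegral_eq_zero_iff hmeas] at h0
  filter_upwards [h0] with g hg
  by_contra hnot
  simp [hnot] at hg

/-- Almost surely every cell is eventually divided, and the dividers of finitely many words, closed
under predecessors, have the density `dividerDensity`. Both statements are proved together along
the order on words. -/
theorem ae_proceeds_and_hasDividerLaw (hΛ : IsHyperplaneMeasure Λ) (hp : Measurable p)
    (hp_param : ∀ k, ofParam (p k) = k) (hW : IsCell W) (e : Word) :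
    (∀ᵐ g ∂(Measure.infinitePi fun _ : ℕ => normalized Λ W), Proceeds p W g e) ∧
      ∀ D : Finset Word, PrefixClosed D → (∀ f ∈ D, f = e ∨ Word.lt f e) →
        HasDividerLaw (normalized Λ W) p W D := by
  classical
  have := isProbabilityMeasure_normalized hΛ hW
  set ν := normalized Λ W with hν
  have hνΛ : ν ≪ Λ := normalized_absolutelyContinuous
  have hW' := hW.isCompact
  have hdiv := measurable_divider hp hp_param hW' (W := W)
  have hempty : HasDividerLaw ν p W ∅ := by
    intro F _ hFd
    have hconst : ∀ h h', F h = F h' := fun h h' => hFd fun _ hi => by simp at hi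
    by_cases hne : Nonempty (Word → Hyperplane ℓ)
    · obtain ⟨h0⟩ := hne
      simp only [fun h => hconst h h0, dividerDensity, Finset.prod_empty, mul_one, lintegral_const,
        measure_univ]
    · have : IsEmpty (Word → Hyperplane ℓ) := not_nonempty_iff.1 hne
      have h2 : IsEmpty (ℕ → Hyperplane ℓ) :=
        ⟨fun g => this.false fun _ => g 0⟩
      simp [Measure.eq_zero_of_isEmpty]
  induction e using Word.lt_wf.induction with
  | h e ih =>
    -- the law for sets of words that strictly precede `e`
    have hlt : ∀ D : Finset Word, PrefixClosed D → (∀ f ∈ D, Word.lt f e) →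
        HasDividerLaw ν p W D := by
      intro D hD hDe
      rcases D.eq_empty_or_nonempty with rfl | hne
      · exact hempty
      · obtain ⟨m, hm, hmax⟩ := Word.exists_max D hne
        exact (ih m (hDe m hm)).2 D hD hmax
    have hI : ∀ᵐ g ∂(Measure.infinitePi fun _ : ℕ => ν), ∀ f, Word.lt f e → Proceeds p W g f := by
      rw [ae_all_iff]
      intro f
      by_cases hf : Word.lt f e
      · filter_upwards [(ih f hf).1] with g hg _ using hg
      · exact Filter.Eventually.of_forall fun g h => absurd h hf
    -- `lintegral_divider_step` with `F = 1` computes the probability that `e` proceeds; it is `1`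
    -- since the cell of `e` is almost surely hit with positive probability.
    have hstep : (∀ᵐ g ∂(Measure.infinitePi fun _ : ℕ => ν), Proceeds p W g e) := by
      by_cases he : e = []
      · exact Filter.Eventually.of_forall fun g => Or.inl he
      have h1 := lintegral_divider_step hp hp_param hW' he hI (F := fun _ => 1) measurable_const
        (fun _ _ _ => rfl)
      have hD : PrefixClosed ((ancestors e).erase e) :=
        (prefixClosed_ancestors e).erase fun f hf => by
          by_cases hfe : f = e
          · exact Or.inl hfe
          · exact Or.inr (Word.lt_of_suffix (mem_ancestors.1 hf) hfe)
      have hprop := (hlt _ hD fun f hf => by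
        rw [Finset.mem_erase, mem_ancestors] at hf
        exact Word.lt_of_suffix hf.2 hf.1).ae_properOn hΛ hp hp_param hW hνΛ hD
      have h2 : ∫⁻ g, ∫⁻ y, hitDensity ν (stitCell p W g e) y * 1 ∂ν
          ∂(Measure.infinitePi fun _ : ℕ => ν) = 1 := by
        refine (lintegral_congr_ae (g := fun _ => 1) ?_).trans (by simp)
        filter_upwards [hprop] with g hg
        have hcell : IsCell (stitCell p W g e) := isCell_cell hW fun f hf hfe =>
          hg f (Finset.mem_erase.2 ⟨hfe, mem_ancestors.2 hf⟩)
        have hcW : stitCell p W g e ⊆ W := cell_subset p W _ e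
        have hm := measurableSet_hit hcell.isCompact
        simp only [mul_one, hitDensity]
        rw [lintegral_const_mul _ (measurable_one.indicator hm), lintegral_indicator_one hm]
        refine ENNReal.inv_mul_cancel ?_ (measure_ne_top _ _)
        rw [hν, normalized_apply_hit hcW hcell.isCompact]
        exact mul_ne_zero (ENNReal.inv_ne_zero.2 (measure_hit_lt_top hΛ hW').ne)
          (hcell.measure_hit_pos hΛ).ne'
      rw [h2] at h1
      have hpm := measurableSet_proceeds hp hp_param hW' (W := W) e
      have h3 : (Measure.infinitePi fun _ : ℕ => ν) {g | Proceeds p W g e} = 1 := by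
        rw [← h1, ← lintegral_indicator_one hpm]
        rfl
      exact (mem_ae_iff_prob_eq_one hpm).2 h3
    refine ⟨hstep, fun D hD hDe => ?_⟩
    by_cases heD : e ∈ D
    swap
    · exact hlt D hD fun f hf => (hDe f hf).resolve_left (by rintro rfl; exact heD hf)
    by_cases he : e = []
    · -- the first hyperplane hits the window
      subst he
      have hD0 : D = {[]} := by
        ext f
        simp only [Finset.mem_singleton]
        refine ⟨fun hf => (hDe f hf).resolve_right (Word.lt_nil f), ?_⟩
        rintro rfl
        exact heD
      subst hD0
      intro F hF hFd
      have hFc : ∀ h, F h = F fun _ => h [] := fun h => hFd fun i hi => by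
        simp only [Finset.coe_singleton, mem_singleton_iff] at hi
        rw [hi]
      have hFm : Measurable fun y : Hyperplane ℓ => F fun _ => y :=
        hF.comp (measurable_pi_iff.2 fun _ => measurable_id)
      have hdd : ∀ h, dividerDensity ν p W {[]} h = hitDensity ν W (h []) := fun h => by
        simp [dividerDensity, cell]
      have hone : ∀ᵐ y ∂ν, hitDensity ν W y = 1 := by
        have h1 : ν (hit W) = 1 := by
          rw [hν, normalized_apply_hit Subset.rfl hW']
          exact ENNReal.inv_mul_cancel (hW.measure_hit_pos hΛ).ne' (measure_hit_lt_top hΛ hW').ne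
        filter_upwards [(mem_ae_iff_prob_eq_one (measurableSet_hit hW')).2 h1] with y hy
        simp [hitDensity, h1, hy]
      have e1 : ∫⁻ g, F (divider p W g) ∂(Measure.infinitePi fun _ : ℕ => ν) =
          ∫⁻ y, (F fun _ => y) ∂ν := by
        rw [← (measurePreserving_eval_infinitePi (fun _ : ℕ => ν) 0).lintegral_comp hFm]
        refine lintegral_congr fun g => ?_
        rw [hFc, divider, kappa_nil]
      have hdm : Measurable fun y => (F fun _ => y) * hitDensity ν W y :=
        hFm.mul (measurable_hitDensity_cell hp hp_param hW'
          (h := fun (y : Hyperplane ℓ) (_ : Word) => y)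
          (measurable_pi_iff.2 fun _ => measurable_id) measurable_id [])
      rw [e1]
      calc ∫⁻ y, (F fun _ => y) ∂ν = ∫⁻ y, (F fun _ => y) * hitDensity ν W y ∂ν := by
            refine lintegral_congr_ae ?_
            filter_upwards [hone] with y hy
            rw [hy, mul_one]
        _ = _ := by
            rw [← (measurePreserving_eval_infinitePi (fun _ : Word => ν) []).lintegral_comp hdm]
            refine lintegral_congr fun h => ?_
            rw [hdd, hFc h]
    -- integrate out the divider of `e` on both sides, and apply the law for `D.erase e`
    intro F hF hFd
    have hsub : (D : Set Word) ⊆ {f | f = e ∨ Word.lt f e} := hDe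
    have hstep1 := lintegral_divider_step hp hp_param hW' he hI hF
      (fun x y h => hFd fun i hi => h i (hsub hi))
    have hleft : ∫⁻ g, F (divider p W g) ∂(Measure.infinitePi fun _ : ℕ => ν) =
        ∫⁻ g, {g | Proceeds p W g e}.indicator (fun g => F (divider p W g)) g
          ∂(Measure.infinitePi fun _ : ℕ => ν) := by
      refine lintegral_congr_ae ?_
      filter_upwards [hstep] with g hg
      rw [indicator_of_mem (by exact hg)]
    have hDer : PrefixClosed (D.erase e) := hD.erase hDe
    have hF'm : Measurable fun h : Word → Hyperplane ℓ =>
        ∫⁻ y, hitDensity ν (cell p W h e) y * F (Function.update h e y) ∂ν := by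
      refine Measurable.lintegral_prod_right' (f := fun r : (Word → Hyperplane ℓ) × Hyperplane ℓ =>
        hitDensity ν (cell p W r.1 e) r.2 * F (Function.update r.1 e r.2)) ?_
      exact (measurable_hitDensity_cell hp hp_param hW' measurable_fst measurable_snd e).mul
        (hF.comp (measurable_update_prod e))
    have hlaw := hlt _ hDer (fun f hf => (hDe f (Finset.mem_of_mem_erase hf)).resolve_left
      (Finset.ne_of_mem_erase hf)) _ hF'm (fun h h' hh => by
        have hc : cell p W h e = cell p W h' e := cell_congr_suffix p W e fun f hf hfe =>
          hh f (Finset.mem_coe.2 (Finset.mem_erase.2 ⟨hfe, hD.mem_of_suffix heD hf⟩))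
        simp only [hc]
        refine lintegral_congr fun y => ?_
        congr 1
        refine hFd fun i hi => ?_
        by_cases hie : i = e
        · subst hie; simp
        · rw [Function.update_of_ne hie, Function.update_of_ne hie]
          exact hh i (Finset.mem_coe.2 (Finset.mem_erase.2 ⟨hie, hi⟩)))
    have hpeel := lintegral_dividerDensity_insert hp hp_param hW' (ν := ν)
      (Finset.notMem_erase e D) (fun f hf => Word.not_suffix_of_lt
        ((hDe f (Finset.mem_of_mem_erase hf)).resolve_left (Finset.ne_of_mem_erase hf))) hF
    rw [Finset.insert_erase heD] at hpeel
    rw [hleft, hstep1, hpeel, ← hlaw]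
    rfl

theorem hasDividerLaw (hΛ : IsHyperplaneMeasure Λ) (hp : Measurable p)
    (hp_param : ∀ k, ofParam (p k) = k) (hW : IsCell W) {D : Finset Word} (hD : PrefixClosed D) :
    HasDividerLaw (normalized Λ W) p W D := by
  rcases D.eq_empty_or_nonempty with rfl | hne
  · exact (ae_proceeds_and_hasDividerLaw hΛ hp hp_param hW []).2 ∅ hD (by simp)
  · obtain ⟨m, -, hmax⟩ := Word.exists_max D hne
    exact (ae_proceeds_and_hasDividerLaw hΛ hp hp_param hW m).2 D hD hmax

theorem ae_cuts_divider (hΛ : IsHyperplaneMeasure Λ) (hp : Measurable p)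
    (hp_param : ∀ k, ofParam (p k) = k) (hW : IsCell W) :
    ∀ᵐ g ∂(Measure.infinitePi fun _ : ℕ => normalized Λ W),
      ∀ e, Cuts (p (divider p W g e)) (stitCell p W g e) := by
  have := isProbabilityMeasure_normalized hΛ hW
  rw [ae_all_iff]
  intro e
  filter_upwards [(hasDividerLaw hΛ hp hp_param hW (prefixClosed_ancestors e)).ae_properOn hΛ hp
    hp_param hW normalized_absolutelyContinuous (prefixClosed_ancestors e)] with g hg
  exact hg e (mem_ancestors.2 List.suffix_rfl)

end Law

end STIT

namespace STIT

variable {ℓ : ℕ}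

/-! ### Growth sequences and orders of division -/

/-- The first `k` terms of `σ` are an admissible order of division: they are distinct, and each is
the empty word or a successor of an earlier one. -/
structure IsDivisionOrder (σ : ℕ → Word) (k : ℕ) : Prop where
  inj : ∀ i < k, ∀ j < k, σ i = σ j → i = j
  pred : ∀ l < k, σ l = [] ∨ ∃ i < l, ∃ b, σ l = b :: σ i

/-- The leaves of the tree after `s` divisions. -/
def leafWords (σ : ℕ → Word) : ℕ → Finset Word
  | 0 => {[]}
  | s + 1 => insert (false :: σ s) (insert (true :: σ s) ((leafWords σ s).erase (σ s)))

namespace IsDivisionOrder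

variable {σ : ℕ → Word} {k : ℕ}

theorem mem_leafWords (hσ : IsDivisionOrder σ k) {s : ℕ} (hs : s ≤ k) {r : Word} :
    r ∈ leafWords σ s ↔ (r = [] ∨ ∃ i < s, ∃ b, r = b :: σ i) ∧ ∀ i < s, r ≠ σ i := by
  induction s with
  | zero => simp [leafWords]
  | succ s ih =>
    have hb : ∀ b, ∀ i < s + 1, b :: σ s ≠ σ i := by
      intro b i hi h
      rcases hσ.pred i (by omega) with h' | ⟨j, hj, b', h'⟩
      · rw [h'] at h; simp at h
      · rw [h'] at h
        have := hσ.inj s (by omega) j (by omega) (List.cons.inj h).2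
        omega
    have hx : r ∈ leafWords σ (s + 1) ↔ (∃ b, r = b :: σ s) ∨ (r ≠ σ s ∧ r ∈ leafWords σ s) := by
      simp [leafWords, or_assoc]
    rw [hx, ih (by omega)]
    constructor
    · rintro (⟨b, rfl⟩ | ⟨h1, h2, h3⟩)
      · exact ⟨Or.inr ⟨s, by omega, b, rfl⟩, hb b⟩
      · refine ⟨h2.imp id fun ⟨i, hi, hb⟩ => ⟨i, by omega, hb⟩, fun i hi => ?_⟩
        rcases Nat.lt_succ_iff_lt_or_eq.1 hi with h | rfl
        · exact h3 i h
        · exact h1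
    · rintro ⟨h1, h2⟩
      by_cases h : ∃ b, r = b :: σ s
      · exact Or.inl h
      · refine Or.inr ⟨h2 s (by omega), ?_, fun i hi => h2 i (by omega)⟩
        refine h1.imp id fun ⟨i, hi, b, hr⟩ => ⟨i, ?_, b, hr⟩
        rcases Nat.lt_succ_iff_lt_or_eq.1 hi with h' | rfl
        · exact h'
        · exact absurd ⟨b, hr⟩ h

theorem mem_leafWords_self (hσ : IsDivisionOrder σ k) {s : ℕ} (hs : s < k) :
    σ s ∈ leafWords σ s :=
  (hσ.mem_leafWords hs.le).2 ⟨hσ.pred s hs, fun i hi h => by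
    have := hσ.inj s hs i (by omega) h
    omega⟩

theorem cons_notMem_leafWords (hσ : IsDivisionOrder σ k) {s : ℕ} (hs : s < k) (b : Bool) :
    b :: σ s ∉ leafWords σ s := by
  rw [hσ.mem_leafWords hs.le]
  rintro ⟨h | ⟨i, hi, b', h⟩, -⟩
  · simp at h
  · have := hσ.inj s hs i (by omega) (List.cons.inj h).2
    omega

/-- Replacing the divided leaf by its two successors. -/
theorem sum_leafWords_succ (hσ : IsDivisionOrder σ k) {s : ℕ} (hs : s < k) (f : Word → ℝ) :
    ∑ r ∈ leafWords σ (s + 1), f r =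
      ∑ r ∈ leafWords σ s, f r - f (σ s) + f (false :: σ s) + f (true :: σ s) := by
  have h1 : true :: σ s ∉ (leafWords σ s).erase (σ s) := fun h =>
    hσ.cons_notMem_leafWords hs true (Finset.mem_of_mem_erase h)
  have h2 : false :: σ s ∉ insert (true :: σ s) ((leafWords σ s).erase (σ s)) := fun h => by
    rcases Finset.mem_insert.1 h with h | h
    · simp at h
    · exact hσ.cons_notMem_leafWords hs false (Finset.mem_of_mem_erase h)
  rw [leafWords, Finset.sum_insert h2, Finset.sum_insert h1,
    ← Finset.add_sum_erase _ f (hσ.mem_leafWords_self hs)]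
  ring

theorem mem_of_suffix (hσ : IsDivisionOrder σ k) {l : ℕ} (hl : l < k) {f : Word}
    (hf : f <:+ σ l) : ∃ i ≤ l, f = σ i := by
  induction l using Nat.strong_induction_on with
  | _ l ih =>
    rcases hσ.pred l hl with h | ⟨i, hi, b, h⟩
    · rw [h, List.suffix_nil] at hf
      exact ⟨l, le_rfl, hf.trans h.symm⟩
    · rw [h, List.suffix_cons_iff] at hf
      rcases hf with hf | hf
      · exact ⟨l, le_rfl, hf.trans h.symm⟩
      · obtain ⟨j, hj, hfj⟩ := ih i hi (by omega) hf
        exact ⟨j, by omega, hfj⟩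

/-- The proper predecessors of a word in the tree are divided words. -/
theorem mem_of_suffix_tree (hσ : IsDivisionOrder σ k) {s : ℕ} (hs : s ≤ k) {r f : Word}
    (hr : r = [] ∨ ∃ i < s, ∃ b, r = b :: σ i) (hf : f <:+ r) (hne : f ≠ r) :
    ∃ i < s, f = σ i := by
  rcases hr with rfl | ⟨i, hi, b, rfl⟩
  · exact absurd (List.suffix_nil.1 hf) hne
  · rcases List.suffix_cons_iff.1 hf with h | h
    · exact absurd h hne
    · obtain ⟨j, hj, hfj⟩ := hσ.mem_of_suffix (by omega) h
      exact ⟨j, by omega, hfj⟩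

theorem not_suffix (hσ : IsDivisionOrder σ k) {i s : ℕ} (hi : i < s) (hs : s < k) :
    ¬ σ s <:+ σ i := fun h => by
  obtain ⟨j, hj, h⟩ := hσ.mem_of_suffix (by omega) h
  have := hσ.inj s hs j (by omega) h
  omega

theorem mono (hσ : IsDivisionOrder σ k) {s : ℕ} (hs : s ≤ k) : IsDivisionOrder σ s :=
  ⟨fun i hi j hj => hσ.inj i (by omega) j (by omega), fun l hl => hσ.pred l (by omega)⟩

theorem prefixClosed (hσ : IsDivisionOrder σ k) : PrefixClosed ((Finset.range k).image σ) := by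
  intro b e he
  simp only [Finset.mem_image, Finset.mem_range] at he ⊢
  obtain ⟨i, hi, h⟩ := he
  obtain ⟨j, hj, hj'⟩ := hσ.mem_of_suffix hi (f := e) (by rw [h]; exact List.suffix_cons b e)
  exact ⟨j, by omega, hj'.symm⟩

end IsDivisionOrder

theorem Word.lt_false_true (e : Word) : Word.lt (false :: e) (true :: e) := by
  unfold Word.lt
  rw [List.reverse_cons, List.reverse_cons]
  refine List.Shortlex.append_left ?_ e.reverse
  rw [List.shortlex_singleton_iff]
  decide

section Growth

variable {k : ℕ} {R : Fin (2 * k + 1) → Word}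

theorem IsGrowth.exists_eq (hR : IsGrowth R) (l : Fin k) :
    R ⟨2 * l + 1, by omega⟩ = false :: splitWord R l ∧
      R ⟨2 * l + 2, by omega⟩ = true :: splitWord R l ∧
      ∃ j : Fin (2 * k + 1), (j : ℕ) ≤ 2 * l ∧ splitWord R l = R j := by
  obtain ⟨j, hj, hset, hlt⟩ := hR.grow l
  have hl : 2 * (l : ℕ) + 1 < 2 * k + 1 := by omega
  have h1 : R ⟨2 * l + 1, by omega⟩ ∈ Word.succ (R j) := hset ▸ mem_insert _ _
  have h2 : R ⟨2 * l + 2, by omega⟩ ∈ Word.succ (R j) := hset ▸ mem_insert_of_mem _ rfl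
  simp only [Word.succ, mem_insert_iff, mem_singleton_iff] at h1 h2
  have hsplit : splitWord R l = Word.pred (R ⟨2 * l + 1, by omega⟩) := by
    rw [splitWord, dif_pos hl]
  have hpred : splitWord R l = R j := by
    rw [hsplit]
    rcases h1 with h1 | h1 <;> rw [h1] <;> rfl
  rw [hpred]
  rcases h1 with h1 | h1 <;> rcases h2 with h2 | h2
  · rw [h1, h2] at hlt
    exact absurd hlt (Word.lt_irrefl _)
  · exact ⟨h1, h2, j, hj, rfl⟩
  · rw [h1, h2] at hlt
    exact absurd (Word.lt_trans hlt (Word.lt_false_true _)) (Word.lt_irrefl _)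
  · rw [h1, h2] at hlt
    exact absurd hlt (Word.lt_irrefl _)

theorem IsGrowth.eq_nil_or (hR : IsGrowth R) (j : Fin (2 * k + 1)) :
    (j = 0 ∧ R j = []) ∨ ∃ i : ℕ, i < k ∧ (2 * i + 1 ≤ j ∧ j ≤ 2 * i + 2) ∧
      R j = (decide ((j : ℕ) = 2 * i + 2)) :: splitWord R i := by
  rcases Nat.eq_zero_or_pos (j : ℕ) with h0 | h0
  · left
    obtain rfl : j = 0 := Fin.ext h0
    exact ⟨rfl, hR.root⟩
  · right
    obtain ⟨i, hi⟩ : ∃ i, (j : ℕ) = 2 * i + 1 ∨ (j : ℕ) = 2 * i + 2 :=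
      ⟨(j - 1) / 2, by omega⟩
    have hik : i < k := by omega
    have := hR.exists_eq ⟨i, hik⟩
    refine ⟨i, hik, by omega, ?_⟩
    rcases hi with hi | hi
    · have hj : j = ⟨2 * i + 1, by omega⟩ := Fin.ext hi
      rw [hj, this.1]
      simp
    · have hj : j = ⟨2 * i + 2, by omega⟩ := Fin.ext hi
      rw [hj, this.2.1]
      simp

theorem IsGrowth.isDivisionOrder (hR : IsGrowth R) : IsDivisionOrder (splitWord R) k where
  inj i hi j hj h := by
    have h1 := (hR.exists_eq ⟨i, hi⟩).1
    have h2 := (hR.exists_eq ⟨j, hj⟩).1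
    simp only at h1 h2
    rw [h, ← h2] at h1
    have := congrArg Fin.val (hR.injective h1)
    simp only at this
    omega
  pred l hl := by
    obtain ⟨-, -, j, hj, h⟩ := hR.exists_eq ⟨l, hl⟩
    simp only at hj h
    rcases hR.eq_nil_or j with ⟨-, h0⟩ | ⟨i, hi, hij, h'⟩
    · exact Or.inl (h.trans h0)
    · exact Or.inr ⟨i, by omega, _, h.trans h'⟩

theorem IsGrowth.mem_range_initial (hR : IsGrowth R) {s : ℕ} (hs : s ≤ k) (r : Word) :
    r ∈ range (initial R s hs) ↔ r = [] ∨ ∃ i < s, ∃ b, r = b :: splitWord R i := by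
  simp only [mem_range, initial]
  constructor
  · rintro ⟨j, rfl⟩
    rcases hR.eq_nil_or ⟨j, by omega⟩ with ⟨-, h0⟩ | ⟨i, hi, hij, h'⟩
    · exact Or.inl h0
    · simp only at hij
      exact Or.inr ⟨i, by omega, _, h'⟩
  · rintro (rfl | ⟨i, hi, b, rfl⟩)
    · exact ⟨0, hR.root⟩
    · have := hR.exists_eq ⟨i, by omega⟩
      cases b
      · exact ⟨⟨2 * i + 1, by omega⟩, this.1⟩
      · exact ⟨⟨2 * i + 2, by omega⟩, this.2.1⟩

theorem IsGrowth.leaves_initial (hR : IsGrowth R) {s : ℕ} (hs : s ≤ k) :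
    leaves (initial R s hs) = leafWords (splitWord R) s := by
  ext r
  rw [Finset.mem_coe, hR.isDivisionOrder.mem_leafWords hs, leaves]
  change r ∈ range (initial R s hs) ∧ _ ↔ _
  rw [hR.mem_range_initial hs]
  refine and_congr_right fun _ => ?_
  rw [eq_empty_iff_forall_notMem]
  constructor
  · intro h i hi hri
    refine h (false :: r) ⟨by simp [Word.succ], (hR.mem_range_initial hs _).2 ?_⟩
    exact Or.inr ⟨i, hi, false, by rw [hri]⟩
  · rintro h f ⟨hf, hf'⟩
    rw [hR.mem_range_initial hs] at hf'
    have hfr : ∃ b, f = b :: r := by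
      simp only [Word.succ, mem_insert_iff, mem_singleton_iff] at hf
      rcases hf with hf | hf
      · exact ⟨_, hf⟩
      · exact ⟨_, hf⟩
    obtain ⟨b, rfl⟩ := hfr
    rcases hf' with hf' | ⟨i, hi, b', hf'⟩
    · simp at hf'
    · exact h i hi (List.cons.inj hf').2

/-- Growth sequences are determined by their orders of division. -/
theorem IsGrowth.ext_splitWord {R' : Fin (2 * k + 1) → Word} (hR : IsGrowth R) (hR' : IsGrowth R')
    (h : ∀ i < k, splitWord R i = splitWord R' i) : R = R' := by
  funext j
  rcases hR.eq_nil_or j with ⟨h0, h1⟩ | ⟨i, hi, hij, h1⟩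
  · rw [h1, h0, hR'.root]
  · rcases hR'.eq_nil_or j with ⟨h0', h1'⟩ | ⟨i', hi', hij', h1'⟩
    · have : (j : ℕ) = 0 := by rw [h0']; rfl
      omega
    · obtain rfl : i = i' := by omega
      rw [h1, h1', h i hi]

/-- Every order of division comes from a growth sequence: the two successors of `σ i` are the entries
number `2 * i + 1` and `2 * i + 2`. -/
theorem IsDivisionOrder.exists_growth {σ : ℕ → Word} (hσ : IsDivisionOrder σ k) :
    ∃ R : Fin (2 * k + 1) → Word, IsGrowth R ∧ ∀ i < k, splitWord R i = σ i := by
  let R : Fin (2 * k + 1) → Word := fun j =>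
    if (j : ℕ) = 0 then [] else decide ((j : ℕ) % 2 = 0) :: σ (((j : ℕ) - 1) / 2)
  have hR1 : ∀ (i : ℕ) (hi : 2 * i + 1 < 2 * k + 1), R ⟨2 * i + 1, hi⟩ = false :: σ i := by
    intro i hi
    simp only [R]
    rw [if_neg (by omega), show (2 * i + 1 - 1) / 2 = i by omega]
    simp
  have hR2 : ∀ (i : ℕ) (hi : 2 * i + 2 < 2 * k + 1), R ⟨2 * i + 2, hi⟩ = true :: σ i := by
    intro i hi
    simp only [R]
    rw [if_neg (by omega), show (2 * i + 2 - 1) / 2 = i by omega]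
    simp
  have hmem : ∀ l < k, ∃ j : Fin (2 * k + 1), (j : ℕ) ≤ 2 * l ∧ R j = σ l := by
    intro l hl
    rcases hσ.pred l hl with h | ⟨i, hi, b, h⟩
    · exact ⟨0, by simp, by simp [R, h]⟩
    · cases b
      · exact ⟨⟨2 * i + 1, by omega⟩, by simp; omega, by rw [hR1, h]⟩
      · exact ⟨⟨2 * i + 2, by omega⟩, by simp; omega, by rw [hR2, h]⟩
  refine ⟨R, ⟨by simp [R], ?_, fun l => ?_⟩, fun i hi => ?_⟩
  · intro j j' h
    simp only [R] at h
    split_ifs at h with h1 h2 h2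
    · exact Fin.ext (h1.trans h2.symm)
    · obtain ⟨e1, e2⟩ := List.cons.inj h
      have := hσ.inj _ (by omega) _ (by omega) e2
      have e3 : (j : ℕ) % 2 = 0 ↔ (j' : ℕ) % 2 = 0 := by simpa using e1
      exact Fin.ext (by omega)
  · obtain ⟨j, hj, hjl⟩ := hmem l l.2
    refine ⟨j, hj, ?_, ?_⟩
    · rw [hR1, hR2, hjl, Word.succ]
    · rw [hR1, hR2]
      exact Word.lt_false_true _
  · rw [splitWord, dif_pos (by omega), hR1]
    rfl

end Growth

/-! ### Integration along a growth sequence -/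

/-- The assignment of `x i` to the word `σ i`, for `i < s`, and of `x₀` to all other words. -/
def extend {X : Type*} (σ : ℕ → Word) (x₀ : X) : (s : ℕ) → (Fin s → X) → Word → X
  | 0, _ => fun _ => x₀
  | s + 1, x => Function.update (extend σ x₀ s (Fin.init (α := fun _ => X) x)) (σ s)
      (x (Fin.last s))

theorem extend_snoc {X : Type*} (σ : ℕ → Word) (x₀ : X) (s : ℕ) (x : Fin s → X) (y : X) :
    extend σ x₀ (s + 1) (Fin.snoc (α := fun _ => X) x y) =
      Function.update (extend σ x₀ s x) (σ s) y := by
  simp [extend]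

theorem extend_apply {X : Type*} {σ : ℕ → Word} {k : ℕ} (hσ : IsDivisionOrder σ k) (x₀ : X)
    {s : ℕ} (hs : s ≤ k) (x : Fin s → X) (i : Fin s) : extend σ x₀ s x (σ i) = x i := by
  induction s with
  | zero => exact i.elim0
  | succ s ih =>
    rw [extend]
    rcases Fin.eq_castSucc_or_eq_last i with ⟨j, rfl⟩ | rfl
    · rw [Function.update_of_ne]
      · exact ih (by omega) _ j
      · intro h
        have := hσ.inj _ (by simp; omega) s (by omega) h
        simp at this
        omega
    · simp

section PlaneIntegral

variable {p : Hyperplane ℓ → Param ℓ} {W : Set (Space ℓ)} {k : ℕ} {R : Fin (2 * k + 1) → Word}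

/-- The cells along a growth sequence are the cells of the corresponding assignment of dividing
hyperplanes to words. -/
theorem growthCell_eq_cell {n : ℕ} {H : Fin n → Hyperplane ℓ}
    {h : Word → Hyperplane ℓ} (hH : ∀ i : Fin n, h (splitWord R i) = H i) {r : Word}
    (hr : ∀ f, f <:+ r → f ≠ r → ∃ i < n, f = splitWord R i) :
    growthCell p W R H r = cell p W h r := by
  induction r with
  | nil => rfl
  | cons b e ih =>
    have hne : ∀ f : Word, f <:+ e → f ≠ b :: e := by
      rintro f hf rfl
      have := hf.length_le
      simp at this
    have hs := fun f (hf : f <:+ e) => hr f (hf.trans (List.suffix_cons b e)) (hne f hf)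
    rw [growthCell, cell, ih fun f hf _ => hs f hf]
    congr 1
    obtain ⟨i, hi, hei⟩ := hs e List.suffix_rfl
    ext x
    simp only [mem_ofPred_eq]
    constructor
    · intro hx
      have := hx ⟨i, hi⟩ hei.symm
      rwa [← hH, ← hei] at this
    · intro hx j hj
      rwa [← hH, hj]

/-- The iterated integral over the dividing hyperplanes, taken in the order of division, is an
integral with respect to the density of the joint law of the dividers, which does not refer to
that order. -/
theorem iterLintegral_normalized_eq {Λ : Measure (Hyperplane ℓ)} (hΛ : IsHyperplaneMeasure Λ)
    (hp : Measurable p) (hp_param : ∀ k, ofParam (p k) = k) (hW : IsCell W) (hR : IsGrowth R)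
    (x₀ : Hyperplane ℓ) {s : ℕ} (hs : s ≤ k) {F : (Word → Hyperplane ℓ) → ℝ≥0∞}
    (hF : Measurable F) (hFd : DependsOn F ((Finset.range s).image (splitWord R))) :
    iterLintegral (fun s H => normalized Λ (growthCell p W R H (splitWord R s))) s
        (fun x => F (extend (splitWord R) x₀ s x)) =
      ∫⁻ h, F h * dividerDensity (normalized Λ W) p W ((Finset.range s).image (splitWord R)) h
        ∂(Measure.infinitePi fun _ : Word => normalized Λ W) := by
  classical
  have := isProbabilityMeasure_normalized hΛ hW
  have hσ := hR.isDivisionOrder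
  induction s generalizing F with
  | zero =>
    have hconst : ∀ h, F h = F fun _ => x₀ := fun h => hFd fun _ hi => by simp at hi
    simp only [iterLintegral, extend, hconst, dividerDensity, Finset.range_zero,
      Finset.image_empty, Finset.prod_empty, mul_one, lintegral_const, measure_univ]
  | succ s ih =>
    set σ := splitWord R with hσdef
    set ν := normalized Λ W with hν
    -- the result of the innermost integration, as a function of the earlier hyperplanes
    let F' : (Word → Hyperplane ℓ) → ℝ≥0∞ := fun h =>
      ∫⁻ y, hitDensity ν (cell p W h (σ s)) y * F (Function.update h (σ s) y) ∂ν
    have hF'm : Measurable F' := by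
      refine Measurable.lintegral_prod_right' (f := fun r : (Word → Hyperplane ℓ) × Hyperplane ℓ =>
        hitDensity ν (cell p W r.1 (σ s)) r.2 * F (Function.update r.1 (σ s) r.2)) ?_
      exact (measurable_hitDensity_cell hp hp_param hW.isCompact measurable_fst measurable_snd
        (σ s)).mul (hF.comp (measurable_update_prod (σ s)))
    have hsuf : ∀ f, f <:+ σ s → f ≠ σ s → ∃ i < s, f = σ i := fun f hf hne => by
      obtain ⟨i, hi, hfi⟩ := hσ.mem_of_suffix (by omega) hf
      refine ⟨i, lt_of_le_of_ne hi ?_, hfi⟩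
      rintro rfl
      exact hne hfi
    have hnotin : σ s ∉ (Finset.range s).image σ := by
      simp only [Finset.mem_image, Finset.mem_range, not_exists, not_and]
      intro i hi h
      have := hσ.inj i (by omega) s (by omega) h
      omega
    have hins : (Finset.range (s + 1)).image σ = insert (σ s) ((Finset.range s).image σ) := by
      rw [Finset.range_add_one, Finset.image_insert]
    have hF'd : DependsOn F' ((Finset.range s).image σ) := by
      intro h h' hh
      have hc : cell p W h (σ s) = cell p W h' (σ s) := cell_congr_suffix p W _ fun f hf hfe => by
        obtain ⟨i, hi, rfl⟩ := hsuf f hf hfe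
        exact hh _ (by simp only [Finset.coe_image, mem_image]; exact ⟨i, by simpa using hi, rfl⟩)
      simp only [F', hc]
      refine lintegral_congr fun y => ?_
      congr 1
      refine hFd fun f hf => ?_
      by_cases hfe : f = σ s
      · subst hfe; simp
      · rw [Function.update_of_ne hfe, Function.update_of_ne hfe]
        rw [hins, Finset.coe_insert] at hf
        exact hh f (hf.resolve_left hfe)
    have hinner : ∀ x : Fin s → Hyperplane ℓ,
        ∫⁻ y, F (extend σ x₀ (s + 1) (Fin.snoc (α := fun _ => Hyperplane ℓ) x y))
          ∂(normalized Λ (growthCell p W R x (σ s))) = F' (extend σ x₀ s x) := by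
      intro x
      have hc : growthCell p W R x (σ s) = cell p W (extend σ x₀ s x) (σ s) :=
        growthCell_eq_cell (fun i : Fin s => extend_apply hσ x₀ (by omega) x i) hsuf
      simp_rw [extend_snoc]
      rw [hc]
      exact lintegral_normalized hΛ hW (cell_subset p W _ _)
        (isCompact_cell p hW.isCompact _ _) (hF.comp (measurable_update _))
    simp only [iterLintegral]
    simp_rw [hinner]
    rw [ih (by omega) hF'm hF'd, hins]
    refine (lintegral_dividerDensity_insert hp hp_param hW.isCompact hnotin (fun f hf => ?_) hF).symm
    simp only [Finset.mem_image, Finset.mem_range] at hf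
    obtain ⟨i, hi, rfl⟩ := hf
    exact hσ.not_suffix hi (by omega)

end PlaneIntegral

end STIT

namespace STIT

/-! ### Exponential lifetimes along a tree -/

instance : IsProbabilityMeasure (expMeasure 1) := isProbabilityMeasure_expMeasure one_pos

theorem lintegral_expMeasure {f : ℝ → ℝ≥0∞} (hf : Measurable f) :
    ∫⁻ y, f y ∂(expMeasure 1) = ∫⁻ y in Ici 0, ENNReal.ofReal (Real.exp (-y)) * f y := by
  have h1 : expMeasure 1 = volume.withDensity (exponentialPDF 1) := rfl
  have hm : Measurable (exponentialPDF 1) := (measurable_exponentialPDFReal 1).ennreal_ofReal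
  rw [h1, lintegral_withDensity_eq_lintegral_mul _ hm hf, ← lintegral_indicator measurableSet_Ici]
  refine lintegral_congr fun y => ?_
  by_cases hy : 0 ≤ y
  · rw [indicator_of_mem (by exact hy), Pi.mul_apply, exponentialPDF_of_nonneg hy]
    simp
  · rw [indicator_of_notMem (by exact hy), Pi.mul_apply, exponentialPDF_of_neg (not_le.1 hy),
      zero_mul]

theorem expMeasure_Ioi {x : ℝ} (hx : 0 ≤ x) :
    expMeasure 1 (Ioi x) = ENNReal.ofReal (Real.exp (-x)) := by
  rw [← lintegral_indicator_one measurableSet_Ioi,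
    lintegral_expMeasure (measurable_one.indicator measurableSet_Ioi)]
  have h : ∀ y, ENNReal.ofReal (Real.exp (-y)) * (Ioi x).indicator 1 y =
      (Ioi x).indicator (fun y => ENNReal.ofReal (Real.exp (-y))) y := fun y => by
    by_cases hy : y ∈ Ioi x <;> simp [hy]
  simp_rw [h]
  rw [lintegral_indicator measurableSet_Ioi, Measure.restrict_restrict measurableSet_Ioi,
    inter_eq_left.2 (Ioi_subset_Ici hx),
    ← ofReal_integral_eq_lintegral_ofReal (integrableOn_exp_neg_Ioi x)
      (Filter.Eventually.of_forall fun _ => (Real.exp_pos _).le), integral_exp_neg_Ioi]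

/-- A lifetime with rate `r` that starts at time `b`, seen from a later time `a`: lack of memory,
together with the change of variables from the standard exponential variable to the time `w`
elapsed since `a`. -/
theorem lintegral_expMeasure_shift {r : ℝ} (hr : 0 < r) {a b : ℝ} (hba : b ≤ a) (t : ℝ)
    {f : ℝ → ℝ≥0∞} (hf : Measurable f) :
    ∫⁻ y, {y | a < b + r⁻¹ * y ∧ b + r⁻¹ * y ≤ t}.indicator (fun y => f (b + r⁻¹ * y)) y
        ∂(expMeasure 1) =
      ∫⁻ w in Icc 0 (t - a), ENNReal.ofReal (r * Real.exp (-(r * (a + w - b)))) * f (a + w) := by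
  have hms : MeasurableSet {y : ℝ | a < b + r⁻¹ * y ∧ b + r⁻¹ * y ≤ t} := by
    refine MeasurableSet.inter (s₁ := {y | a < b + r⁻¹ * y}) (s₂ := {y | b + r⁻¹ * y ≤ t}) ?_ ?_
    · exact measurableSet_lt (by fun_prop) (by fun_prop)
    · exact measurableSet_le (by fun_prop) (by fun_prop)
  have hm1 : Measurable ({y | a < b + r⁻¹ * y ∧ b + r⁻¹ * y ≤ t}.indicator
      (fun y => f (b + r⁻¹ * y))) :=
    (hf.comp (by fun_prop : Measurable fun y : ℝ => b + r⁻¹ * y)).indicator hms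
  let g : ℝ → ℝ≥0∞ := (Ici 0).indicator fun y => ENNReal.ofReal (Real.exp (-y)) *
    {y | a < b + r⁻¹ * y ∧ b + r⁻¹ * y ≤ t}.indicator (fun y => f (b + r⁻¹ * y)) y
  have hg : Measurable g := by
    refine Measurable.indicator (Measurable.mul ?_ hm1) measurableSet_Ici
    fun_prop
  rw [lintegral_expMeasure hm1, ← lintegral_indicator measurableSet_Ici]
  change ∫⁻ y, g y = _
  conv_lhs => rw [← Real.smul_map_volume_mul_left hr.ne']
  rw [lintegral_smul_measure, lintegral_map hg (by fun_prop), abs_of_pos hr, smul_eq_mul,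
    ← lintegral_add_right_eq_self _ (a - b), ← restrict_Ioc_eq_restrict_Icc,
    ← lintegral_indicator measurableSet_Ioc, ← lintegral_const_mul _ (by fun_prop)]
  refine lintegral_congr fun w => ?_
  have e1 : b + r⁻¹ * (r * (w + (a - b))) = a + w := by field_simp; ring
  by_cases hw : w ∈ Ioc 0 (t - a)
  · have h0 : 0 ≤ r * (w + (a - b)) := mul_nonneg hr.le (by linarith [hw.1])
    have h1 : r * (w + (a - b)) ∈ {y : ℝ | a < b + r⁻¹ * y ∧ b + r⁻¹ * y ≤ t} := by
      simp only [mem_ofPred_eq, e1]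
      exact ⟨by linarith [hw.1], by linarith [hw.2]⟩
    simp only [g]
    rw [indicator_of_mem hw, indicator_of_mem (mem_Ici.2 h0), indicator_of_mem h1, e1, ← mul_assoc,
      ← ENNReal.ofReal_mul hr.le]
    congr 5
    ring
  · have h1 : r * (w + (a - b)) ∉ {y : ℝ | a < b + r⁻¹ * y ∧ b + r⁻¹ * y ≤ t} := by
      simp only [mem_ofPred_eq, e1]
      rintro ⟨h2, h3⟩
      exact hw ⟨by linarith, by linarith⟩
    simp only [g]
    rw [indicator_of_notMem hw]
    by_cases h0 : r * (w + (a - b)) ∈ Ici 0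
    · rw [indicator_of_mem h0, indicator_of_notMem h1, mul_zero, mul_zero]
    · rw [indicator_of_notMem h0, mul_zero]

/-- The time at which the cell of a word is born, given the times at which cells are divided. -/
def startTime (d : Word → ℝ) : Word → ℝ
  | [] => 0
  | _ :: e => d e

/-- The time at which the cell of a word is divided, given the rates of division and the standard
exponential variables. -/
noncomputable def deathTime (rate : Word → ℝ) (z : Word → ℝ) : Word → ℝ
  | [] => (rate [])⁻¹ * z []
  | b :: e => deathTime rate z e + (rate (b :: e))⁻¹ * z (b :: e)

theorem deathTime_eq (rate z : Word → ℝ) (e : Word) :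
    deathTime rate z e = startTime (deathTime rate z) e + (rate e)⁻¹ * z e := by
  cases e <;> simp [deathTime, startTime]

theorem deathTime_update_of_not_suffix (rate z : Word → ℝ) {e f : Word} (h : ¬ e <:+ f) (y : ℝ) :
    deathTime rate (Function.update z e y) f = deathTime rate z f := by
  induction f with
  | nil =>
    have : [] ≠ e := by rintro rfl; exact h List.suffix_rfl
    simp [deathTime, Function.update_of_ne this]
  | cons b f ih =>
    have h1 : ¬ e <:+ f := fun h' => h (h'.trans (List.suffix_cons b f))
    have h2 : b :: f ≠ e := by rintro rfl; exact h List.suffix_rfl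
    simp [deathTime, Function.update_of_ne h2, ih h1]

theorem startTime_deathTime_update (rate z : Word → ℝ) (e : Word) (y : ℝ) :
    startTime (deathTime rate (Function.update z e y)) e = startTime (deathTime rate z) e := by
  cases e with
  | nil => rfl
  | cons b e =>
    refine deathTime_update_of_not_suffix rate z (fun h => ?_) y
    have := h.length_le
    simp at this

theorem measurable_deathTime {Y : Type*} [MeasurableSpace Y] {rate z : Y → Word → ℝ}
    (hr : Measurable rate) (hz : Measurable z) : Measurable fun y => deathTime (rate y) (z y) := by
  refine measurable_pi_iff.2 fun e => ?_
  have h := fun e => ((measurable_pi_apply e).comp hr).inv.mul ((measurable_pi_apply e).comp hz)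
  induction e with
  | nil => exact h []
  | cons b e ih => exact ih.add (h (b :: e))

theorem measurable_startTime {Y : Type*} [MeasurableSpace Y] {d : Y → Word → ℝ}
    (hd : Measurable d) (e : Word) : Measurable fun y => startTime (d y) e := by
  cases e with
  | nil => exact measurable_const
  | cons b e => exact (measurable_pi_apply e).comp hd

/-- The time of the division that precedes the division number `s`. -/
def prevTime (σ : ℕ → Word) (d : Word → ℝ) : ℕ → ℝ
  | 0 => 0
  | s + 1 => d (σ s)

/-- The divisions of the first `s` words of `σ` take place in this order, at positive times
up to `t`. -/
def InOrder (σ : ℕ → Word) (t : ℝ) (s : ℕ) (d : Word → ℝ) : Prop :=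
  ∀ i < s, prevTime σ d i < d (σ i) ∧ d (σ i) ≤ t

theorem inOrder_succ {σ : ℕ → Word} {t : ℝ} {s : ℕ} {d : Word → ℝ} :
    InOrder σ t (s + 1) d ↔ InOrder σ t s d ∧ prevTime σ d s < d (σ s) ∧ d (σ s) ≤ t := by
  constructor
  · exact fun h => ⟨fun i hi => h i (by omega), h s (by omega)⟩
  · rintro ⟨h1, h2⟩ i hi
    rcases Nat.lt_succ_iff_lt_or_eq.1 hi with h | rfl
    · exact h1 i h
    · exact h2

theorem InOrder.le_prevTime {σ : ℕ → Word} {t : ℝ} {s : ℕ} {d : Word → ℝ} (h : InOrder σ t s d) :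
    0 ≤ prevTime σ d s ∧ ∀ i < s, d (σ i) ≤ prevTime σ d s := by
  induction s with
  | zero => simp [prevTime]
  | succ s ih =>
    obtain ⟨h1, h2⟩ := ih (inOrder_succ.1 h).1
    have h3 := (inOrder_succ.1 h).2.1
    refine ⟨h1.trans h3.le, fun i hi => ?_⟩
    rcases Nat.lt_succ_iff_lt_or_eq.1 hi with h' | rfl
    · exact (h2 i h').trans h3.le
    · exact le_rfl

theorem InOrder.startTime_le {σ : ℕ → Word} {t : ℝ} {s : ℕ} {d : Word → ℝ} (h : InOrder σ t s d)
    {r : Word} (hr : r = [] ∨ ∃ i < s, ∃ b, r = b :: σ i) : startTime d r ≤ prevTime σ d s := by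
  rcases hr with rfl | ⟨i, hi, b, rfl⟩
  · exact h.le_prevTime.1
  · exact h.le_prevTime.2 i hi

theorem measurable_prevTime (σ : ℕ → Word) (s : ℕ) :
    Measurable fun d : Word → ℝ => prevTime σ d s := by
  cases s with
  | zero => exact measurable_const
  | succ s => exact measurable_pi_apply (σ s)

theorem measurableSet_inOrder (σ : ℕ → Word) (t : ℝ) (s : ℕ) :
    MeasurableSet {d | InOrder σ t s d} := by
  have : {d | InOrder σ t s d} =
      ⋂ i ∈ {i | i < s}, {d | prevTime σ d i < d (σ i) ∧ d (σ i) ≤ t} := by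
    ext d; simp [InOrder]
  rw [this]
  refine MeasurableSet.biInter (to_countable _) fun i _ => MeasurableSet.inter ?_ ?_
  · exact measurableSet_lt (measurable_prevTime σ i) (measurable_pi_apply (σ i))
  · exact measurableSet_le (measurable_pi_apply (σ i)) measurable_const

/-- The times of division, as functions of the waiting times `w` between them. -/
noncomputable def timesOfWaits (σ : ℕ → Word) : (s : ℕ) → (Fin s → ℝ) → Word → ℝ
  | 0, _ => fun _ => 0
  | s + 1, w => Function.update (timesOfWaits σ s (Fin.init (α := fun _ => ℝ) w)) (σ s) (∑ i, w i)

theorem timesOfWaits_snoc (σ : ℕ → Word) (s : ℕ) (w : Fin s → ℝ) (y : ℝ) :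
    timesOfWaits σ (s + 1) (Fin.snoc (α := fun _ => ℝ) w y) =
      Function.update (timesOfWaits σ s w) (σ s) (∑ i, w i + y) := by
  simp [timesOfWaits, Fin.sum_univ_castSucc]

theorem prevTime_timesOfWaits (σ : ℕ → Word) (s : ℕ) (w : Fin s → ℝ) :
    prevTime σ (timesOfWaits σ s w) s = ∑ i, w i := by
  cases s with
  | zero => simp [prevTime]
  | succ s => simp [prevTime, timesOfWaits]

/-- The density of the times of the first `s` divisions. -/
noncomputable def timeDensity (σ : ℕ → Word) (rate : Word → ℝ) (s : ℕ) (d : Word → ℝ) : ℝ≥0∞ :=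
  ∏ i ∈ Finset.range s, ENNReal.ofReal
    (rate (σ i) * Real.exp (-(rate (σ i) * (d (σ i) - startTime d (σ i)))))

section DivisionOrder

variable {σ : ℕ → Word} {k : ℕ}

theorem startTime_congr (hσ : IsDivisionOrder σ k) {s : ℕ} (hs : s < k) {d d' : Word → ℝ}
    (h : ∀ i < s, d (σ i) = d' (σ i)) : startTime d (σ s) = startTime d' (σ s) := by
  rcases hσ.pred s hs with h0 | ⟨i, hi, b, h0⟩
  · rw [h0]; rfl
  · rw [h0]; exact h i hi

theorem prevTime_congr {s : ℕ} {d d' : Word → ℝ} (h : ∀ i < s, d (σ i) = d' (σ i)) :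
    prevTime σ d s = prevTime σ d' s := by
  cases s with
  | zero => rfl
  | succ s => exact h s (by omega)

theorem inOrder_congr {t : ℝ} {s : ℕ} {d d' : Word → ℝ} (h : ∀ i < s, d (σ i) = d' (σ i)) :
    InOrder σ t s d ↔ InOrder σ t s d' := by
  refine forall₂_congr fun i hi => ?_
  rw [h i hi, prevTime_congr fun j hj => h j (by omega)]

theorem timeDensity_congr (hσ : IsDivisionOrder σ k) {rate : Word → ℝ} {s : ℕ} (hs : s ≤ k)
    {d d' : Word → ℝ} (h : ∀ i < s, d (σ i) = d' (σ i)) :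
    timeDensity σ rate s d = timeDensity σ rate s d' := by
  refine Finset.prod_congr rfl fun i hi => ?_
  have hi := Finset.mem_range.1 hi
  rw [h i hi, startTime_congr hσ (by omega) fun j hj => h j (by omega)]

/-- The joint law of the division times, in terms of the waiting times between them. -/
theorem lintegral_inOrder_deathTime (hσ : IsDivisionOrder σ k) {rate : Word → ℝ} (t : ℝ) {s : ℕ}
    (hs : s ≤ k) (hrate : ∀ i < s, 0 < rate (σ i)) {F : (Word → ℝ) → ℝ≥0∞} (hF : Measurable F)
    (hFd : ∀ d d', (∀ i < s, d (σ i) = d' (σ i)) → F d = F d') :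
    ∫⁻ z, {d | InOrder σ t s d}.indicator F (deathTime rate z)
        ∂(Measure.infinitePi fun _ : Word => expMeasure 1) =
      timeIntegral t s fun w => timeDensity σ rate s (timesOfWaits σ s w) *
        F (timesOfWaits σ s w) := by
  classical
  induction s generalizing F with
  | zero =>
    have hconst : ∀ d, F d = F fun _ => 0 := fun d => hFd _ _ fun i hi => by omega
    have : {d : Word → ℝ | InOrder σ t 0 d} = univ := by ext; simp [InOrder]
    simp [this, timeIntegral, iterLintegral, timesOfWaits, timeDensity, hconst]
  | succ s ih =>
    have hδm : Measurable fun z => deathTime rate z :=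
      measurable_deathTime measurable_const measurable_id
    have hne : ∀ i < s, σ i ≠ σ s := fun i hi h => by
      have := hσ.inj i (by omega) s (by omega) h
      omega
    have hrs := hrate s (by omega)
    -- the result of integrating out the time of the last division, as the waiting time `w` since the
    -- division before
    let F' : (Word → ℝ) → ℝ≥0∞ := fun d => ∫⁻ w in Icc 0 (t - prevTime σ d s),
      ENNReal.ofReal (rate (σ s) * Real.exp (-(rate (σ s) *
        (prevTime σ d s + w - startTime d (σ s))))) *
      F (Function.update d (σ s) (prevTime σ d s + w))
    have hF'm : Measurable F' := by
      let K : (Word → ℝ) × ℝ → ℝ≥0∞ :=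
        {q : (Word → ℝ) × ℝ | 0 ≤ q.2 ∧ q.2 ≤ t - prevTime σ q.1 s}.indicator
        fun q => ENNReal.ofReal (rate (σ s) * Real.exp (-(rate (σ s) *
          (prevTime σ q.1 s + q.2 - startTime q.1 (σ s))))) *
          F (Function.update q.1 (σ s) (prevTime σ q.1 s + q.2))
      have hpm : Measurable fun q : (Word → ℝ) × ℝ => prevTime σ q.1 s :=
        (measurable_prevTime σ s).comp measurable_fst
      have hst : Measurable fun q : (Word → ℝ) × ℝ => startTime q.1 (σ s) :=
        measurable_startTime measurable_fst (σ s)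
      have hK : Measurable K := by
        refine Measurable.indicator (Measurable.mul ?_ ?_) (MeasurableSet.inter ?_ ?_)
        · fun_prop
        · exact hF.comp ((measurable_update_prod (σ s)).comp
            (measurable_fst.prodMk (hpm.add measurable_snd)))
        · exact measurableSet_le measurable_const measurable_snd
        · exact measurableSet_le measurable_snd (measurable_const.sub hpm)
      have : F' = fun d => ∫⁻ w, K (d, w) := by
        ext d
        simp only [F']
        rw [← lintegral_indicator measurableSet_Icc]
        rfl
      rw [this]
      exact hK.lintegral_prod_right'
    have hF'd : ∀ d d', (∀ i < s, d (σ i) = d' (σ i)) → F' d = F' d' := by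
      intro d d' h
      simp only [F']
      rw [prevTime_congr h, startTime_congr hσ (by omega) h]
      refine lintegral_congr fun w => ?_
      congr 1
      refine hFd _ _ fun i hi => ?_
      rcases Nat.lt_succ_iff_lt_or_eq.1 hi with h' | rfl
      · rw [Function.update_of_ne (hne i h'), Function.update_of_ne (hne i h'), h i h']
      · simp
    have hmeas : Measurable fun z => {d | InOrder σ t (s + 1) d}.indicator F (deathTime rate z) :=
      (hF.indicator (measurableSet_inOrder σ t (s + 1))).comp hδm
    have hstep : ∫⁻ z, {d | InOrder σ t (s + 1) d}.indicator F (deathTime rate z)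
        ∂(Measure.infinitePi fun _ : Word => expMeasure 1) =
        ∫⁻ z, {d | InOrder σ t s d}.indicator F' (deathTime rate z)
          ∂(Measure.infinitePi fun _ : Word => expMeasure 1) := by
      rw [lintegral_resample _ (σ s) hmeas]
      refine lintegral_congr fun z => ?_
      set d := deathTime rate z with hd
      have hupd : ∀ y, ∀ i < s, deathTime rate (Function.update z (σ s) y) (σ i) = d (σ i) :=
        fun y i hi => deathTime_update_of_not_suffix rate z (hσ.not_suffix hi (by omega)) y
      have hself : ∀ y, deathTime rate (Function.update z (σ s) y) (σ s) =
          startTime d (σ s) + (rate (σ s))⁻¹ * y := fun y => by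
        rw [deathTime_eq, startTime_deathTime_update, Function.update_self]
      have hFu : ∀ y, F (deathTime rate (Function.update z (σ s) y)) =
          F (Function.update d (σ s) (startTime d (σ s) + (rate (σ s))⁻¹ * y)) := fun y => by
        refine hFd _ _ fun i hi => ?_
        rcases Nat.lt_succ_iff_lt_or_eq.1 hi with h' | rfl
        · rw [Function.update_of_ne (hne i h'), hupd y i h']
        · rw [hself, Function.update_self]
      by_cases hin : InOrder σ t s d
      · rw [indicator_of_mem (by exact hin)]
        have hle : startTime d (σ s) ≤ prevTime σ d s := hin.startTime_le (hσ.pred s (by omega))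
        have h1 := lintegral_expMeasure_shift hrs hle t
          (f := fun x => F (Function.update d (σ s) x)) (hF.comp (measurable_update d))
        simp only [F']
        rw [← h1]
        refine lintegral_congr fun y => ?_
        have hiff : InOrder σ t (s + 1) (deathTime rate (Function.update z (σ s) y)) ↔
            prevTime σ d s < startTime d (σ s) + (rate (σ s))⁻¹ * y ∧
              startTime d (σ s) + (rate (σ s))⁻¹ * y ≤ t := by
          rw [inOrder_succ, hself, prevTime_congr (hupd y), inOrder_congr (hupd y)]
          simp only [hin, true_and]
        simp only [indicator, mem_ofPred_eq, hiff, hFu]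
      · rw [indicator_of_notMem (by exact hin)]
        refine (lintegral_congr fun y => ?_).trans lintegral_zero
        rw [indicator_of_notMem]
        intro h
        exact hin ((inOrder_congr (hupd y)).1 (inOrder_succ.1 h).1)
    rw [hstep, ih (by omega) (fun i hi => hrate i (by omega)) hF'm hF'd]
    simp only [timeIntegral, iterLintegral]
    congr 1
    funext w
    simp only [F', prevTime_timesOfWaits, timesOfWaits_snoc]
    rw [← lintegral_const_mul]
    · refine lintegral_congr fun y => ?_
      have h1 : ∀ i < s, Function.update (timesOfWaits σ s w) (σ s) (∑ i, w i + y) (σ i) =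
          timesOfWaits σ s w (σ i) := fun i hi => Function.update_of_ne (hne i hi) _ _
      have h2 : timeDensity σ rate (s + 1)
          (Function.update (timesOfWaits σ s w) (σ s) (∑ i, w i + y)) =
          timeDensity σ rate s (timesOfWaits σ s w) * ENNReal.ofReal (rate (σ s) *
            Real.exp (-(rate (σ s) * (∑ i, w i + y - startTime (timesOfWaits σ s w) (σ s))))) := by
        rw [timeDensity, Finset.prod_range_succ]
        congr 1
        · exact timeDensity_congr hσ (by omega) h1
        · rw [Function.update_self, startTime_congr hσ (by omega) h1]
      rw [h2, mul_assoc]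
    · refine Measurable.mul (by fun_prop) (hF.comp ((measurable_update _).comp ?_))
      fun_prop

/-- Integrating out the lifetimes of words none of which is a predecessor of another. -/
theorem lintegral_prod_leaves {rate : Word → ℝ} (t : ℝ) (L : Finset Word)
    (hrate : ∀ r ∈ L, 0 < rate r) (hL : ∀ r ∈ L, ∀ r' ∈ L, r <:+ r' → r = r')
    {A : (Word → ℝ) → ℝ≥0∞} (hA : Measurable A)
    (hAd : ∀ r ∈ L, ∀ z y, A (Function.update z r y) = A z)
    (hstart : ∀ r ∈ L, ∀ z, A z ≠ 0 → startTime (deathTime rate z) r ≤ t) :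
    ∫⁻ z, A z * ∏ r ∈ L, {z | t < deathTime rate z r}.indicator 1 z
        ∂(Measure.infinitePi fun _ : Word => expMeasure 1) =
      ∫⁻ z, A z * ∏ r ∈ L, ENNReal.ofReal
          (Real.exp (-(rate r * (t - startTime (deathTime rate z) r))))
        ∂(Measure.infinitePi fun _ : Word => expMeasure 1) := by
  classical
  have hδm : Measurable fun z => deathTime rate z :=
    measurable_deathTime measurable_const measurable_id
  have hind : ∀ r, Measurable fun z =>
      {z | t < deathTime rate z r}.indicator (1 : (Word → ℝ) → ℝ≥0∞) z :=
    fun r => measurable_one.indicator (measurableSet_lt measurable_const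
      ((measurable_pi_apply r).comp hδm))
  have hexp : ∀ r, Measurable fun z => ENNReal.ofReal
      (Real.exp (-(rate r * (t - startTime (deathTime rate z) r)))) := fun r => by
    have := measurable_startTime hδm r
    fun_prop
  induction L using Finset.induction_on generalizing A with
  | empty => simp
  | insert r L hr ih =>
    have hns : ∀ r' ∈ L, ¬ r <:+ r' := fun r' hr' h => hr
      (hL r (Finset.mem_insert_self _ _) r' (Finset.mem_insert_of_mem hr') h ▸ hr')
    have hns' : ∀ r' ∈ L, ¬ r' <:+ r := fun r' hr' h => hr
      (hL r' (Finset.mem_insert_of_mem hr') r (Finset.mem_insert_self _ _) h ▸ hr')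
    have hprod : Measurable fun z => A z * ∏ r' ∈ insert r L,
        {z | t < deathTime rate z r'}.indicator (1 : (Word → ℝ) → ℝ≥0∞) z :=
      hA.mul (Finset.measurable_prod _ fun r' _ => hind r')
    have hA' : Measurable fun z => A z * ENNReal.ofReal
        (Real.exp (-(rate r * (t - startTime (deathTime rate z) r)))) := hA.mul (hexp r)
    have hstep : ∫⁻ z, A z * ∏ r' ∈ insert r L, {z | t < deathTime rate z r'}.indicator 1 z
        ∂(Measure.infinitePi fun _ : Word => expMeasure 1) =
        ∫⁻ z, (A z * ENNReal.ofReal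
          (Real.exp (-(rate r * (t - startTime (deathTime rate z) r))))) *
          ∏ r' ∈ L, {z | t < deathTime rate z r'}.indicator 1 z
          ∂(Measure.infinitePi fun _ : Word => expMeasure 1) := by
      rw [lintegral_resample _ r hprod]
      refine lintegral_congr fun z => ?_
      have h1 : ∀ y, A (Function.update z r y) * ∏ r' ∈ insert r L,
          {z | t < deathTime rate z r'}.indicator (1 : (Word → ℝ) → ℝ≥0∞) (Function.update z r y) =
          (A z * ∏ r' ∈ L, {z | t < deathTime rate z r'}.indicator 1 z) *
            (Ioi (rate r * (t - startTime (deathTime rate z) r))).indicator 1 y := by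
        intro y
        rw [hAd r (Finset.mem_insert_self _ _), Finset.prod_insert hr, mul_comm (indicator _ _ _),
          ← mul_assoc]
        have hr0 := hrate r (Finset.mem_insert_self _ _)
        congr 1
        · congr 1
          refine Finset.prod_congr rfl fun r' hr' => ?_
          simp only [indicator, mem_ofPred_eq,
            deathTime_update_of_not_suffix rate z (hns r' hr') y, Pi.one_apply]
        · have : t < deathTime rate (Function.update z r y) r ↔
              rate r * (t - startTime (deathTime rate z) r) < y := by
            rw [deathTime_eq, startTime_deathTime_update, Function.update_self,
              ← sub_lt_iff_lt_add', ← div_eq_inv_mul, lt_div_iff₀ hr0, mul_comm]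
          simp only [indicator, mem_ofPred_eq, mem_Ioi, this, Pi.one_apply]
      simp_rw [h1]
      rw [lintegral_const_mul _ (measurable_one.indicator measurableSet_Ioi),
        lintegral_indicator_one measurableSet_Ioi]
      by_cases hAz : A z = 0
      · simp [hAz]
      · rw [expMeasure_Ioi (mul_nonneg (hrate r (Finset.mem_insert_self _ _)).le
          (sub_nonneg.2 (hstart r (Finset.mem_insert_self _ _) z hAz)))]
        ring
    rw [hstep, ih (fun r' hr' => hrate r' (Finset.mem_insert_of_mem hr'))
      (fun a ha b hb => hL a (Finset.mem_insert_of_mem ha) b (Finset.mem_insert_of_mem hb)) hA'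
      (fun r' hr' z y => ?_) (fun r' hr' z hz => ?_)]
    · refine lintegral_congr fun z => ?_
      rw [Finset.prod_insert hr]
      ring
    · have hs : startTime (deathTime rate (Function.update z r' y)) r =
          startTime (deathTime rate z) r := by
        cases r with
        | nil => rfl
        | cons b e =>
          exact deathTime_update_of_not_suffix rate z
            (fun h => hns' r' hr' (h.trans (List.suffix_cons b e))) y
      rw [hAd r' (Finset.mem_insert_of_mem hr'), hs]
    · exact hstart r' (Finset.mem_insert_of_mem hr') z (left_ne_zero_of_mul hz)

/-- The total lifetime of all cells up to time `τ`, weighted by the rates of division, is the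
integral over time of the total rate of the current leaves. -/
theorem sum_lifetimes_eq (hσ : IsDivisionOrder σ k) (rate : Word → ℝ) {s : ℕ} (hs : s ≤ k)
    (w : Fin s → ℝ) (τ : ℝ) :
    ∑ i ∈ Finset.range s, rate (σ i) *
        (timesOfWaits σ s w (σ i) - startTime (timesOfWaits σ s w) (σ i)) +
      ∑ r ∈ leafWords σ s, rate r * (τ - startTime (timesOfWaits σ s w) r) =
    ∑ i : Fin s, (∑ r ∈ leafWords σ i, rate r) * w i +
      (∑ r ∈ leafWords σ s, rate r) * (τ - ∑ i, w i) := by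
  induction s with
  | zero => simp [leafWords, startTime]
  | succ s ih =>
    set w' : Fin s → ℝ := Fin.init (α := fun _ => ℝ) w
    have ih := ih (by omega) w'
    have hw : ∀ i, w (Fin.castSucc i) = w' i := fun i => rfl
    set D := timesOfWaits σ s w'
    set D' := timesOfWaits σ (s + 1) w with hD'
    have hne : ∀ i < s, σ i ≠ σ s := fun i hi h => by
      have := hσ.inj i (by omega) s (by omega) h
      omega
    have hDD : ∀ i < s, D' (σ i) = D (σ i) := fun i hi => Function.update_of_ne (hne i hi) _ _
    have hDs : D' (σ s) = ∑ i, w i := Function.update_self _ _ _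
    have e1 : ∑ i ∈ Finset.range (s + 1), rate (σ i) * (D' (σ i) - startTime D' (σ i)) =
        ∑ i ∈ Finset.range s, rate (σ i) * (D (σ i) - startTime D (σ i)) +
          rate (σ s) * (∑ i, w i - startTime D (σ s)) := by
      rw [Finset.sum_range_succ, hDs, startTime_congr hσ (by omega) hDD]
      congr 1
      refine Finset.sum_congr rfl fun i hi => ?_
      have hi := Finset.mem_range.1 hi
      rw [hDD i hi, startTime_congr hσ (by omega) fun j hj => hDD j (by omega)]
    have hst : ∀ r ∈ leafWords σ s, startTime D' r = startTime D r := by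
      intro r hr
      rcases ((hσ.mem_leafWords (by omega)).1 hr).1 with rfl | ⟨i, hi, b, rfl⟩
      · rfl
      · exact hDD i hi
    have e2 : ∑ r ∈ leafWords σ s, rate r * (τ - startTime D' r) =
        ∑ r ∈ leafWords σ s, rate r * (τ - startTime D r) :=
      Finset.sum_congr rfl fun r hr => by rw [hst r hr]
    have e3 : startTime D' (σ s) = startTime D (σ s) := hst _ (hσ.mem_leafWords_self (by omega))
    have e4 : ∀ b, startTime D' (b :: σ s) = ∑ i, w i := fun _ => hDs
    have e5 : ∑ i : Fin (s + 1), (∑ r ∈ leafWords σ i, rate r) * w i =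
        ∑ i : Fin s, (∑ r ∈ leafWords σ i, rate r) * w' i +
          (∑ r ∈ leafWords σ s, rate r) * w (Fin.last s) := by
      rw [Fin.sum_univ_castSucc]
      rfl
    have e6 : ∑ i, w i = ∑ i, w' i + w (Fin.last s) := by
      rw [Fin.sum_univ_castSucc]
      rfl
    rw [e1, hσ.sum_leafWords_succ (by omega), hσ.sum_leafWords_succ (by omega) rate, e2, e3, e4, e4,
      e5, e6]
    linear_combination ih

/-- Given the rates, the probability that the divisions up to time `t` are those of `σ`, in this
order. -/
theorem measure_inOrder_and_leaves (hσ : IsDivisionOrder σ k) {rate : Word → ℝ} {t : ℝ}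
    (ht : 0 ≤ t) (hrate : ∀ i < k, 0 < rate (σ i)) (hrate' : ∀ r ∈ leafWords σ k, 0 < rate r) :
    Measure.infinitePi (fun _ : Word => expMeasure 1)
        {z | InOrder σ t k (deathTime rate z) ∧ ∀ r ∈ leafWords σ k, t < deathTime rate z r} =
      timeIntegral t k fun w => (∏ s : Fin k, ENNReal.ofReal (rate (σ s))) *
        ENNReal.ofReal (Real.exp (-∑ s : Fin k, (∑ r ∈ leafWords σ s, rate r) * w s)) *
        ENNReal.ofReal (Real.exp (-((∑ r ∈ leafWords σ k, rate r) * (t - ∑ s, w s)))) := by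
  classical
  have hδm : Measurable fun z => deathTime rate z :=
    measurable_deathTime measurable_const measurable_id
  let A : (Word → ℝ) → ℝ≥0∞ := fun z => {d | InOrder σ t k d}.indicator 1 (deathTime rate z)
  have hA : Measurable A := (measurable_one.indicator (measurableSet_inOrder σ t k)).comp hδm
  have hns : ∀ r ∈ leafWords σ k, ∀ i < k, ¬ r <:+ σ i := fun r hr i hi h => by
    obtain ⟨j, hj, hrj⟩ := hσ.mem_of_suffix hi h
    exact ((hσ.mem_leafWords le_rfl).1 hr).2 j (by omega) hrj
  have hL : ∀ r ∈ leafWords σ k, ∀ r' ∈ leafWords σ k, r <:+ r' → r = r' := by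
    intro r hr r' hr' h
    by_contra hne
    obtain ⟨j, hj, hrj⟩ := hσ.mem_of_suffix_tree le_rfl ((hσ.mem_leafWords le_rfl).1 hr').1 h hne
    exact ((hσ.mem_leafWords le_rfl).1 hr).2 j (by omega) hrj
  have hAd : ∀ r ∈ leafWords σ k, ∀ z y, A (Function.update z r y) = A z := by
    intro r hr z y
    have := inOrder_congr (t := t) (s := k) (σ := σ) (fun i hi =>
      deathTime_update_of_not_suffix rate z (hns r hr i hi) y)
    simp only [A, indicator, mem_ofPred_eq, this, Pi.one_apply]
  have hstart : ∀ r ∈ leafWords σ k, ∀ z, A z ≠ 0 → startTime (deathTime rate z) r ≤ t := by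
    intro r hr z hz
    have hin : InOrder σ t k (deathTime rate z) := by
      by_contra h
      exact hz (indicator_of_notMem (by exact h) _)
    rcases ((hσ.mem_leafWords le_rfl).1 hr).1 with rfl | ⟨i, hi, b, rfl⟩
    · exact ht
    · exact (hin i hi).2
  have hset : MeasurableSet {z | InOrder σ t k (deathTime rate z) ∧
      ∀ r ∈ leafWords σ k, t < deathTime rate z r} := by
    refine ((measurableSet_inOrder σ t k).preimage hδm).inter ?_
    have : {z | ∀ r ∈ leafWords σ k, t < deathTime rate z r} =
        ⋂ r ∈ leafWords σ k, {z | t < deathTime rate z r} := by ext; simp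
    change MeasurableSet {z | ∀ r ∈ leafWords σ k, t < deathTime rate z r}
    rw [this]
    exact Finset.measurableSet_biInter _ fun r _ =>
      measurableSet_lt measurable_const ((measurable_pi_apply r).comp hδm)
  let F : (Word → ℝ) → ℝ≥0∞ := fun d => ∏ r ∈ leafWords σ k,
    ENNReal.ofReal (Real.exp (-(rate r * (t - startTime d r))))
  have hF : Measurable F := Finset.measurable_prod _ fun r _ => by
    have := measurable_startTime (measurable_id : Measurable fun d : Word → ℝ => d) r
    fun_prop
  have hFd : ∀ d d', (∀ i < k, d (σ i) = d' (σ i)) → F d = F d' := by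
    intro d d' h
    refine Finset.prod_congr rfl fun r hr => ?_
    rcases ((hσ.mem_leafWords le_rfl).1 hr).1 with rfl | ⟨i, hi, b, rfl⟩
    · rfl
    · simp only [startTime, h i hi]
  calc _ = ∫⁻ z, A z * ∏ r ∈ leafWords σ k, {z | t < deathTime rate z r}.indicator 1 z
        ∂(Measure.infinitePi fun _ : Word => expMeasure 1) := by
        rw [← lintegral_indicator_one hset]
        refine lintegral_congr fun z => ?_
        by_cases h1 : InOrder σ t k (deathTime rate z)
        · by_cases h2 : ∀ r ∈ leafWords σ k, t < deathTime rate z r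
          · have h3 : ∏ r ∈ leafWords σ k,
                {z | t < deathTime rate z r}.indicator (1 : (Word → ℝ) → ℝ≥0∞) z = 1 :=
              Finset.prod_eq_one fun r hr => indicator_of_mem (by exact h2 r hr) _
            rw [h3, indicator_of_mem (by exact ⟨h1, h2⟩)]
            simp [A, h1]
          · push Not at h2
            obtain ⟨r, hr, hrt⟩ := h2
            have h3 : ∏ r ∈ leafWords σ k,
                {z | t < deathTime rate z r}.indicator (1 : (Word → ℝ) → ℝ≥0∞) z = 0 :=
              Finset.prod_eq_zero hr (indicator_of_notMem (by exact not_lt.2 hrt) _)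
            rw [h3, mul_zero]
            exact indicator_of_notMem (fun h => absurd (h.2 r hr) (not_lt.2 hrt)) _
        · simp [A, h1]
    _ = ∫⁻ z, A z * F (deathTime rate z) ∂(Measure.infinitePi fun _ : Word => expMeasure 1) :=
        lintegral_prod_leaves t _ hrate' hL hA hAd hstart
    _ = ∫⁻ z, {d | InOrder σ t k d}.indicator F (deathTime rate z)
          ∂(Measure.infinitePi fun _ : Word => expMeasure 1) := by
        refine lintegral_congr fun z => ?_
        by_cases h1 : InOrder σ t k (deathTime rate z) <;> simp [A, h1]
    _ = _ := by
        rw [lintegral_inOrder_deathTime hσ t le_rfl hrate hF hFd]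
        congr 1
        funext w
        have hkey := sum_lifetimes_eq hσ rate le_rfl w t
        simp only [F, timeDensity]
        rw [← ENNReal.ofReal_prod_of_nonneg fun _ _ => (Real.exp_pos _).le, ← Real.exp_sum,
          Finset.prod_congr rfl fun i hi =>
            ENNReal.ofReal_mul (hrate i (Finset.mem_range.1 hi)).le,
          Finset.prod_mul_distrib, ← ENNReal.ofReal_prod_of_nonneg (s := Finset.range k)
            (f := fun i => Real.exp _) fun _ _ => (Real.exp_pos _).le, ← Real.exp_sum,
          Finset.prod_range, mul_assoc, mul_assoc, ← ENNReal.ofReal_mul (Real.exp_pos _).le,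
          ← ENNReal.ofReal_mul (Real.exp_pos _).le, ← Real.exp_add, ← Real.exp_add]
        congr 3
        rw [Finset.sum_neg_distrib, Finset.sum_neg_distrib]
        linear_combination -hkey

end DivisionOrder

end STIT

namespace STIT

/-! ### Histories of divisions up to a fixed time -/

/-- The words of `σ` are divided in this order up to time `t`, and no other cell is. -/
def IsHistory (σ : ℕ → Word) (t : ℝ) (k : ℕ) (d : Word → ℝ) : Prop :=
  InOrder σ t k d ∧ ∀ r ∈ leafWords σ k, t < d r

theorem InOrder.lt_of_lt {σ : ℕ → Word} {t : ℝ} {k : ℕ} {d : Word → ℝ} (h : InOrder σ t k d)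
    {i j : ℕ} (hij : i < j) (hj : j < k) : d (σ i) < d (σ j) := by
  have hj' : InOrder σ t j d := fun i hi => h i (by omega)
  exact (hj'.le_prevTime.2 i hij).trans_lt (h j hj).1

namespace IsDivisionOrder

variable {σ : ℕ → Word} {k : ℕ}

theorem card_leafWords (hσ : IsDivisionOrder σ k) {s : ℕ} (hs : s ≤ k) :
    (leafWords σ s).card = s + 1 := by
  induction s with
  | zero => simp [leafWords]
  | succ s ih =>
    have h := hσ.sum_leafWords_succ (s := s) (by omega) fun _ => 1
    simp only [Finset.sum_const, ih (by omega), nsmul_eq_mul, mul_one] at h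
    have h' : ((leafWords σ (s + 1)).card : ℝ) = ((s + 1 + 1 : ℕ) : ℝ) := by
      rw [h]; push_cast; ring
    exact_mod_cast h'

variable {d : Word → ℝ} {t : ℝ}

/-- Every word that is born up to time `t` belongs to the tree of the history. -/
theorem mem_tree_of_startTime_le (hσ : IsDivisionOrder σ k) (hd : ∀ e, startTime d e < d e)
    (h : IsHistory σ t k d) {e : Word} (he : startTime d e ≤ t) :
    e = [] ∨ ∃ i < k, ∃ b, e = b :: σ i := by
  induction e with
  | nil => exact Or.inl rfl
  | cons b f ih =>
    have hf : d f ≤ t := he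
    have hft := ih ((hd f).le.trans hf)
    by_cases hfl : f ∈ leafWords σ k
    · exact absurd (h.2 f hfl) (not_lt.2 hf)
    · rw [hσ.mem_leafWords le_rfl] at hfl
      push Not at hfl
      obtain ⟨i, hi, rfl⟩ := hfl hft
      exact Or.inr ⟨i, hi, b, rfl⟩

theorem exists_eq_of_le (hσ : IsDivisionOrder σ k) (hd : ∀ e, startTime d e < d e)
    (h : IsHistory σ t k d) {e : Word} (he : d e ≤ t) : ∃ i < k, e = σ i := by
  have het := hσ.mem_tree_of_startTime_le hd h ((hd e).le.trans he)
  by_contra hne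
  push Not at hne
  exact absurd (h.2 e ((hσ.mem_leafWords le_rfl).2 ⟨het, hne⟩)) (not_lt.2 he)

theorem setOf_alive_eq (hσ : IsDivisionOrder σ k) (hd : ∀ e, startTime d e < d e) (ht : 0 ≤ t)
    (h : IsHistory σ t k d) : {e | startTime d e ≤ t ∧ t < d e} = leafWords σ k := by
  ext e
  rw [Finset.mem_coe]
  constructor
  · rintro ⟨h1, h2⟩
    refine (hσ.mem_leafWords le_rfl).2 ⟨hσ.mem_tree_of_startTime_le hd h h1, ?_⟩
    rintro i hi rfl
    exact absurd (h.1 i hi).2 (not_le.2 h2)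
  · intro he
    refine ⟨?_, h.2 e he⟩
    rcases ((hσ.mem_leafWords le_rfl).1 he).1 with rfl | ⟨i, hi, b, rfl⟩
    · exact ht
    · exact (h.1 i hi).2

/-- A history lists the divided words by increasing times of division, hence is unique. -/
theorem eq_of_isHistory (hσ : IsDivisionOrder σ k) {σ' : ℕ → Word} (hσ' : IsDivisionOrder σ' k)
    (hd : ∀ e, startTime d e < d e) (h : IsHistory σ t k d) (h' : IsHistory σ' t k d) :
    ∀ i < k, σ i = σ' i := by
  have hm : StrictMono fun i : Fin k => d (σ i) := fun i j hij => h.1.lt_of_lt hij j.2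
  have hm' : StrictMono fun i : Fin k => d (σ' i) := fun i j hij => h'.1.lt_of_lt hij j.2
  have hr : (fun i : Fin k => d (σ i)) = fun i : Fin k => d (σ' i) := by
    refine (StrictMono.range_inj hm hm').1 (Subset.antisymm ?_ ?_)
    · rintro _ ⟨i, rfl⟩
      obtain ⟨j, hj, hij⟩ := hσ'.exists_eq_of_le hd h' (h.1 i i.2).2
      exact ⟨⟨j, hj⟩, by simp only [hij]⟩
    · rintro _ ⟨i, rfl⟩
      obtain ⟨j, hj, hij⟩ := hσ.exists_eq_of_le hd h (h'.1 i i.2).2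
      exact ⟨⟨j, hj⟩, by simp only [hij]⟩
  intro i hi
  obtain ⟨j, hj, hij⟩ := hσ'.exists_eq_of_le hd h' (h.1 i hi).2
  have h1 := congrFun hr ⟨i, hi⟩
  simp only [hij] at h1
  have h2 := congrArg Fin.val (hm'.injective (a₁ := ⟨j, hj⟩) (a₂ := ⟨i, hi⟩) h1)
  simp only at h2
  rw [hij, h2]

end IsDivisionOrder

/-- If finitely many cells are born up to time `t`, and no two cells are divided simultaneously,
then the divided words, listed by their times of division, form a history. -/
theorem exists_isHistory {d : Word → ℝ} {t : ℝ} (hd : ∀ e, startTime d e < d e)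
    (hinj : Function.Injective d) (hfin : {e | startTime d e ≤ t}.Finite) :
    ∃ k σ, IsDivisionOrder σ k ∧ IsHistory σ t k d := by
  classical
  have hDf : {e | d e ≤ t}.Finite := hfin.subset fun e he => (hd e).le.trans he
  -- the times of division up to time `t`, enumerated in increasing order by `o`
  let D : Finset ℝ := hDf.toFinset.image d
  have hD : ∀ x, x ∈ D ↔ ∃ e, d e ≤ t ∧ d e = x := fun x => by simp [D]
  let o := D.orderEmbOfFin rfl
  have ho : ∀ i, ∃ e, d e ≤ t ∧ d e = o i := fun i => (hD _).1 (D.orderEmbOfFin_mem rfl i)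
  choose τ hτ hτo using ho
  let σ : ℕ → Word := fun n => if h : n < D.card then τ ⟨n, h⟩ else []
  have hσ : ∀ i (hi : i < D.card), σ i = τ ⟨i, hi⟩ := fun i hi => dif_pos hi
  have hsurj : ∀ e, d e ≤ t → ∃ i, ∃ hi : i < D.card, e = σ i ∧ d e = o ⟨i, hi⟩ := by
    intro e he
    have : d e ∈ Set.range o := by
      rw [Finset.range_orderEmbOfFin]
      exact (hD _).2 ⟨e, he, rfl⟩
    obtain ⟨i, hi⟩ := this
    exact ⟨i, i.2, by rw [hσ i i.2]; exact hinj (hi.symm.trans (hτo i).symm), hi.symm⟩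
  have h0 : ∀ e, 0 ≤ startTime d e := by
    intro e
    induction e with
    | nil => exact le_rfl
    | cons b e ih => exact ih.trans (hd e).le
  have hpred : ∀ l < D.card, σ l = [] ∨ ∃ i < l, ∃ b, σ l = b :: σ i := by
    intro l hl
    rcases hl' : σ l with _ | ⟨b, f⟩
    · exact Or.inl rfl
    · right
      have h1 : d f < d (b :: f) := hd (b :: f)
      rw [← hl', hσ l hl, hτo] at h1
      obtain ⟨i, hi, rfl, hoi⟩ := hsurj f (h1.le.trans ((hτo _).symm.trans_le (hτ _)))
      rw [hoi, o.lt_iff_lt] at h1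
      exact ⟨i, h1, b, rfl⟩
  have hdiv : IsDivisionOrder σ D.card := by
    refine ⟨fun i hi j hj h => ?_, hpred⟩
    rw [hσ i hi, hσ j hj] at h
    have := congrArg d h
    rw [hτo, hτo] at this
    exact congrArg Fin.val (o.injective this)
  refine ⟨D.card, σ, hdiv, fun i hi => ⟨?_, ?_⟩, fun r hr => ?_⟩
  · cases i with
    | zero => exact (h0 _).trans_lt (hd _)
    | succ i =>
      simp only [prevTime]
      rw [hσ i (by omega), hσ _ hi, hτo, hτo, o.lt_iff_lt]
      exact Nat.lt_succ_self i
  · rw [hσ i hi]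
    exact hτ _
  · by_contra hrt
    obtain ⟨i, hi, hri, -⟩ := hsurj r (not_lt.1 hrt)
    exact ((hdiv.mem_leafWords le_rfl).1 hr).2 i hi hri

/-! ### The process does not explode, and no two divisions are simultaneous -/

/-- There are `2 ^ n` words of length `n`. -/
theorem tsum_length_pow_ne_top : ∑' e : Word, (4⁻¹ : ℝ≥0∞) ^ e.length ≠ ∞ := by
  have h1 : ∀ n : ℕ, ∑' v : {e : Word // e.length = n}, (4⁻¹ : ℝ≥0∞) ^ v.1.length = 2⁻¹ ^ n := by
    intro n
    have h2 : ∀ v : {e : Word // e.length = n}, (4⁻¹ : ℝ≥0∞) ^ v.1.length = 4⁻¹ ^ n :=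
      fun v => by rw [v.2]
    have h3 : ∑' _ : List.Vector Bool n, (4⁻¹ : ℝ≥0∞) ^ n = 2⁻¹ ^ n := by
      rw [tsum_fintype, Finset.sum_const, Finset.card_univ, card_vector, Fintype.card_bool,
        nsmul_eq_mul, Nat.cast_pow, ← mul_pow]
      congr 1
      rw [show (4 : ℝ≥0∞) = 2 * 2 by norm_num, ENNReal.mul_inv (by simp) (by simp), ← mul_assoc,
        Nat.cast_ofNat, ENNReal.mul_inv_cancel (by simp) (by simp), one_mul]
    simp_rw [h2]
    exact h3
  rw [← (Equiv.sigmaFiberEquiv (List.length : Word → ℕ)).tsum_eq, ENNReal.tsum_sigma']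
  simp only [Equiv.sigmaFiberEquiv_apply]
  simp_rw [h1]
  rw [ENNReal.tsum_geometric]
  simp

theorem lintegral_exp_expMeasure :
    ∫⁻ y, ENNReal.ofReal (Real.exp (-3 * y)) ∂(expMeasure 1) = 4⁻¹ := by
  rw [lintegral_expMeasure (by fun_prop)]
  have h : ∀ y : ℝ, ENNReal.ofReal (Real.exp (-y)) * ENNReal.ofReal (Real.exp (-3 * y)) =
      ENNReal.ofReal (Real.exp (-4 * y)) := fun y => by
    rw [← ENNReal.ofReal_mul (Real.exp_pos _).le, ← Real.exp_add]
    ring_nf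
  simp_rw [h]
  rw [setLIntegral_congr Ioi_ae_eq_Ici.symm, ← ofReal_integral_eq_lintegral_ofReal
    (integrableOn_exp_mul_Ioi (by norm_num) 0)
    (Filter.Eventually.of_forall fun _ => (Real.exp_pos _).le), integral_exp_mul_Ioi (by norm_num)]
  rw [show -Real.exp (-4 * 0) / -4 = (4 : ℝ)⁻¹ by norm_num, ENNReal.ofReal_inv_of_pos (by norm_num)]
  norm_num

/-- For unit rates, the time of birth of a word of length `n` is a sum of `n` independent standard
exponential variables. -/
theorem lintegral_exp_startTime (e : Word) :
    ∫⁻ z, ENNReal.ofReal (Real.exp (-3 * startTime (deathTime (fun _ => 1) z) e))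
      ∂(Measure.infinitePi fun _ : Word => expMeasure 1) = 4⁻¹ ^ e.length := by
  have hm : ∀ e : Word, Measurable fun z : Word → ℝ =>
      ENNReal.ofReal (Real.exp (-3 * startTime (deathTime (fun _ => 1) z) e)) := fun e => by
    have := measurable_startTime (measurable_deathTime
      (measurable_const (a := fun _ : Word => (1 : ℝ)))
      (measurable_id : Measurable fun z : Word → ℝ => z)) e
    fun_prop
  induction e with
  | nil => simp [startTime]
  | cons b e ih =>
    rw [lintegral_resample _ e (hm _)]
    have h : ∀ (z : Word → ℝ) (y : ℝ), ENNReal.ofReal (Real.exp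
        (-3 * startTime (deathTime (fun _ => 1) (Function.update z e y)) (b :: e))) =
        ENNReal.ofReal (Real.exp (-3 * startTime (deathTime (fun _ => 1) z) e)) *
          ENNReal.ofReal (Real.exp (-3 * y)) := by
      intro z y
      rw [← ENNReal.ofReal_mul (Real.exp_pos _).le, ← Real.exp_add, ← mul_add]
      rw [show startTime (deathTime (fun _ => 1) (Function.update z e y)) (b :: e) =
        deathTime (fun _ => 1) (Function.update z e y) e from rfl, deathTime_eq,
        startTime_deathTime_update, Function.update_self, inv_one, one_mul]
    simp_rw [h]
    have h' : ∀ z : Word → ℝ, ∫⁻ y, ENNReal.ofReal (Real.exp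
        (-3 * startTime (deathTime (fun _ => 1) z) e)) * ENNReal.ofReal (Real.exp (-3 * y))
          ∂(expMeasure 1) = ENNReal.ofReal (Real.exp
        (-3 * startTime (deathTime (fun _ => 1) z) e)) * 4⁻¹ := fun z => by
      rw [lintegral_const_mul _ (by fun_prop), lintegral_exp_expMeasure]
    simp_rw [h']
    rw [lintegral_mul_const _ (hm e), ih, List.length_cons, pow_succ]

/-- For unit rates, almost surely only finitely many cells are born up to any given time: the
expected number of births, discounted at rate `3`, is finite. -/
theorem ae_finite_startTime_le :
    ∀ᵐ z ∂(Measure.infinitePi fun _ : Word => expMeasure 1),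
      ∀ c : ℝ, {e | startTime (deathTime (fun _ => 1) z) e ≤ c}.Finite := by
  have hm : ∀ e : Word, Measurable fun z : Word → ℝ =>
      ENNReal.ofReal (Real.exp (-3 * startTime (deathTime (fun _ => 1) z) e)) := fun e => by
    have := measurable_startTime (measurable_deathTime
      (measurable_const (a := fun _ : Word => (1 : ℝ)))
      (measurable_id : Measurable fun z : Word → ℝ => z)) e
    fun_prop
  have hsum : ∫⁻ z, ∑' e, ENNReal.ofReal
      (Real.exp (-3 * startTime (deathTime (fun _ => 1) z) e))
      ∂(Measure.infinitePi fun _ : Word => expMeasure 1) ≠ ∞ := by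
    rw [lintegral_tsum fun e => (hm e).aemeasurable]
    simp_rw [lintegral_exp_startTime]
    exact tsum_length_pow_ne_top
  filter_upwards [ae_lt_top (Measurable.tsum hm) hsum] with z hz c
  refine (ENNReal.finite_const_le_of_tsum_ne_top (ε := ENNReal.ofReal (Real.exp (-3 * c))) hz.ne
    (by simp [Real.exp_pos])).subset fun e he => ?_
  have he : startTime (deathTime (fun _ => 1) z) e ≤ c := he
  exact ENNReal.ofReal_le_ofReal (Real.exp_le_exp.2 (by linarith))

theorem le_startTime_deathTime {rate z : Word → ℝ} {M : ℝ} (hr : ∀ e, 0 < rate e)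
    (hM : ∀ e, rate e ≤ M) (hz : ∀ e, 0 < z e) (e : Word) :
    M⁻¹ * startTime (deathTime (fun _ => 1) z) e ≤ startTime (deathTime rate z) e := by
  induction e with
  | nil => simp [startTime]
  | cons b e ih =>
    simp only [startTime]
    rw [deathTime_eq, deathTime_eq, mul_add]
    refine add_le_add ih ?_
    simp only [inv_one, one_mul]
    exact mul_le_mul_of_nonneg_right (inv_anti₀ (hr e) (hM e)) (hz e).le

theorem finite_startTime_le_of_rate_le {rate z : Word → ℝ} {M : ℝ} (hr : ∀ e, 0 < rate e)
    (hM : ∀ e, rate e ≤ M) (hz : ∀ e, 0 < z e)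
    (hfin : ∀ c : ℝ, {e | startTime (deathTime (fun _ => 1) z) e ≤ c}.Finite) (t : ℝ) :
    {e | startTime (deathTime rate z) e ≤ t}.Finite := by
  have hM0 : 0 < M := (hr []).trans_le (hM [])
  refine (hfin (M * t)).subset fun e he => ?_
  have h := (le_startTime_deathTime hr hM hz e).trans he
  change startTime (deathTime (fun _ => 1) z) e ≤ M * t
  rwa [inv_mul_le_iff₀ hM0] at h

theorem ae_expMeasure_pos :
    ∀ᵐ z ∂(Measure.infinitePi fun _ : Word => expMeasure 1), ∀ e, 0 < z e := by
  refine ae_all_iff.2 fun e => ?_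
  have h1 : ∀ᵐ y ∂(expMeasure 1), 0 < y := by
    have h2 : expMeasure 1 (Ioi 0) = 1 := by rw [expMeasure_Ioi le_rfl]; simp
    exact (mem_ae_iff_prob_eq_one measurableSet_Ioi).2 h2
  have h3 := Measure.infinitePi_map_eval (fun _ : Word => expMeasure 1) e
  rw [← h3] at h1
  exact ae_of_ae_map (measurable_pi_apply e).aemeasurable h1

theorem expMeasure_singleton (x : ℝ) : expMeasure 1 {x} = 0 := by
  have h : expMeasure 1 ≪ volume := withDensity_absolutelyContinuous _ _
  exact h (by simp)

theorem ae_injective_deathTime {rate : Word → ℝ} (hr : ∀ e, 0 < rate e) :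
    ∀ᵐ z ∂(Measure.infinitePi fun _ : Word => expMeasure 1),
      Function.Injective (deathTime rate z) := by
  have hm : Measurable fun z : Word → ℝ => deathTime rate z :=
    measurable_deathTime measurable_const measurable_id
  -- One of two distinct words is not a suffix of the other. Its lifetime does not enter the time at
  -- which the other one is divided, and the conclusion excludes at most one value of this lifetime.
  have key : ∀ e e' : Word, ¬ e <:+ e' →
      ∀ᵐ z ∂(Measure.infinitePi fun _ : Word => expMeasure 1),
        deathTime rate z e ≠ deathTime rate z e' := by
    intro e e' he
    have hms : MeasurableSet {z | deathTime rate z e ≠ deathTime rate z e'} :=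
      (measurableSet_eq_fun ((measurable_pi_apply e).comp hm)
        ((measurable_pi_apply e').comp hm)).compl
    refine ae_resample _ e hms fun z => ?_
    have hsub : {y | ¬ deathTime rate (Function.update z e y) e ≠
        deathTime rate (Function.update z e y) e'} ⊆
        {rate e * (deathTime rate z e' - startTime (deathTime rate z) e)} := by
      intro y hy
      simp only [mem_ofPred_eq, not_not] at hy
      rw [deathTime_eq, startTime_deathTime_update, deathTime_update_of_not_suffix rate z he,
        Function.update_self] at hy
      rw [mem_singleton_iff, ← hy, add_sub_cancel_left, mul_inv_cancel_left₀ (hr e).ne']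
    exact measure_mono_null hsub (expMeasure_singleton _)
  have h2 : ∀ᵐ z ∂(Measure.infinitePi fun _ : Word => expMeasure 1), ∀ e e' : Word,
      e ≠ e' → deathTime rate z e ≠ deathTime rate z e' := by
    refine ae_all_iff.2 fun e => ae_all_iff.2 fun e' => ?_
    by_cases hee : e = e'
    · exact Filter.Eventually.of_forall fun z h => absurd hee h
    · by_cases h : e <:+ e'
      · have h' : ¬ e' <:+ e := fun h' =>
          hee (h.eq_of_length (le_antisymm h.length_le h'.length_le))
        filter_upwards [key e' e h'] with z hz _ using hz.symm
      · filter_upwards [key e e' h] with z hz _ using hz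
  filter_upwards [h2] with z hz e e' h
  by_contra hne
  exact hz e e' hne h

end STIT

namespace STIT

variable {ℓ : ℕ} {p : Hyperplane ℓ → Param ℓ} {W : Set (Space ℓ)}

/-! ### The tessellation of the leaves -/

/-- Two words, neither of which precedes the other in the tree, separate at some word `f`. -/
theorem Word.exists_split {e e' : Word} (h : ¬ e <:+ e') (h' : ¬ e' <:+ e) :
    ∃ b f, b :: f <:+ e ∧ (!b) :: f <:+ e' := by
  induction e with
  | nil => exact absurd (List.nil_suffix) h
  | cons b f ih =>
    by_cases hf : f <:+ e'
    · obtain ⟨l, rfl⟩ := hf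
      rcases List.eq_nil_or_concat l with rfl | ⟨l', c, rfl⟩
      · exact absurd (List.suffix_cons b f) h'
      · refine ⟨b, f, List.suffix_rfl, ?_⟩
        by_cases hc : c = b
        · subst hc
          exact absurd ⟨l', by simp⟩ h
        · have : c = !b := by cases b <;> cases c <;> simp_all
          subst this
          exact ⟨l', by simp⟩
    · obtain ⟨c, f', h1, h2⟩ := ih hf fun h1 => h' (h1.trans (List.suffix_cons b f))
      exact ⟨c, f', h1.trans (List.suffix_cons b f), h2⟩

theorem cell_subset_of_suffix {h : Word → Hyperplane ℓ} {e f : Word} (hf : f <:+ e) :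
    cell p W h e ⊆ cell p W h f := by
  induction e with
  | nil => rw [List.suffix_nil.1 hf]
  | cons b e ih =>
    rcases List.suffix_cons_iff.1 hf with rfl | h1
    · exact Subset.rfl
    · exact inter_subset_left.trans (ih h1)

theorem inner_self_upperSphere (u : upperSphere ℓ) : inner ℝ (u : Space ℓ) (u : Space ℓ) = 1 := by
  rw [real_inner_self_eq_norm_sq, u.2.1, one_pow]

theorem half_inter_half (q : Param ℓ) (b : Bool) : half q b ∩ half q (!b) = plane q := by
  ext x
  cases b
  · exact ⟨fun h => le_antisymm h.1 h.2, fun h => ⟨le_of_eq h, ge_of_eq h⟩⟩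
  · exact ⟨fun h => le_antisymm h.2 h.1, fun h => ⟨ge_of_eq h, le_of_eq h⟩⟩

theorem half_union_half (q : Param ℓ) : half q false ∪ half q true = univ :=
  eq_univ_of_forall fun x => le_total (inner ℝ x (q.2 : Space ℓ)) q.1

/-- Points close to a point `x` of a hyperplane, in the direction of the normal. -/
theorem mem_of_mem_interior {q : Param ℓ} {x : Space ℓ} {s : Set (Space ℓ)} (hs : x ∈ interior s) :
    ∃ ε : ℝ, 0 < ε ∧ x + ε • (q.2 : Space ℓ) ∈ s := by
  obtain ⟨ε, hε, hball⟩ :=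
    Metric.nhds_basis_closedBall.mem_iff.1 (mem_interior_iff_mem_nhds.1 hs)
  refine ⟨ε, hε, hball ?_⟩
  rw [Metric.mem_closedBall, dist_eq_norm, add_sub_cancel_left, norm_smul, q.2.2.1, mul_one,
    Real.norm_eq_abs, abs_of_pos hε]

theorem inner_add_smul_normal (q : Param ℓ) (x : Space ℓ) (ε : ℝ) :
    inner ℝ (x + ε • (q.2 : Space ℓ)) (q.2 : Space ℓ) = inner ℝ x (q.2 : Space ℓ) + ε := by
  rw [inner_add_left, real_inner_smul_left, inner_self_upperSphere, mul_one]

theorem interior_plane (q : Param ℓ) : interior (plane q) = ∅ := by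
  refine eq_empty_of_forall_notMem fun x hx => ?_
  obtain ⟨ε, hε, h⟩ := mem_of_mem_interior (q := q) hx
  have hx : x ∈ plane q := interior_subset hx
  have hx : inner ℝ x (q.2 : Space ℓ) = q.1 := hx
  have h : inner ℝ (x + ε • (q.2 : Space ℓ)) (q.2 : Space ℓ) = q.1 := h
  rw [inner_add_smul_normal] at h
  linarith

theorem frontier_half_subset (q : Param ℓ) (b : Bool) : frontier (half q b) ⊆ plane q := by
  cases b
  · exact frontier_le_subset_eq (by fun_prop) continuous_const
  · exact (frontier_le_subset_eq continuous_const (by fun_prop)).trans fun x hx => Eq.symm hx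

theorem disjoint_interior_cell {h : Word → Hyperplane ℓ} {e e' : Word} (he : ¬ e <:+ e')
    (he' : ¬ e' <:+ e) : Disjoint (interior (cell p W h e)) (interior (cell p W h e')) := by
  obtain ⟨b, f, h1, h2⟩ := Word.exists_split he he'
  rw [disjoint_iff_inter_eq_empty, ← interior_inter, ← subset_empty_iff,
    ← interior_plane (p (h f)), ← half_inter_half _ b]
  exact interior_mono (inter_subset_inter
    ((cell_subset_of_suffix h1).trans inter_subset_right)
    ((cell_subset_of_suffix h2).trans inter_subset_right))

/-- Dividing a closed cell adds the dividing face to the union of the cell boundaries. -/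
theorem frontier_inter_half_union {C : Set (Space ℓ)} (hC : IsClosed C) (q : Param ℓ) :
    frontier (C ∩ half q false) ∪ frontier (C ∩ half q true) = frontier C ∪ (C ∩ plane q) := by
  have hcl : ∀ b, IsClosed (C ∩ half q b) := fun b => hC.inter (isClosed_half_fixed q b)
  refine Subset.antisymm ?_ ?_
  · have h : ∀ b, frontier (C ∩ half q b) ⊆ frontier C ∪ (C ∩ plane q) := by
      intro b x hx
      rcases frontier_inter_subset _ _ hx with h1 | h1
      · exact Or.inl h1.1
      · rw [hC.closure_eq] at h1
        exact Or.inr ⟨h1.1, frontier_half_subset q b h1.2⟩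
    exact union_subset (h false) (h true)
  · rintro x (hx | ⟨hxC, hx⟩)
    · have h : ∀ b, x ∈ half q b → x ∈ frontier (C ∩ half q b) := by
        intro b hb
        rw [(hcl b).frontier_eq]
        rw [hC.frontier_eq] at hx
        exact ⟨⟨hx.1, hb⟩, fun h' => hx.2 (interior_mono inter_subset_left h')⟩
      have hu : x ∈ half q false ∪ half q true := by rw [half_union_half]; trivial
      exact hu.imp (h false) (h true)
    · left
      rw [(hcl false).frontier_eq]
      have hx : inner ℝ x (q.2 : Space ℓ) = q.1 := hx
      refine ⟨⟨hxC, le_of_eq hx⟩, fun h' => ?_⟩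
      obtain ⟨ε, hε, h2⟩ := mem_of_mem_interior (q := q) h'
      have h2 : inner ℝ (x + ε • (q.2 : Space ℓ)) (q.2 : Space ℓ) ≤ q.1 := h2.2
      rw [inner_add_smul_normal] at h2
      linarith

section Leaves

variable {σ : ℕ → Word} {k : ℕ} {h : Word → Hyperplane ℓ}

theorem IsDivisionOrder.not_suffix_leafWords (hσ : IsDivisionOrder σ k) {s : ℕ} (hs : s ≤ k)
    {r r' : Word} (hr : r ∈ leafWords σ s) (hr' : r' ∈ leafWords σ s) (hne : r ≠ r') :
    ¬ r <:+ r' := fun h => by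
  obtain ⟨j, hj, hrj⟩ := hσ.mem_of_suffix_tree hs ((hσ.mem_leafWords hs).1 hr').1 h hne
  exact ((hσ.mem_leafWords hs).1 hr).2 j hj hrj

theorem IsDivisionOrder.mem_image_of_suffix_leafWords (hσ : IsDivisionOrder σ k) {s : ℕ}
    (hs : s ≤ k) {r f : Word} (hr : r ∈ leafWords σ s) (hf : f <:+ r) (hne : f ≠ r) :
    f ∈ (Finset.range k).image σ := by
  obtain ⟨j, hj, rfl⟩ := hσ.mem_of_suffix_tree hs ((hσ.mem_leafWords hs).1 hr).1 hf hne
  exact Finset.mem_image_of_mem σ (Finset.mem_range.2 (by omega))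

theorem ProperOn.isCell_leaf (hσ : IsDivisionOrder σ k) (hW : IsCell W)
    (hh : ProperOn p W ((Finset.range k).image σ) h) {s : ℕ} (hs : s ≤ k) {r : Word}
    (hr : r ∈ leafWords σ s) : IsCell (cell p W h r) :=
  isCell_cell hW fun f hf hne => hh f (hσ.mem_image_of_suffix_leafWords hs hr hf hne)

theorem ProperOn.injOn_cell (hσ : IsDivisionOrder σ k) (hW : IsCell W)
    (hh : ProperOn p W ((Finset.range k).image σ) h) {s : ℕ} (hs : s ≤ k) :
    InjOn (cell p W h) (leafWords σ s) := by
  intro r hr r' hr' heq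
  by_contra hne
  have hd := disjoint_interior_cell (p := p) (W := W) (h := h)
    (hσ.not_suffix_leafWords hs hr hr' hne) (hσ.not_suffix_leafWords hs hr' hr (Ne.symm hne))
  rw [← heq, disjoint_self] at hd
  exact (hh.isCell_leaf hσ hW hs hr).2.ne_empty hd

/-- After proper divisions, the cells of the leaves form a tessellation of the window. -/
theorem ProperOn.isTessellation (hσ : IsDivisionOrder σ k) (hW : IsCell W)
    (hh : ProperOn p W ((Finset.range k).image σ) h) {s : ℕ} (hs : s ≤ k) :
    IsTessellation W (cell p W h '' leafWords σ s) where
  finite := (Finset.finite_toSet _).image _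
  isCell := by
    rintro _ ⟨r, hr, rfl⟩
    exact hh.isCell_leaf hσ hW hs hr
  disjoint := by
    rintro _ ⟨r, hr, rfl⟩ _ ⟨r', hr', rfl⟩ hne
    have hne : r ≠ r' := fun h => hne (by rw [h])
    exact disjoint_interior_cell (hσ.not_suffix_leafWords hs hr hr' hne)
      (hσ.not_suffix_leafWords hs hr' hr hne.symm)
  cover := by
    refine Subset.antisymm (sUnion_subset ?_) fun x hx => ?_
    · rintro _ ⟨r, -, rfl⟩
      exact cell_subset p W h r
    · clear hh
      induction s with
      | zero => exact ⟨W, ⟨[], by simp [leafWords], rfl⟩, hx⟩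
      | succ s ih =>
        obtain ⟨_, ⟨r, hr, rfl⟩, hxr⟩ := ih (by omega)
        by_cases hrs : r = σ s
        · subst hrs
          have hu : x ∈ half (p (h (σ s))) false ∪ half (p (h (σ s))) true := by
            rw [half_union_half]; trivial
          rcases hu with hu | hu
          · exact ⟨_, ⟨false :: σ s, by simp [leafWords], rfl⟩, hxr, hu⟩
          · exact ⟨_, ⟨true :: σ s, by simp [leafWords], rfl⟩, hxr, hu⟩
        · refine ⟨_, ⟨r, ?_, rfl⟩, hxr⟩
          rw [Finset.mem_coe] at hr ⊢
          simp [leafWords, hrs, hr]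

/-- The boundary of the tessellation in terms of conditions whose measurability is known. -/
theorem boundary_leafWords (hσ : IsDivisionOrder σ k) (hW : IsClosed W) {s : ℕ} (hs : s ≤ k) :
    boundary (cell p W h '' leafWords σ s) =
      frontier W ∪ ⋃ i ∈ Finset.range s, cell p W h (σ i) ∩ plane (p (h (σ i))) := by
  have hb : ∀ L : Finset Word, boundary (cell p W h '' L) = ⋃ r ∈ L, frontier (cell p W h r) := by
    intro L
    simp [boundary]
  simp only [hb]
  induction s with
  | zero => simp [leafWords, cell]
  | succ s ih =>
    have ih := ih (by omega)
    rw [← Finset.insert_erase (hσ.mem_leafWords_self (s := s) (by omega)),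
      Finset.set_biUnion_insert] at ih
    rw [leafWords, Finset.set_biUnion_insert, Finset.set_biUnion_insert, ← union_assoc]
    change frontier (cell p W h (σ s) ∩ half (p (h (σ s))) false) ∪
      frontier (cell p W h (σ s) ∩ half (p (h (σ s))) true) ∪ _ = _
    rw [frontier_inter_half_union (isClosed_cell p hW h (σ s)), Finset.range_add_one,
      Finset.set_biUnion_insert, union_right_comm, ih, union_assoc]
    congr 1
    exact union_comm _ _

theorem measurableSet_boundary_inter_eq_empty (hσ : IsDivisionOrder σ k) (hp : Measurable p)
    (hW : IsCompact W) {K : Set (Space ℓ)} (hK : IsCompact K) :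
    MeasurableSet {h : Word → Hyperplane ℓ | boundary (cell p W h '' leafWords σ k) ∩ K = ∅} := by
  have hm : ∀ e : Word, MeasurableSet {h : Word → Hyperplane ℓ |
      ∃ x ∈ cell p W h e, (x, p (h e)) ∈ {r : Space ℓ × Param ℓ | r.1 ∈ K ∧ r.1 ∈ plane r.2}} :=
    fun e => measurableSet_exists_mem_cell hp hW measurable_id (hp.comp (measurable_pi_apply e)) e
      ((hK.isClosed.preimage continuous_fst).inter isClosed_inner_eq)
  have heq : {h : Word → Hyperplane ℓ | boundary (cell p W h '' leafWords σ k) ∩ K = ∅} =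
      {_h | frontier W ∩ K = ∅} ∩ ⋂ i ∈ Finset.range k, {h : Word → Hyperplane ℓ |
        ∃ x ∈ cell p W h (σ i),
          (x, p (h (σ i))) ∈ {r : Space ℓ × Param ℓ | r.1 ∈ K ∧ r.1 ∈ plane r.2}}ᶜ := by
    ext h
    rw [mem_ofPred_eq, boundary_leafWords hσ hW.isClosed le_rfl, union_inter_distrib_right,
      union_empty_iff]
    refine and_congr Iff.rfl ?_
    rw [iUnion₂_inter, mem_iInter₂]
    simp only [iUnion_eq_empty]
    refine forall₂_congr fun i hi => ?_
    rw [eq_empty_iff_forall_notMem]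
    simp only [mem_compl_iff, mem_ofPred_eq, not_exists, not_and, mem_inter_iff]
    exact ⟨fun H x hx hK hpl => H x ⟨hx, hpl⟩ hK, fun H x hx hK => H x hx.1 hK hx.2⟩
  rw [heq]
  exact (MeasurableSet.const _).inter (Finset.measurableSet_biInter _ fun i _ => (hm _).compl)

theorem cell_image_leafWords_congr (hσ : IsDivisionOrder σ k) {h h' : Word → Hyperplane ℓ}
    (hh : ∀ e ∈ (Finset.range k).image σ, h e = h' e) {s : ℕ} (hs : s ≤ k) :
    cell p W h '' leafWords σ s = cell p W h' '' leafWords σ s :=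
  image_congr fun _ hr => cell_congr_suffix p W _ fun f hf hne =>
    hh f (hσ.mem_image_of_suffix_leafWords hs hr hf hne)

/-- The dividing hyperplanes for which the divisions of `σ` are proper and lead to a tessellation
in `A`. -/
def tessEvent (p : Hyperplane ℓ → Param ℓ) (W : Set (Space ℓ)) (σ : ℕ → Word) (k : ℕ)
    (A : Set (Tessellation W)) : Set (Word → Hyperplane ℓ) :=
  {h | ProperOn p W ((Finset.range k).image σ) h ∧
    cell p W h '' leafWords σ k ∈ Subtype.val '' A}

/-- On the measurable set of proper divisions, the tessellation is a measurable function of the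
hyperplanes. -/
theorem measurableSet_tessEvent (hσ : IsDivisionOrder σ k) (hp : Measurable p) (hW : IsCell W)
    {A : Set (Tessellation W)} (hA : MeasurableSet A) : MeasurableSet (tessEvent p W σ k A) := by
  let S : Set (Word → Hyperplane ℓ) := {h | ProperOn p W ((Finset.range k).image σ) h}
  have hS : MeasurableSet S := measurableSet_properOn hp hW.isCompact _
  let τ : S → Tessellation W := fun h =>
    ⟨cell p W h.1 '' leafWords σ k, ProperOn.isTessellation hσ hW h.2 le_rfl⟩
  have hτ : Measurable τ := by
    refine measurable_generateFrom ?_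
    rintro _ ⟨K, -, hK, rfl⟩
    exact measurable_subtype_coe
      (measurableSet_boundary_inter_eq_empty (p := p) hσ hp hW.isCompact hK)
  have heq : tessEvent p W σ k A = Subtype.val '' (τ ⁻¹' A) := by
    ext h
    constructor
    · rintro ⟨h1, T, hT, h2⟩
      refine ⟨⟨h, h1⟩, ?_, rfl⟩
      have : τ ⟨h, h1⟩ = T := Subtype.ext h2.symm
      rw [mem_preimage, this]
      exact hT
    · rintro ⟨h', h1, rfl⟩
      exact ⟨h'.2, _, h1, rfl⟩
  rw [heq]
  exact hS.subtype_image (hτ hA)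

theorem dependsOn_tessEvent (hσ : IsDivisionOrder σ k) (A : Set (Tessellation W)) :
    DependsOn (fun h => h ∈ tessEvent p W σ k A) ((Finset.range k).image σ) := by
  intro h h' hh
  have h1 := dependsOn_properOn (p := p) (W := W) hσ.prefixClosed hh
  have h2 := cell_image_leafWords_congr (p := p) (W := W) hσ (h := h) (h' := h') hh le_rfl
  simp only [tessEvent, mem_ofPred_eq, h1, h2]

/-! ### Rates of division -/

/-- The rate `Λ([C(e)])` at which the cell of `e` is divided. -/
noncomputable def rate (Λ : Measure (Hyperplane ℓ)) (p : Hyperplane ℓ → Param ℓ)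
    (W : Set (Space ℓ)) (h : Word → Hyperplane ℓ) (e : Word) : ℝ :=
  (Λ (hit (cell p W h e))).toReal

variable {Λ : Measure (Hyperplane ℓ)}

theorem measure_hit_cell_lt_top (hΛ : IsHyperplaneMeasure Λ) (hW : IsCell W)
    (h : Word → Hyperplane ℓ) (e : Word) : Λ (hit (cell p W h e)) < ∞ :=
  measure_hit_lt_top hΛ (isCompact_cell p hW.isCompact h e)

theorem ofReal_rate (hΛ : IsHyperplaneMeasure Λ) (hW : IsCell W)
    (h : Word → Hyperplane ℓ) (e : Word) :
    ENNReal.ofReal (rate Λ p W h e) = Λ (hit (cell p W h e)) :=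
  ENNReal.ofReal_toReal (measure_hit_cell_lt_top hΛ hW h e).ne

theorem rate_pos (hΛ : IsHyperplaneMeasure Λ) (hW : IsCell W) {h : Word → Hyperplane ℓ} {e : Word}
    (he : IsCell (cell p W h e)) : 0 < rate Λ p W h e :=
  ENNReal.toReal_pos (he.measure_hit_pos hΛ).ne' (measure_hit_cell_lt_top hΛ hW h e).ne

theorem rate_le (hΛ : IsHyperplaneMeasure Λ) (hW : IsCell W) (h : Word → Hyperplane ℓ) (e : Word) :
    rate Λ p W h e ≤ (Λ (hit W)).toReal :=
  ENNReal.toReal_mono (measure_hit_lt_top hΛ hW.isCompact).ne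
    (measure_mono (hit_mono (cell_subset p W h e)))

/-- Only the finite restriction of `Λ` to `[W]` matters for the rates. -/
theorem measurable_rate (hΛ : IsHyperplaneMeasure Λ) (hp : Measurable p)
    (hp_param : ∀ k, ofParam (p k) = k) (hW : IsCell W) :
    Measurable fun h : Word → Hyperplane ℓ => rate Λ p W h := by
  have : IsFiniteMeasure (Λ.restrict (hit W)) :=
    ⟨by rw [Measure.restrict_apply_univ]; exact measure_hit_lt_top hΛ hW.isCompact⟩
  refine measurable_pi_iff.2 fun e => ?_
  have h1 : ∀ h : Word → Hyperplane ℓ,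
      Λ (hit (cell p W h e)) = Λ.restrict (hit W) (hit (cell p W h e)) := fun h => by
    rw [Measure.restrict_apply (measurableSet_hit (isCompact_cell p hW.isCompact h e)),
      inter_eq_left.2 (hit_mono (cell_subset p W h e))]
  simp only [rate, h1]
  exact (measurable_measure_hit_cell hp hp_param hW.isCompact measurable_id _ e).ennreal_toReal

theorem rate_congr {h h' : Word → Hyperplane ℓ} {e : Word}
    (hh : ∀ f, f <:+ e → f ≠ e → h f = h' f) : rate Λ p W h e = rate Λ p W h' e := by
  rw [rate, rate, cell_congr_suffix p W e hh]

theorem zeta_leafWords (hΛ : IsHyperplaneMeasure Λ) (hσ : IsDivisionOrder σ k) (hW : IsCell W)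
    (hh : ProperOn p W ((Finset.range k).image σ) h) {s : ℕ} (hs : s ≤ k) :
    (zeta Λ (cell p W h '' leafWords σ s)).toReal = ∑ r ∈ leafWords σ s, rate Λ p W h r := by
  rw [zeta, tsum_image (fun C => Λ (hit C)) (hh.injOn_cell hσ hW hs)]
  change (∑' r : (leafWords σ s : Set Word), Λ (hit (cell p W h r))).toReal = _
  rw [Finset.tsum_subtype' (leafWords σ s) fun r => Λ (hit (cell p W h r)),
    ENNReal.toReal_sum fun r _ => (measure_hit_cell_lt_top hΛ hW h r).ne]
  rfl

theorem deathTime_congr {rate rate' z : Word → ℝ} {e : Word}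
    (h : ∀ f, f <:+ e → rate f = rate' f) : deathTime rate z e = deathTime rate' z e := by
  induction e with
  | nil => simp [deathTime, h [] List.suffix_rfl]
  | cons b e ih =>
    rw [deathTime, deathTime, ih fun f hf => h f (hf.trans (List.suffix_cons b e)),
      h _ List.suffix_rfl]

theorem isHistory_congr (hσ : IsDivisionOrder σ k) {t : ℝ} {h h' : Word → Hyperplane ℓ}
    (hh : ∀ e ∈ (Finset.range k).image σ, h e = h' e) (z : Word → ℝ) :
    IsHistory σ t k (deathTime (rate Λ p W h) z) ↔
      IsHistory σ t k (deathTime (rate Λ p W h') z) := by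
  have hD : ∀ i < k, ∀ f, f <:+ σ i → f ∈ (Finset.range k).image σ := fun i hi f hf =>
    hσ.prefixClosed.mem_of_suffix (Finset.mem_image_of_mem σ (Finset.mem_range.2 hi)) hf
  refine and_congr (inOrder_congr fun i hi => deathTime_congr fun f hf =>
    rate_congr fun f' hf' _ => hh f' (hD i hi f' (hf'.trans hf))) (forall₂_congr fun r hr => ?_)
  rw [deathTime_congr fun f hf => rate_congr fun f' hf' hne => hh f'
    (hσ.mem_image_of_suffix_leafWords le_rfl hr (hf'.trans hf) ?_)]
  rintro rfl
  exact hne (hf'.eq_of_length (le_antisymm hf'.length_le hf.length_le))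

end Leaves

end STIT

namespace STIT

variable {ℓ : ℕ} {p : Hyperplane ℓ → Param ℓ} {W : Set (Space ℓ)} {Λ : Measure (Hyperplane ℓ)}

/-! ### The division times of the STIT process -/

theorem birth_eq_startTime (z : Word → ℝ) (g : ℕ → Hyperplane ℓ) (e : Word) :
    birth Λ p W z g e = startTime (deathTime (rate Λ p W (divider p W g)) z) e := by
  induction e with
  | nil => rfl
  | cons b e ih =>
    rw [birth, ih, show startTime (deathTime (rate Λ p W (divider p W g)) z) (b :: e) =
      deathTime (rate Λ p W (divider p W g)) z e from rfl, deathTime_eq]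
    rfl

theorem birth_add_lifetime_eq_deathTime (z : Word → ℝ) (g : ℕ → Hyperplane ℓ) (e : Word) :
    birth Λ p W z g e + lifetime Λ p W z g e =
      deathTime (rate Λ p W (divider p W g)) z e := by
  rw [birth_eq_startTime, deathTime_eq]
  rfl

theorem leafWords_congr {σ σ' : ℕ → Word} {k : ℕ} (h : ∀ i < k, σ i = σ' i) :
    leafWords σ k = leafWords σ' k := by
  induction k with
  | zero => rfl
  | succ k ih => rw [leafWords, leafWords, h k (by omega), ih fun i hi => h i (by omega)]

theorem IsHistory.congr_order {σ σ' : ℕ → Word} {k : ℕ} {t : ℝ} {d : Word → ℝ}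
    (hd : IsHistory σ t k d) (h : ∀ i < k, σ i = σ' i) : IsHistory σ' t k d := by
  refine ⟨fun i hi => ?_, leafWords_congr h ▸ hd.2⟩
  have hprev : prevTime σ' d i = prevTime σ d i := by
    cases i with
    | zero => rfl
    | succ i => simp only [prevTime, h i (by omega)]
  rw [hprev, ← h i hi]
  exact hd.1 i hi

theorem measurableSet_isHistory (σ : ℕ → Word) (t : ℝ) (k : ℕ) :
    MeasurableSet {d | IsHistory σ t k d} := by
  have : {d | IsHistory σ t k d} =
      {d | InOrder σ t k d} ∩ ⋂ r ∈ leafWords σ k, {d | t < d r} := by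
    ext d; simp [IsHistory]
  rw [this]
  exact (measurableSet_inOrder σ t k).inter (Finset.measurableSet_biInter _ fun r _ =>
    measurableSet_lt measurable_const (measurable_pi_apply r))

/-- Outside a null set of inputs, the process at time `t` has `k + 1` cells and lies in `A` if and
only if, for some growth sequence, the divisions up to time `t` are those of the sequence, in its
order, and lead to a tessellation in `A`. -/
theorem stit_mem_iff_exists_growth (hΛ : IsHyperplaneMeasure Λ) (hW : IsCell W)
    {g : ℕ → Hyperplane ℓ} {z : Word → ℝ}
    (hcuts : ∀ e, Cuts (p (divider p W g e)) (stitCell p W g e)) (hz : ∀ e, 0 < z e)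
    (hfin : ∀ c : ℝ, {e | startTime (deathTime (fun _ => 1) z) e ≤ c}.Finite)
    (hinj : Function.Injective (deathTime (rate Λ p W (divider p W g)) z))
    {t : ℝ} (ht : 0 ≤ t) (k : ℕ) (A : Set (Tessellation W)) :
    ((stit Λ p W z g t).encard = (k + 1 : ℕ) ∧ stit Λ p W z g t ∈ Subtype.val '' A) ↔
      ∃ R : {R : Fin (2 * k + 1) → Word // IsGrowth R},
        IsHistory (splitWord R.1) t k (deathTime (rate Λ p W (divider p W g)) z) ∧
          divider p W g ∈ tessEvent p W (splitWord R.1) k A := by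
  set h := divider p W g with hh
  set d := deathTime (rate Λ p W h) z with hd
  have hcell : ∀ e, IsCell (cell p W h e) := fun e => isCell_cell hW fun f _ _ => hcuts f
  have hr : ∀ e, 0 < rate Λ p W h e := fun e => rate_pos hΛ hW (hcell e)
  have hlt : ∀ e, startTime d e < d e := fun e => by
    rw [hd, deathTime_eq]
    exact lt_add_of_pos_right _ (mul_pos (inv_pos.2 (hr e)) (hz e))
  have halive : alive Λ p W z g t = {e | startTime d e ≤ t ∧ t < d e} := by
    simp only [alive, birth_add_lifetime_eq_deathTime]
    simp only [birth_eq_startTime, hd, hh]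
  have hproper : ∀ D, ProperOn p W D h := fun D e _ => hcuts e
  have hstit : ∀ {n : ℕ} {σ : ℕ → Word}, IsDivisionOrder σ n → IsHistory σ t n d →
      stit Λ p W z g t = cell p W h '' leafWords σ n := by
    intro n σ hσ hist
    rw [stit, halive, hσ.setOf_alive_eq hlt ht hist]
    rfl
  have hcard : ∀ {n : ℕ} {σ : ℕ → Word}, IsDivisionOrder σ n → IsHistory σ t n d →
      (stit Λ p W z g t).encard = (n + 1 : ℕ) := by
    intro n σ hσ hist
    rw [hstit hσ hist, ((hproper _).injOn_cell hσ hW le_rfl).encard_image,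
      Set.encard_coe_eq_coe_finsetCard, hσ.card_leafWords le_rfl]
  constructor
  · rintro ⟨hk, hA⟩
    obtain ⟨n, σ, hσ, hist⟩ := exists_isHistory hlt hinj (finite_startTime_le_of_rate_le hr
      (rate_le hΛ hW h) hz hfin t)
    have hnk : n = k := by
      rw [hcard hσ hist, Nat.cast_inj] at hk
      omega
    subst hnk
    obtain ⟨R, hR, hRσ⟩ := hσ.exists_growth
    have hist' := hist.congr_order fun i hi => (hRσ i hi).symm
    refine ⟨⟨R, hR⟩, hist', hproper _, ?_⟩
    rwa [← hstit hR.isDivisionOrder hist']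
  · rintro ⟨R, hist, hmem⟩
    refine ⟨hcard R.2.isDivisionOrder hist, ?_⟩
    rw [hstit R.2.isDivisionOrder hist]
    exact hmem.2

/-! ### Integration over the hyperplanes and the times -/

theorem iterLintegral_zero {X : Type*} [MeasurableSpace X] (μ : ∀ s : ℕ, (Fin s → X) → Measure X)
    (k : ℕ) : iterLintegral μ k (fun _ => 0) = 0 := by
  induction k with
  | zero => rfl
  | succ k ih => simpa only [iterLintegral, lintegral_zero] using ih

/-- The probability that the divisions up to time `t` are those of `σ`, as a function of the
dividing hyperplanes, restricted to the event that they lead to a tessellation in `A`. -/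
noncomputable def historyProb (Λ : Measure (Hyperplane ℓ)) (p : Hyperplane ℓ → Param ℓ)
    (W : Set (Space ℓ)) (σ : ℕ → Word) (t : ℝ) (k : ℕ) (A : Set (Tessellation W))
    (h : Word → Hyperplane ℓ) : ℝ≥0∞ :=
  Measure.infinitePi (fun _ : Word => expMeasure 1)
    {z | IsHistory σ t k (deathTime (rate Λ p W h) z) ∧ h ∈ tessEvent p W σ k A}

theorem measurableSet_historyEvent (hΛ : IsHyperplaneMeasure Λ) (hp : Measurable p)
    (hp_param : ∀ k, ofParam (p k) = k) (hW : IsCell W) {σ : ℕ → Word} {k : ℕ}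
    (hσ : IsDivisionOrder σ k) (t : ℝ) {A : Set (Tessellation W)} (hA : MeasurableSet A) :
    MeasurableSet {r : (Word → Hyperplane ℓ) × (Word → ℝ) |
      IsHistory σ t k (deathTime (rate Λ p W r.1) r.2) ∧ r.1 ∈ tessEvent p W σ k A} :=
  ((measurableSet_isHistory σ t k).preimage (measurable_deathTime
    ((measurable_rate hΛ hp hp_param hW).comp measurable_fst) measurable_snd)).inter
    ((measurableSet_tessEvent hσ hp hW hA).preimage measurable_fst)

theorem measurable_historyProb (hΛ : IsHyperplaneMeasure Λ) (hp : Measurable p)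
    (hp_param : ∀ k, ofParam (p k) = k) (hW : IsCell W) {σ : ℕ → Word} {k : ℕ}
    (hσ : IsDivisionOrder σ k) (t : ℝ) {A : Set (Tessellation W)} (hA : MeasurableSet A) :
    Measurable (historyProb Λ p W σ t k A) :=
  measurable_measure_prodMk_left (measurableSet_historyEvent hΛ hp hp_param hW hσ t hA)

theorem dependsOn_historyProb {σ : ℕ → Word} {k : ℕ} (hσ : IsDivisionOrder σ k) (t : ℝ)
    (A : Set (Tessellation W)) :
    DependsOn (historyProb Λ p W σ t k A) ((Finset.range k).image σ) := by
  intro h h' hh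
  have h1 := dependsOn_tessEvent (p := p) hσ A hh
  simp only [eq_iff_iff] at h1
  simp only [historyProb, isHistory_congr hσ hh, h1]

theorem growthTess_eq {k : ℕ} {R : Fin (2 * k + 1) → Word} (hR : IsGrowth R)
    {H : Fin k → Hyperplane ℓ} {h : Word → Hyperplane ℓ} (hH : ∀ i : Fin k, h (splitWord R i) = H i)
    {s : ℕ} (hs : s ≤ k) : growthTess p W R H s hs = cell p W h '' leafWords (splitWord R) s := by
  rw [growthTess, hR.leaves_initial]
  refine image_congr fun r hr => growthCell_eq_cell hH fun f hf hne => ?_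
  obtain ⟨i, hi, hfi⟩ := hR.isDivisionOrder.mem_of_suffix_tree hs
    ((hR.isDivisionOrder.mem_leafWords hs).1 hr).1 hf hne
  exact ⟨i, by omega, hfi⟩

/-- For proper divisions, the probability of the history is the iterated integral over the waiting
times. -/
theorem historyProb_eq_timeIntegral (hΛ : IsHyperplaneMeasure Λ) (hW : IsCell W) {k : ℕ}
    {R : Fin (2 * k + 1) → Word} (hR : IsGrowth R) {H : Fin k → Hyperplane ℓ}
    {h : Word → Hyperplane ℓ} (hH : ∀ i : Fin k, h (splitWord R i) = H i)
    (hh : ProperOn p W ((Finset.range k).image (splitWord R)) h) {t : ℝ} (ht : 0 ≤ t)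
    (A : Set (Tessellation W)) :
    historyProb Λ p W (splitWord R) t k A h = timeIntegral t k fun w =>
      (∏ s : Fin k, Λ (hit (growthCell p W R H (splitWord R s)))) *
      ENNReal.ofReal (Real.exp (-∑ s : Fin k,
        (zeta Λ (growthTess p W R H s s.2.le)).toReal * w s)) *
      ENNReal.ofReal (Real.exp (-((zeta Λ (growthTess p W R H k le_rfl)).toReal *
        (t - ∑ s, w s)))) *
      (Subtype.val '' A).indicator (fun _ => (1 : ℝ≥0∞)) (growthTess p W R H k le_rfl) := by
  have hσ := hR.isDivisionOrder
  have hcellσ : ∀ i < k, IsCell (cell p W h (splitWord R i)) := fun i hi =>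
    hh.isCell_leaf hσ hW hi.le (hσ.mem_leafWords_self hi)
  have htess : ∀ {s : ℕ} (hs : s ≤ k), growthTess p W R H s hs =
      cell p W h '' leafWords (splitWord R) s := fun hs => growthTess_eq hR hH hs
  have hcell : ∀ s : Fin k, Λ (hit (growthCell p W R H (splitWord R s))) =
      ENNReal.ofReal (rate Λ p W h (splitWord R s)) := fun s => by
    rw [ofReal_rate hΛ hW, growthCell_eq_cell hH fun f hf hne => ?_]
    obtain ⟨j, hj, hfj⟩ := hσ.mem_of_suffix s.2 hf
    exact ⟨j, by omega, hfj⟩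
  have hzeta : ∀ {s : ℕ} (hs : s ≤ k), (zeta Λ (growthTess p W R H s hs)).toReal =
      ∑ r ∈ leafWords (splitWord R) s, rate Λ p W h r := fun hs => by
    rw [htess hs, zeta_leafWords hΛ hσ hW hh hs]
  simp only [hcell, hzeta]
  rw [htess le_rfl]
  by_cases hA : cell p W h '' leafWords (splitWord R) k ∈ Subtype.val '' A
  · have hm : h ∈ tessEvent p W (splitWord R) k A := ⟨hh, hA⟩
    simp only [historyProb, hm, and_true, indicator_of_mem hA, mul_one]
    exact measure_inOrder_and_leaves hσ ht (fun i hi => rate_pos hΛ hW (hcellσ i hi))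
      fun r hr => rate_pos hΛ hW (hh.isCell_leaf hσ hW le_rfl hr)
  · have hm : h ∉ tessEvent p W (splitWord R) k A := fun hm => hA hm.2
    simp only [historyProb, hm, and_false, indicator_of_notMem hA, mul_zero]
    rw [timeIntegral, iterLintegral_zero]
    exact measure_empty

/-- Along a growth sequence the divisions are proper for almost all hyperplanes, so that the formula
for proper divisions may be integrated. -/
theorem lintegral_historyProb_divider (hΛ : IsHyperplaneMeasure Λ) (hp : Measurable p)
    (hp_param : ∀ k, ofParam (p k) = k) (hW : IsCell W) {k : ℕ}
    {R : Fin (2 * k + 1) → Word} (hR : IsGrowth R) {t : ℝ} (ht : 0 ≤ t)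
    {A : Set (Tessellation W)} (hA : MeasurableSet A) :
    ∫⁻ g, historyProb Λ p W (splitWord R) t k A (divider p W g)
        ∂(Measure.infinitePi fun _ : ℕ => normalized Λ W) =
      planeIntegral Λ p W R fun H => timeIntegral t k fun w =>
        (∏ s : Fin k, Λ (hit (growthCell p W R H (splitWord R s)))) *
        ENNReal.ofReal (Real.exp (-∑ s : Fin k,
          (zeta Λ (growthTess p W R H s s.2.le)).toReal * w s)) *
        ENNReal.ofReal (Real.exp (-((zeta Λ (growthTess p W R H k le_rfl)).toReal *
          (t - ∑ s, w s)))) *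
        (Subtype.val '' A).indicator (fun _ => (1 : ℝ≥0∞)) (growthTess p W R H k le_rfl) := by
  have hσ := hR.isDivisionOrder
  obtain ⟨x₀⟩ : Nonempty (Hyperplane ℓ) := by
    by_contra hne
    rw [not_nonempty_iff] at hne
    exact hΛ.ne_zero (Measure.eq_zero_of_isEmpty Λ)
  have hFm := measurable_historyProb hΛ hp hp_param hW hσ t hA
  have hFd := dependsOn_historyProb (Λ := Λ) (p := p) hσ t A
  rw [hasDividerLaw hΛ hp hp_param hW hσ.prefixClosed _ hFm hFd,
    ← iterLintegral_normalized_eq hΛ hp hp_param hW hR x₀ le_rfl hFm hFd]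
  refine iterLintegral_congr_of_ae _ (fun s x => s ≤ k → ProperOn p W
    ((Finset.range s).image (splitWord R)) (extend (splitWord R) x₀ s x)) ?_ k ?_ ?_
  · intro x _ e he
    simp at he
  · intro s hs x hx
    have hx := hx hs.le
    have hσs := hσ.mono hs.le
    have hsuf : ∀ f, f <:+ splitWord R s → f ≠ splitWord R s → ∃ i < s, f = splitWord R i :=
      fun f hf hne => by
        obtain ⟨i, hi, hfi⟩ := hσ.mem_of_suffix hs hf
        refine ⟨i, lt_of_le_of_ne hi ?_, hfi⟩
        rintro rfl
        exact hne hfi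
    have hc : growthCell p W R x (splitWord R s) =
        cell p W (extend (splitWord R) x₀ s x) (splitWord R s) :=
      growthCell_eq_cell (fun i : Fin s => extend_apply hσ x₀ hs.le x i) hsuf
    have hcell : IsCell (cell p W (extend (splitWord R) x₀ s x) (splitWord R s)) :=
      hx.isCell_leaf hσs hW le_rfl (hσ.mem_leafWords_self hs)
    have hmeas := measurableSet_hit hcell.isCompact
    rw [hc]
    have hae : ∀ᵐ y ∂(normalized Λ (cell p W (extend (splitWord R) x₀ s x) (splitWord R s))),
        Cuts (p y) (cell p W (extend (splitWord R) x₀ s x) (splitWord R s)) :=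
      (Measure.smul_absolutelyContinuous (c := (Λ (hit (cell p W (extend (splitWord R) x₀ s x)
        (splitWord R s))))⁻¹)).ae_le ((ae_restrict_iff' hmeas).2 (hcell.ae_cuts hΛ p hp_param))
    filter_upwards [hae] with y hy _ e he
    rw [extend_snoc]
    simp only [Finset.mem_image, Finset.mem_range] at he
    obtain ⟨i, hi, rfl⟩ := he
    rcases Nat.lt_succ_iff_lt_or_eq.1 hi with h | rfl
    · have hne : ¬ splitWord R s <:+ splitWord R i := hσ.not_suffix h hs
      have hne' : splitWord R i ≠ splitWord R s := fun h' => hne (by rw [h'])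
      rw [Function.update_of_ne hne',
        cell_update_of_not_suffix fun h' => absurd h' hne]
      exact hx _ (Finset.mem_image_of_mem _ (Finset.mem_range.2 h))
    · rw [Function.update_self, cell_update_of_not_suffix fun _ => rfl]
      exact hy
  · intro H hH
    exact historyProb_eq_timeIntegral hΛ hW hR (fun i => extend_apply hσ x₀ le_rfl H i) (hH le_rfl)
      ht A

/-! ### The random input -/

theorem IsStitInput.map_eq {Ω : Type*} [MeasurableSpace Ω] {P : Measure Ω} [IsProbabilityMeasure P]
    {Z : Word → Ω → ℝ} {G : ℕ → Ω → Hyperplane ℓ} (hZG : IsStitInput P Λ W Z G) :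
    P.map (fun ω => ((fun n => G n ω), fun e => Z e ω)) =
      (Measure.infinitePi fun _ : ℕ => normalized Λ W).prod
        (Measure.infinitePi fun _ : Word => expMeasure 1) := by
  have hZ : Measurable fun ω e => Z e ω := measurable_pi_iff.2 hZG.measurable_Z
  have hG : Measurable fun ω n => G n ω := measurable_pi_iff.2 hZG.measurable_G
  rw [(indepFun_iff_map_prod_eq_prod_map_map hG.aemeasurable hZ.aemeasurable).1 hZG.indep.symm,
    hZG.indep_G.map_fun_eq_infinitePi_map hZG.measurable_G,
    hZG.indep_Z.map_fun_eq_infinitePi_map hZG.measurable_Z]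
  simp_rw [hZG.law_G, hZG.law_Z]

/-- Almost surely no two cells are divided at the same time. -/
theorem ae_injective_deathTime_divider (hΛ : IsHyperplaneMeasure Λ) (hp : Measurable p)
    (hp_param : ∀ k, ofParam (p k) = k) (hW : IsCell W) :
    ∀ᵐ r ∂((Measure.infinitePi fun _ : ℕ => normalized Λ W).prod
        (Measure.infinitePi fun _ : Word => expMeasure 1)),
      Function.Injective (deathTime (rate Λ p W (divider p W r.1)) r.2) := by
  have := isProbabilityMeasure_normalized hΛ hW
  have hm : Measurable fun r : (ℕ → Hyperplane ℓ) × (Word → ℝ) =>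
      deathTime (rate Λ p W (divider p W r.1)) r.2 :=
    measurable_deathTime ((measurable_rate hΛ hp hp_param hW).comp
      ((measurable_divider hp hp_param hW.isCompact).comp measurable_fst)) measurable_snd
  have hs : MeasurableSet {d : Word → ℝ | Function.Injective d} := by
    have : {d : Word → ℝ | Function.Injective d} =
        ⋂ e, ⋂ e', ⋂ _ : e ≠ e', {d : Word → ℝ | d e = d e'}ᶜ := by
      ext d
      simp only [mem_ofPred_eq, mem_iInter, mem_compl_iff]
      exact ⟨fun h e e' hne heq => hne (h heq), fun h e e' heq => by
        by_contra hne
        exact h e e' hne heq⟩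
    rw [this]
    exact MeasurableSet.iInter fun e => MeasurableSet.iInter fun e' => MeasurableSet.iInter fun _ =>
      (measurableSet_eq_fun (measurable_pi_apply e) (measurable_pi_apply e')).compl
  refine (Measure.ae_prod_mem_iff_ae_ae_mem (hs.preimage hm)).2 ?_
  filter_upwards [ae_cuts_divider hΛ hp hp_param hW] with g hg
  exact ae_injective_deathTime fun e => rate_pos hΛ hW (isCell_cell hW fun f _ _ => hg f)

/-- The inputs for which the divisions up to time `t` are those of `σ`, in this order, and lead to
a tessellation in `A`. -/
def inputEvent (Λ : Measure (Hyperplane ℓ)) (p : Hyperplane ℓ → Param ℓ) (W : Set (Space ℓ))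
    (σ : ℕ → Word) (t : ℝ) (k : ℕ) (A : Set (Tessellation W)) :
    Set ((ℕ → Hyperplane ℓ) × (Word → ℝ)) :=
  {r | IsHistory σ t k (deathTime (rate Λ p W (divider p W r.1)) r.2) ∧
    divider p W r.1 ∈ tessEvent p W σ k A}

theorem measurableSet_inputEvent (hΛ : IsHyperplaneMeasure Λ) (hp : Measurable p)
    (hp_param : ∀ k, ofParam (p k) = k) (hW : IsCell W) {σ : ℕ → Word} {k : ℕ}
    (hσ : IsDivisionOrder σ k) (t : ℝ) {A : Set (Tessellation W)} (hA : MeasurableSet A) :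
    MeasurableSet (inputEvent Λ p W σ t k A) := by
  have hd := (measurable_divider hp hp_param hW.isCompact).comp
    (measurable_fst : Measurable (Prod.fst : (ℕ → Hyperplane ℓ) × (Word → ℝ) → _))
  have h1 := measurable_deathTime ((measurable_rate hΛ hp hp_param hW).comp hd) measurable_snd
  exact (h1 (measurableSet_isHistory σ t k)).inter (hd (measurableSet_tessEvent hσ hp hW hA))

end STIT

theorem mainTheorem2 {ℓ : ℕ} {Ω : Type*} [MeasurableSpace Ω] (P : Measure Ω)
    [IsProbabilityMeasure P]
    (Λ : Measure (STIT.Hyperplane ℓ)) (hΛ : STIT.IsHyperplaneMeasure Λ)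
    (p : STIT.Hyperplane ℓ → STIT.Param ℓ) (hp : Measurable p)
    (hp_param : ∀ h, STIT.ofParam (p h) = h)
    (W : Set (STIT.Space ℓ)) (hW : STIT.IsCell W)
    (Z : STIT.Word → Ω → ℝ) (G : ℕ → Ω → STIT.Hyperplane ℓ)
    (hZG : STIT.IsStitInput P Λ W Z G)
    (t : ℝ) (ht : 0 ≤ t) (k : ℕ) (hk : 1 ≤ k)
    (A : Set (STIT.Tessellation W)) (hA : MeasurableSet A) :
    P {ω | (STIT.stit Λ p W (fun e => Z e ω) (fun n => G n ω) t).encard = (k + 1 : ℕ) ∧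
        STIT.stit Λ p W (fun e => Z e ω) (fun n => G n ω) t ∈ Subtype.val '' A} =
      ∑' R : {R : Fin (2 * k + 1) → STIT.Word // STIT.IsGrowth R},
        STIT.planeIntegral Λ p W R.1 fun H =>
          STIT.timeIntegral t k fun w =>
            (∏ s : Fin k, Λ (STIT.hit (STIT.growthCell p W R.1 H (STIT.splitWord R.1 s)))) *
            ENNReal.ofReal (Real.exp (-∑ s : Fin k,
              (STIT.zeta Λ (STIT.growthTess p W R.1 H s s.2.le)).toReal * w s)) *
            ENNReal.ofReal (Real.exp (-((STIT.zeta Λ (STIT.growthTess p W R.1 H k le_rfl)).toReal *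
              (t - ∑ s, w s)))) *
            (Subtype.val '' A).indicator (fun _ => (1 : ℝ≥0∞))
              (STIT.growthTess p W R.1 H k le_rfl) := by
  have := STIT.isProbabilityMeasure_normalized hΛ hW
  let μ := (Measure.infinitePi fun _ : ℕ => STIT.normalized Λ W).prod
    (Measure.infinitePi fun _ : STIT.Word => expMeasure 1)
  let φ : Ω → (ℕ → STIT.Hyperplane ℓ) × (STIT.Word → ℝ) :=
    fun ω => ((fun n => G n ω), fun e => Z e ω)
  have hφ : Measurable φ := (measurable_pi_iff.2 hZG.measurable_G).prodMk
    (measurable_pi_iff.2 hZG.measurable_Z)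
  have hmap : P.map φ = μ := hZG.map_eq
  -- the event that belongs to the growth sequence `R`
  let E : {R : Fin (2 * k + 1) → STIT.Word // STIT.IsGrowth R} →
      Set ((ℕ → STIT.Hyperplane ℓ) × (STIT.Word → ℝ)) := fun R =>
    STIT.inputEvent Λ p W (STIT.splitWord R.1) t k A
  have hE : ∀ R, MeasurableSet (E R) := fun R =>
    STIT.measurableSet_inputEvent hΛ hp hp_param hW R.2.isDivisionOrder t hA
  have hcuts : ∀ᵐ r ∂μ, ∀ e, STIT.Cuts (p (STIT.divider p W r.1 e)) (STIT.stitCell p W r.1 e) :=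
    Measure.quasiMeasurePreserving_fst.ae (STIT.ae_cuts_divider hΛ hp hp_param hW)
  have hpos : ∀ᵐ r ∂μ, ∀ e, 0 < r.2 e :=
    Measure.quasiMeasurePreserving_snd.ae STIT.ae_expMeasure_pos
  have hfin : ∀ᵐ r ∂μ, ∀ c : ℝ,
      {e | STIT.startTime (STIT.deathTime (fun _ => 1) r.2) e ≤ c}.Finite :=
    Measure.quasiMeasurePreserving_snd.ae STIT.ae_finite_startTime_le
  have hinj := STIT.ae_injective_deathTime_divider hΛ hp hp_param hW
  have hevent : ∀ᵐ r ∂μ, ((STIT.stit Λ p W r.2 r.1 t).encard = (k + 1 : ℕ) ∧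
      STIT.stit Λ p W r.2 r.1 t ∈ Subtype.val '' A) ↔ r ∈ ⋃ R, E R := by
    filter_upwards [hcuts, hpos, hfin, hinj] with r h1 h2 h3 h4
    rw [STIT.stit_mem_iff_exists_growth hΛ hW h1 h2 h3 h4 ht k A, mem_iUnion]
    rfl
  have hdisj : Pairwise (Function.onFun (AEDisjoint μ) E) := by
    intro R R' hne
    have hae : ∀ᵐ r ∂μ, ¬ r ∈ E R ∩ E R' := by
      filter_upwards [hcuts, hpos] with r h1 h2 h
      refine hne (Subtype.ext (R.2.ext_splitWord R'.2 ?_))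
      refine R.2.isDivisionOrder.eq_of_isHistory R'.2.isDivisionOrder (fun e => ?_) h.1.1 h.2.1
      rw [STIT.deathTime_eq]
      exact lt_add_of_pos_right _ (mul_pos (inv_pos.2 (STIT.rate_pos hΛ hW
        (STIT.isCell_cell hW fun f _ _ => h1 f))) (h2 e))
    exact measure_eq_zero_iff_ae_notMem.2 hae
  calc _ = P (φ ⁻¹' ⋃ R, E R) := by
        refine measure_congr (Filter.eventuallyEq_set.2 ?_)
        rw [← hmap] at hevent
        exact ae_of_ae_map hφ.aemeasurable hevent
    _ = μ (⋃ R, E R) := by rw [← hmap, Measure.map_apply hφ (MeasurableSet.iUnion hE)]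
    _ = ∑' R, μ (E R) := measure_iUnion₀ hdisj fun R => (hE R).nullMeasurableSet
    _ = _ := by
        refine tsum_congr fun R => ?_
        rw [Measure.prod_apply (hE R)]
        exact STIT.lintegral_historyProb_divider hΛ hp hp_param hW R.2 ht hA
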